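/- Let $\omega\subset\mathbb R^2$ be a polygonal domain, i.e. the bounded open region enclosed by a simple closed polygon with sides $\gamma_1,\dots,\gamma_K$, with exactly one re-entrant corner: one interior angle lies in $(\pi,2\pi)$ and all others are smaller than $\pi$. Write $(\cdot,\cdot)$ and $\|\cdot\|_0$ for the inner product and norm of $L^2(\omega)$, $|v|_1^2=\sum_i\|\partial_i v\|_0^2$ and $|v|_2^2=\sum_{i,j}\|\partial_i\partial_j v\|_0^2$. Let $$N=\{p\in L^2(\omega):\ \Delta p=0 \text{ in }\omega,\ p|_{\gamma_k}=0\text{ in }(H^{1/2}_{00}(\gamma_k))',\ 1\le k\le K\},$$ where the trace of a harmonic $p\in L^2(\omega)$ on $\gamma_k$ is defined by duality through $\langle p,\partial_n v\rangle_{\gamma_k}=(p,\Delta v)$ for all $v\in H^2(\omega)\cap H^1_0(\omega)$ with $\partial_n v=0$ on the sides other than $\gamma_k$. Let $p_s\in N\setminus\{0\}$ and let $\phi_s\in H^1_0(\omega)$ solve $-\Delta\phi_s=p_s$ in $\omega$. Let $\mu\ge 0$ and $f\in L^2(\omega)$, and put $a_\mu(w,v)=(\nabla w,\nabla v)+\mu\,(w,v)$,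 $\|v\|_a^2=a_\mu(v,v)$. Then there is exactly one pair $(\tilde u_\mu,c_\mu)\in H^1_0(\omega)\times\mathbb R$ such that $$a_\mu(\tilde u_\mu,v)+c_\mu\,a_\mu(\phi_s,v)=(f,v)\quad\text{for all }v\in H^1_0(\omega),$$ $$\big(\|p_s\|_0^2+\mu\,|\phi_s|_1^2\big)\,c_\mu+\mu\,(\tilde u_\mu,p_s)=(f,p_s).$$ Moreover $\tilde u_\mu\in H^2(\omega)$, and $$|c_\mu|\le 2\,\frac{\|f\|_0}{\|p_s\|_0},\qquad |\tilde u_\mu|_2\le 4\,\|f\|_0,$$ and, if $\mu>0$, $$\|\tilde u_\mu\|_a\le\sqrt2\,\Big(2\sqrt\mu\,C_P^2+\frac1{\sqrt\mu}\Big)\|f\|_0$$ for every constant $C_P$ such that $\|v\|_0\le C_P\,|v|_1$ for all $v\in H^1_0(\omega)$. -/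

import Mathlib

open MeasureTheory Filter Topology Set
open scoped ENNReal

noncomputable section

/-! ### Plane polygonal domains and their corners -/

/-- The Euclidean plane. -/
abbrev Plane : Type := EuclideanSpace ℝ (Fin 2)

/-- The bounded open region `ω` enclosed by the simple closed polygon `poly` (side number `i` joins
the vertices `i` and `i + 1`, cyclically). Three consecutive vertices are never collinear. -/
structure IsPolygonalDomain {K : ℕ} [NeZero K] (poly : Polygon Plane K) (ω : Set Plane) : Prop where
  nondegenerate : poly.HasNondegenerateVertices ℝ
  adjacent_sides : ∀ i, poly.edgeSet ℝ i ∩ poly.edgeSet ℝ (i + 1) = {poly (i + 1)}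
  other_sides : ∀ i j, i ≠ j → i ≠ j + 1 → j ≠ i + 1 →
    Disjoint (poly.edgeSet ℝ i) (poly.edgeSet ℝ j)
  isOpen : IsOpen ω
  isConnected : IsConnected ω
  isBounded : Bornology.IsBounded ω
  frontier_eq : frontier ω = poly.boundary ℝ

/-- The interior angle of `ω` at vertex `i` is smaller than `π`: near the vertex, `ω` is the open
convex sector between the two sides that meet there. -/
def IsConvexCorner {K : ℕ} [NeZero K] (poly : Polygon Plane K) (ω : Set Plane) (i : Fin K) : Prop :=
  ∃ r > 0, ∀ x ∈ Metric.ball (poly i) r,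
    (x ∈ ω ↔ ∃ s t : ℝ, 0 < s ∧ 0 < t ∧
      x = poly i + s • (poly (i - 1) - poly i) + t • (poly (i + 1) - poly i))

/-- The interior angle of `ω` at vertex `i` lies strictly between `π` and `2 * π`: near the vertex,
`ω` is the complement of the closed convex sector between the two sides that meet there. -/
def IsReentrantCorner {K : ℕ} [NeZero K] (poly : Polygon Plane K) (ω : Set Plane) (i : Fin K) :
    Prop :=
  ∃ r > 0, ∀ x ∈ Metric.ball (poly i) r,
    (x ∈ ω ↔ ¬ ∃ s t : ℝ, 0 ≤ s ∧ 0 ≤ t ∧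
      x = poly i + s • (poly (i - 1) - poly i) + t • (poly (i + 1) - poly i))

/-- Exactly one corner of `ω` is re-entrant; every other interior angle is smaller than `π`. -/
def HasUniqueReentrantCorner {K : ℕ} [NeZero K] (poly : Polygon Plane K) (ω : Set Plane) : Prop :=
  ∃ i₀, IsReentrantCorner poly ω i₀ ∧ ∀ i, i ≠ i₀ → IsConvexCorner poly ω i

/-- The relatively open side joining the vertices `i` and `i + 1`. -/
def openSide {K : ℕ} [NeZero K] (poly : Polygon Plane K) (i : Fin K) : Set Plane :=
  openSegment ℝ (poly i) (poly (i + 1))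

/-! ### Lebesgue and Sobolev spaces on `ω` -/

/-- The real Hilbert space `L²(ω)`. -/
abbrev L2 (ω : Set Plane) : Type := Lp ℝ 2 (volume.restrict ω)

/-- The `i`-th vector of the standard basis of the plane. -/
def stdVec (i : Fin 2) : Plane := EuclideanSpace.single i 1

/-- `φ ∈ C_c^∞(ω)`. -/
structure IsTestFunction (ω : Set Plane) (φ : Plane → ℝ) : Prop where
  smooth : ContDiff ℝ (⊤ : ℕ∞) φ
  compact : HasCompactSupport φ
  support : tsupport φ ⊆ ω

/-- `g ∈ L²(ω)` is the weak (distributional) partial derivative `∂ᵢ u` in `ω`. -/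
def HasWeakPartial {ω : Set Plane} (i : Fin 2) (u g : L2 ω) : Prop :=
  ∀ φ, IsTestFunction ω φ →
    ∫ x in ω, u x * fderiv ℝ φ x (stdVec i) = - ∫ x in ω, g x * φ x

/-- A weak partial derivative on an open set is unique. -/
theorem HasWeakPartial.unique {ω : Set Plane} (hω : IsOpen ω) {i : Fin 2} {u g g' : L2 ω}
    (h : HasWeakPartial i u g) (h' : HasWeakPartial i u g') : g = g' := by
  have loc : ∀ v : L2 ω, LocallyIntegrable v (volume.restrict ω) := fun v =>
    (Lp.memLp v).locallyIntegrable (by norm_num)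
  have key : ∀ᵐ x ∂volume, x ∈ ω → (g - g' : L2 ω) x = 0 := by
    refine hω.ae_eq_zero_of_integral_contDiff_smul_eq_zero ?_ ?_
    · rw [locallyIntegrableOn_iff hω.isLocallyClosed]
      intro k hk hc
      have := (loc (g - g')).integrableOn_isCompact hc
      rwa [IntegrableOn, Measure.restrict_restrict hc.measurableSet,
        inter_eq_left.mpr hk] at this
    · intro φ h1 h2 h3
      have int : ∀ v : L2 ω, Integrable (fun x => v x * φ x) (volume.restrict ω) := fun v => by
        have := (loc v).integrable_smul_left_of_hasCompactSupport h1.continuous h2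
        simpa [mul_comm] using this
      have e : ∫ x in ω, g x * φ x = ∫ x in ω, g' x * φ x := by
        have := (h φ ⟨h1, h2, h3⟩).symm.trans (h' φ ⟨h1, h2, h3⟩)
        linarith
      have z : ∫ x in ω, φ x • (g - g' : L2 ω) x = 0 := by
        have : ∫ x in ω, φ x • (g - g' : L2 ω) x = ∫ x in ω, (g x * φ x - g' x * φ x) := by
          refine integral_congr_ae ?_
          filter_upwards [Lp.coeFn_sub g g'] with x hx
          rw [hx]
          simp only [Pi.sub_apply, smul_eq_mul]
          ring
        rw [this, integral_sub (int g) (int g'), e, sub_self]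
      rw [← z]
      symm
      refine setIntegral_eq_integral_of_forall_compl_eq_zero fun x hx => ?_
      rw [image_eq_zero_of_notMem_tsupport fun hm => hx (h3 hm), zero_smul]
  rw [← sub_eq_zero]
  refine (Lp.eq_zero_iff_ae_eq_zero).2 ?_
  exact (ae_restrict_iff' hω.measurableSet).2 key

open Classical in
/-- The weak partial derivative `∂ᵢ u` (and `0` if `u` has none in `L²(ω)`). -/
def weakPartial {ω : Set Plane} (i : Fin 2) (u : L2 ω) : L2 ω :=
  if h : ∃ g, HasWeakPartial i u g then h.choose else 0

theorem HasWeakPartial.weakPartial_eq {ω : Set Plane} (hω : IsOpen ω) {i : Fin 2} {u g : L2 ω}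
    (h : HasWeakPartial i u g) : weakPartial i u = g := by
  have hex : ∃ g, HasWeakPartial i u g := ⟨g, h⟩
  rw [weakPartial, dif_pos hex]
  exact hex.choose_spec.unique hω h

/-- `u ∈ H¹(ω)`. -/
def MemH1 {ω : Set Plane} (u : L2 ω) : Prop :=
  ∀ i, ∃ g, HasWeakPartial i u g

/-- `u ∈ H²(ω)`. -/
def MemH2 {ω : Set Plane} (u : L2 ω) : Prop :=
  MemH1 u ∧ ∀ i, MemH1 (weakPartial i u)

/-- `u ∈ H¹₀(ω)`, the closure of `C_c^∞(ω)` in `H¹(ω)`. -/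
def MemH10 {ω : Set Plane} (u : L2 ω) : Prop :=
  MemH1 u ∧ ∃ φ : ℕ → Plane → ℝ, (∀ n, IsTestFunction ω (φ n)) ∧
    Tendsto (fun n => eLpNorm (fun x => φ n x - u x) 2 (volume.restrict ω)) atTop (𝓝 0) ∧
    ∀ i, Tendsto (fun n => eLpNorm (fun x => fderiv ℝ (φ n) x (stdVec i) - weakPartial i u x) 2
      (volume.restrict ω)) atTop (𝓝 0)

/-- `(∇ u, ∇ v)` in `L²(ω)`. -/
def gradInner {ω : Set Plane} (u v : L2 ω) : ℝ :=
  ∑ i, inner ℝ (weakPartial i u) (weakPartial i v)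

/-- The seminorm `|u|₁` of `H¹(ω)`. -/
def seminormH1 {ω : Set Plane} (u : L2 ω) : ℝ :=
  √(∑ i, ‖weakPartial i u‖ ^ 2)

/-- The seminorm `|u|₂` of `H²(ω)`. -/
def seminormH2 {ω : Set Plane} (u : L2 ω) : ℝ :=
  √(∑ i, ∑ j, ‖weakPartial i (weakPartial j u)‖ ^ 2)

/-- The Laplacian of `u ∈ H²(ω)`, as an element of `L²(ω)`. -/
def weakLaplacian {ω : Set Plane} (u : L2 ω) : L2 ω :=
  ∑ i, weakPartial i (weakPartial i u)

/-- `Δ u = g` in `ω` in the sense of distributions. -/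
def HasDistribLaplacian {ω : Set Plane} (u g : L2 ω) : Prop :=
  ∀ φ, IsTestFunction ω φ →
    ∫ x in ω, u x * Laplacian.laplacian φ x = ∫ x in ω, g x * φ x

/-- `C` is an admissible constant in the Poincaré inequality on `H¹₀(ω)`. -/
def IsPoincareConstant (ω : Set Plane) (C : ℝ) : Prop :=
  ∀ v : L2 ω, MemH10 v → ‖v‖ ≤ C * seminormH1 v

/-! ### The space of singular harmonic functions -/

/-- For `v ∈ H²(ω)`, the normal derivative `∂ₙ v` vanishes on the relatively open part `γ` of the
boundary: by Green's formula, the integral below is `∫_γ (∂ₙ v) w ds` for every smooth `w` whose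
support meets the boundary only inside `γ`. -/
def NormalDerivVanishesOn {ω : Set Plane} (γ : Set Plane) (v : L2 ω) : Prop :=
  ∀ w : Plane → ℝ, ContDiff ℝ (⊤ : ℕ∞) w → HasCompactSupport w → tsupport w ∩ frontier ω ⊆ γ →
    ∫ x in ω, (weakLaplacian v x * w x + ∑ i, weakPartial i v x * fderiv ℝ w x (stdVec i)) = 0

/-- For a harmonic `p ∈ L²(ω)`, the trace of `p` on the `k`-th side `γ_k` vanishes in the dual of
`H_{00}^{1/2}(γ_k)`. The elements of `H_{00}^{1/2}(γ_k)` are the normal derivatives `∂ₙ v` on `γ_k`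
of the functions `v ∈ H²(ω) ∩ H¹₀(ω)` with `∂ₙ v = 0` on the other sides, and the trace of `p` is
defined by Green's formula `⟨p, ∂ₙ v⟩ = (p, Δ v) - (Δ p, v) = (p, Δ v)`. -/
def HarmonicTraceVanishesOn {K : ℕ} [NeZero K] (poly : Polygon Plane K) {ω : Set Plane} (k : Fin K)
    (p : L2 ω) : Prop :=
  ∀ v : L2 ω, MemH10 v → MemH2 v →
    (∀ j, j ≠ k → NormalDerivVanishesOn (openSide poly j) v) →
    inner ℝ p (weakLaplacian v) = 0

/-- `p` belongs to the space `N` of the `L²` harmonic functions whose trace vanishes, in the dual of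
`H_{00}^{1/2}(γ_k)`, on every side `γ_k` of `ω`. -/
structure IsSingularHarmonic {K : ℕ} [NeZero K] (poly : Polygon Plane K) {ω : Set Plane}
    (p : L2 ω) : Prop where
  harmonic : HasDistribLaplacian p 0
  trace_zero : ∀ k, HarmonicTraceVanishesOn poly k p

/-! ### The coupled system -/

/-- `a_μ(w, v) = (∇ w, ∇ v) + μ (w, v)`. -/
def aForm {ω : Set Plane} (μ : ℝ) (w v : L2 ω) : ℝ :=
  gradInner w v + μ * inner ℝ w v

/-- `‖v‖_a = √(a_μ(v, v))`. -/
def energyNorm {ω : Set Plane} (μ : ℝ) (v : L2 ω) : ℝ :=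
  √(aForm μ v v)

/-- `(u, c) ∈ H¹₀(ω) × ℝ` solves the coupled system with data `μ`, `f`, `p_s`, `φ_s`. -/
structure IsCoupledSolution {ω : Set Plane} (μ : ℝ) (f ps φs u : L2 ω) (c : ℝ) : Prop where
  mem : MemH10 u
  eq_regular : ∀ v, MemH10 v → aForm μ u v + c * aForm μ φs v = inner ℝ f v
  eq_coeff : (‖ps‖ ^ 2 + μ * seminormH1 φs ^ 2) * c + μ * inner ℝ u ps = inner ℝ f ps

end

/-! Let `w` in H¹₀ solve a_μ(w, v) = (f, v). The first equation of the system says exactly that u =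
w - c φ_s. Since |φ_s|₁² = (φ_s, p_s), inserting this into the second equation cancels every term
that carries both μ and c and leaves c ‖p_s‖² = (f - μ w, p_s). So the pair exists and is unique
(`isCoupledSolution_iff`), and -Δu = g, where g = f - μ w - c p_s is the part of f - μ w orthogonal
to p_s. Testing with `w` gives ‖f - μ w‖ ≤ ‖f‖, hence |c| ‖p_s‖ ≤ ‖f‖ and ‖g‖ ≤ ‖f‖. The energy
bound is the triangle inequality applied to w - c φ_s.

The substance is regularity (`hessBound_of_inner_eq_zero`): if g is orthogonal to p_s, the Dirichlet
solution lies in H² and |u|₂ ≤ ‖g‖.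

Away from the corners (`truncation`), difference quotients along a side show that the tangential
derivative is in H¹ and again vanishes on the boundary; the equation supplies the remaining second
derivatives. For a truncated function v the difference between ∑ ‖∂ᵢ∂ⱼ v‖² and ‖Δv‖² is a null
Lagrangian without boundary term, so the two are equal. The constant 1 does not depend on the
cut-off, which is what allows limits. A partition of unity into pieces that touch at most one side
shows also that Δv is orthogonal to p_s: this is where the trace conditions enter.

At a corner with interior angle 2κ the cut-off can be removed if the energy in the ball of radius ρ
is o(ρ²) (`regular_of_decay`). If Δu vanishes near the corner, the Fourier modes of the gradient are
C_k r^{λ_k} with λ_k = kπ/(2κ) (`IsPolarSector.exists_cornerMode_eq`). Finite energy excludes k ≤ 0,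
so the energy is O(ρ^{2λ_m}) for the first mode m present. Now λ₁ > 1 at a convex corner and λ₂ > 1
at any corner; the only obstruction is the coefficient of the first mode at the re-entrant corner.

That coefficient is linear in the data and is removed by elimination. Fix a test function f₀ whose
coefficient is not zero. For every test function φ some φ - t f₀ has coefficient zero, so it is
regular and (p_s, φ) = t (p_s, f₀). As p_s ≠ 0, (p_s, f₀) ≠ 0. If test functions φ_n tend to g ⟂
p_s, then t_n → 0, so φ_n - t_n f₀ → g, and the H² bounds pass to the limit. If no such f₀ exists,
density of the test functions is enough. The dimension of N is never needed. -/

noncomputable section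

/-! ### Smooth compactly supported functions as elements of `L²(ω)` -/

/-- The class of a function in `L²(ω)` (and `0` if it is not square integrable). -/
def toL2 (ω : Set Plane) (φ : Plane → ℝ) : L2 ω :=
  open Classical in
  if h : MemLp φ 2 (volume.restrict ω) then h.toLp φ else 0

/-- The partial derivative `∂ᵢ φ`. -/
def pd (i : Fin 2) (φ : Plane → ℝ) (x : Plane) : ℝ := fderiv ℝ φ x (stdVec i)

theorem coeFn_toL2 {ω : Set Plane} {φ : Plane → ℝ} (h : MemLp φ 2 (volume.restrict ω)) :
    toL2 ω φ =ᵐ[volume.restrict ω] φ := by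
  rw [toL2, dif_pos h]
  exact h.coeFn_toLp

theorem toL2_congr {ω : Set Plane} {φ ψ : Plane → ℝ} (h : φ =ᵐ[volume.restrict ω] ψ) :
    toL2 ω φ = toL2 ω ψ := by
  by_cases hφ : MemLp φ 2 (volume.restrict ω)
  · have hψ := hφ.ae_eq h
    rw [toL2, toL2, dif_pos hφ, dif_pos hψ]
    exact (MemLp.toLp_eq_toLp_iff _ _).2 h
  · have hψ : ¬ MemLp ψ 2 (volume.restrict ω) := fun hψ => hφ (hψ.ae_eq h.symm)
    rw [toL2, toL2, dif_neg hφ, dif_neg hψ]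

theorem toL2_coeFn {ω : Set Plane} (u : L2 ω) : toL2 ω u = u := by
  rw [toL2, dif_pos (Lp.memLp u)]
  exact Lp.toLp_coeFn _ _

theorem inner_L2_eq {ω : Set Plane} (u v : L2 ω) : inner ℝ u v = ∫ x in ω, u x * v x := by
  rw [L2.inner_def]
  refine integral_congr_ae (Eventually.of_forall fun x => ?_)
  simp [mul_comm]

theorem inner_toL2_right {ω : Set Plane} (u : L2 ω) {φ : Plane → ℝ}
    (h : MemLp φ 2 (volume.restrict ω)) : inner ℝ u (toL2 ω φ) = ∫ x in ω, u x * φ x := by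
  rw [inner_L2_eq]
  refine integral_congr_ae ?_
  filter_upwards [coeFn_toL2 h] with x hx
  rw [hx]

theorem integrable_mul_L2 {ω : Set Plane} (u v : L2 ω) :
    Integrable (fun x => u x * v x) (volume.restrict ω) :=
  (Lp.memLp u).integrable_mul (Lp.memLp v)

namespace IsTestFunction

variable {ω U : Set Plane} {φ ψ χ : Plane → ℝ}

theorem mono (h : IsTestFunction U φ) (hU : U ⊆ ω) : IsTestFunction ω φ :=
  ⟨h.smooth, h.compact, h.support.trans hU⟩

theorem univ (h : IsTestFunction ω φ) : IsTestFunction Set.univ φ := h.mono (subset_univ _)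

theorem continuous (h : IsTestFunction ω φ) : Continuous φ := h.smooth.continuous

theorem differentiable (h : IsTestFunction ω φ) : Differentiable ℝ φ :=
  h.smooth.differentiable (by simp)

theorem memLp (h : IsTestFunction ω φ) (U : Set Plane) (p : ℝ≥0∞) :
    MemLp φ p (volume.restrict U) :=
  h.continuous.memLp_of_hasCompactSupport h.compact

theorem integrable (h : IsTestFunction ω φ) (U : Set Plane) :
    Integrable φ (volume.restrict U) :=
  h.continuous.integrable_of_hasCompactSupport h.compact

theorem zero : IsTestFunction ω (fun _ => 0) :=
  ⟨contDiff_const, HasCompactSupport.zero, by simp [tsupport, Function.support]⟩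

theorem add (h : IsTestFunction ω φ) (h' : IsTestFunction ω ψ) :
    IsTestFunction ω (fun x => φ x + ψ x) :=
  ⟨h.smooth.add h'.smooth, h.compact.add h'.compact,
    (tsupport_add φ ψ).trans (union_subset h.support h'.support)⟩

theorem smooth_mul (h : IsTestFunction ω φ) (hχ : ContDiff ℝ (⊤ : ℕ∞) χ) :
    IsTestFunction ω (fun x => χ x * φ x) :=
  ⟨hχ.mul h.smooth, h.compact.mul_left, (tsupport_mul_subset_right).trans h.support⟩

theorem mul_smooth (h : IsTestFunction ω φ) (hχ : ContDiff ℝ (⊤ : ℕ∞) χ) :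
    IsTestFunction ω (fun x => φ x * χ x) :=
  ⟨h.smooth.mul hχ, h.compact.mul_right, (tsupport_mul_subset_left).trans h.support⟩

theorem const_mul (h : IsTestFunction ω φ) (c : ℝ) : IsTestFunction ω (fun x => c * φ x) :=
  h.smooth_mul contDiff_const

theorem neg (h : IsTestFunction ω φ) : IsTestFunction ω (fun x => - φ x) := by
  simpa using h.const_mul (-1)

theorem sub (h : IsTestFunction ω φ) (h' : IsTestFunction ω ψ) :
    IsTestFunction ω (fun x => φ x - ψ x) := by
  simpa [sub_eq_add_neg] using h.add h'.neg

theorem sum {ι : Type*} (s : Finset ι) {φ : ι → Plane → ℝ}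
    (h : ∀ i ∈ s, IsTestFunction ω (φ i)) : IsTestFunction ω (fun x => ∑ i ∈ s, φ i x) := by
  classical
  induction s using Finset.induction_on with
  | empty => simpa using zero
  | insert a s ha ih =>
    simp only [Finset.sum_insert ha]
    exact (h a (by simp)).add (ih fun i hi => h i (by simp [hi]))

theorem contDiff_pd (hχ : ContDiff ℝ (⊤ : ℕ∞) χ) (i : Fin 2) : ContDiff ℝ (⊤ : ℕ∞) (pd i χ) :=
  (hχ.fderiv_right (m := (⊤ : ℕ∞)) (by simp)).clm_apply contDiff_const

theorem pd (h : IsTestFunction ω φ) (i : Fin 2) : IsTestFunction ω (pd i φ) :=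
  ⟨contDiff_pd h.smooth i, h.compact.fderiv_apply (𝕜 := ℝ) _,
    (tsupport_fderiv_apply_subset ℝ _).trans h.support⟩

theorem eq_zero_of_notMem (h : IsTestFunction ω φ) {x : Plane} (hx : x ∉ ω) : φ x = 0 :=
  image_eq_zero_of_notMem_tsupport fun hm => hx (h.support hm)

theorem setIntegral_mul (h : IsTestFunction ω φ) (f : Plane → ℝ) :
    ∫ x in ω, f x * φ x = ∫ x, f x * φ x :=
  setIntegral_eq_integral_of_forall_compl_eq_zero fun x hx => by
    rw [h.eq_zero_of_notMem hx, mul_zero]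

theorem exists_bound (h : IsTestFunction ω φ) : ∃ C, 0 ≤ C ∧ ∀ x, |φ x| ≤ C := by
  obtain ⟨C, hC⟩ := h.compact.exists_bound_of_continuous h.continuous
  exact ⟨C, (norm_nonneg _).trans (hC 0), hC⟩

end IsTestFunction

/-! ### Calculus of partial derivatives of smooth functions. -/

section pd

variable {φ ψ : Plane → ℝ}

theorem pd_add (hφ : Differentiable ℝ φ) (hψ : Differentiable ℝ ψ) (i : Fin 2) :
    pd i (fun x => φ x + ψ x) = fun x => pd i φ x + pd i ψ x := by
  ext x
  simp [pd, fderiv_fun_add (hφ x) (hψ x)]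

theorem pd_const_mul (hφ : Differentiable ℝ φ) (c : ℝ) (i : Fin 2) :
    pd i (fun x => c * φ x) = fun x => c * pd i φ x := by
  ext x
  simp [pd, fderiv_const_mul (hφ x)]

theorem pd_mul (hφ : Differentiable ℝ φ) (hψ : Differentiable ℝ ψ) (i : Fin 2) :
    pd i (fun x => φ x * ψ x) = fun x => φ x * pd i ψ x + pd i φ x * ψ x := by
  ext x
  simp [pd, fderiv_fun_mul (hφ x) (hψ x), mul_comm]

theorem pd_comm (hφ : ContDiff ℝ (⊤ : ℕ∞) φ) (i j : Fin 2) : pd i (pd j φ) = pd j (pd i φ) := by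
  ext x
  have hs : IsSymmSndFDerivAt ℝ φ x :=
    (hφ.contDiffAt (x := x)).isSymmSndFDerivAt
      (by simpa using WithTop.coe_le_coe.2 (le_top : (2 : ℕ∞) ≤ ⊤))
  have hd : DifferentiableAt ℝ (fderiv ℝ φ) x :=
    (hφ.fderiv_right (m := (⊤ : ℕ∞)) (by simp)).differentiable (by simp) x
  have key : ∀ i j, pd i (pd j φ) x = fderiv ℝ (fderiv ℝ φ) x (stdVec i) (stdVec j) := by
    intro i j
    change fderiv ℝ (fun y => fderiv ℝ φ y (stdVec j)) x (stdVec i) = _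
    rw [fderiv_clm_apply hd (differentiableAt_const _)]
    simp
  rw [key, key, hs.eq]

theorem laplacian_eq_pd (hφ : ContDiff ℝ (⊤ : ℕ∞) φ) :
    Laplacian.laplacian φ = fun x => ∑ i, pd i (pd i φ) x := by
  ext x
  rw [InnerProductSpace.laplacian_eq_iteratedFDeriv_orthonormalBasis φ
    (EuclideanSpace.basisFun (Fin 2) ℝ)]
  refine Finset.sum_congr rfl fun i _ => ?_
  have hd : DifferentiableAt ℝ (fderiv ℝ φ) x :=
    (hφ.fderiv_right (m := (⊤ : ℕ∞)) (by simp)).differentiable (by simp) x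
  rw [iteratedFDeriv_two_apply]
  change _ = fderiv ℝ (fun y => fderiv ℝ φ y (stdVec i)) x (stdVec i)
  rw [fderiv_clm_apply hd (differentiableAt_const _)]
  simp [stdVec]

/-- Integration by parts against a test function. -/
theorem integral_mul_pd {ω : Set Plane} (hφ : IsTestFunction ω φ) (hψ : ContDiff ℝ (⊤ : ℕ∞) ψ)
    (i : Fin 2) : ∫ x, ψ x * pd i φ x = - ∫ x, pd i ψ x * φ x := by
  have hc := IsTestFunction.contDiff_pd hψ i
  exact integral_mul_fderiv_eq_neg_fderiv_mul_of_integrable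
    (((hφ.smooth_mul hc).integrable Set.univ).mono_measure (by simp))
    ((((hφ.pd i).smooth_mul hψ).integrable Set.univ).mono_measure (by simp))
    (((hφ.smooth_mul hψ).integrable Set.univ).mono_measure (by simp))
    (fun x _ => hψ.differentiable (by simp) x) (fun x _ => hφ.differentiable x)

end pd

/-! ### Passing to classes in L²(ω), and multiplication operators. -/

section toL2

variable {ω U : Set Plane} {φ ψ χ : Plane → ℝ}

theorem toL2_add (hφ : MemLp φ 2 (volume.restrict ω)) (hψ : MemLp ψ 2 (volume.restrict ω)) :
    toL2 ω (fun x => φ x + ψ x) = toL2 ω φ + toL2 ω ψ := by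
  have h := hφ.add hψ
  change toL2 ω (φ + ψ) = _
  rw [toL2, toL2, toL2, dif_pos hφ, dif_pos hψ, dif_pos h, MemLp.toLp_add]

theorem toL2_const_mul (hφ : MemLp φ 2 (volume.restrict ω)) (c : ℝ) :
    toL2 ω (fun x => c * φ x) = c • toL2 ω φ := by
  have h := hφ.const_smul c
  change toL2 ω (c • φ) = _
  rw [toL2, toL2, dif_pos hφ, dif_pos h, MemLp.toLp_const_smul]

theorem toL2_zero : toL2 ω (fun _ => 0) = 0 := by
  have h : MemLp (0 : Plane → ℝ) 2 (volume.restrict ω) := MemLp.zero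
  change toL2 ω 0 = 0
  rw [toL2, dif_pos h, MemLp.toLp_zero]

theorem toL2_sub (hφ : MemLp φ 2 (volume.restrict ω)) (hψ : MemLp ψ 2 (volume.restrict ω)) :
    toL2 ω (fun x => φ x - ψ x) = toL2 ω φ - toL2 ω ψ := by
  have h := hφ.sub hψ
  change toL2 ω (φ - ψ) = _
  rw [toL2, toL2, toL2, dif_pos hφ, dif_pos hψ, dif_pos h, MemLp.toLp_sub]

/-- Multiplication by a function on `L²(ω)`. -/
def mulL (χ : Plane → ℝ) (u : L2 ω) : L2 ω := toL2 ω fun x => χ x * u x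

theorem memLp_mul_L2 (hχ : Continuous χ) {C : ℝ} (hC : ∀ x, |χ x| ≤ C) (u : L2 ω) :
    MemLp (fun x => χ x * u x) 2 (volume.restrict ω) := by
  refine MemLp.mono' (g := fun x => C * ‖u x‖) ((Lp.memLp u).norm.const_mul C)
    (hχ.aestronglyMeasurable.mul (Lp.aestronglyMeasurable u)) (Eventually.of_forall fun x => ?_)
  rw [norm_mul]
  exact mul_le_mul_of_nonneg_right (hC x) (norm_nonneg _)

theorem IsTestFunction.memLp_mul (hχ : IsTestFunction U χ) (u : L2 ω) :
    MemLp (fun x => χ x * u x) 2 (volume.restrict ω) := by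
  obtain ⟨C, -, hC⟩ := hχ.exists_bound
  exact memLp_mul_L2 hχ.continuous hC u

theorem IsTestFunction.coeFn_mulL (hχ : IsTestFunction U χ) (u : L2 ω) :
    mulL χ u =ᵐ[volume.restrict ω] fun x => χ x * u x := coeFn_toL2 (hχ.memLp_mul u)

theorem norm_le_of_ae {C : ℝ} {u v : L2 ω}
    (h : ∀ᵐ x ∂volume.restrict ω, |u x| ≤ C * |v x|) : ‖u‖ ≤ C * ‖v‖ :=
  Lp.norm_le_mul_norm_of_ae_le_mul h

/-- Multiplication by a test function, as a bounded operator on `L²(ω)`. -/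
def mulCLM (hχ : IsTestFunction U χ) : L2 ω →L[ℝ] L2 ω :=
  LinearMap.mkContinuous
    { toFun := mulL χ
      map_add' := fun u v => by
        rw [mulL, mulL, mulL, ← toL2_add (hχ.memLp_mul u) (hχ.memLp_mul v)]
        refine toL2_congr ?_
        filter_upwards [Lp.coeFn_add u v] with x hx
        rw [hx, Pi.add_apply, mul_add]
      map_smul' := fun c u => by
        rw [mulL, mulL, RingHom.id_apply, ← toL2_const_mul (hχ.memLp_mul u)]
        refine toL2_congr ?_
        filter_upwards [Lp.coeFn_smul c u] with x hx
        rw [hx, Pi.smul_apply, smul_eq_mul]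
        ring }
    hχ.exists_bound.choose fun u => by
      refine norm_le_of_ae ?_
      filter_upwards [hχ.coeFn_mulL u] with x hx
      simp only [LinearMap.coe_mk, AddHom.coe_mk]
      rw [hx, abs_mul]
      exact mul_le_mul_of_nonneg_right (hχ.exists_bound.choose_spec.2 x) (abs_nonneg _)

theorem mulL_toL2 (hφ : MemLp φ 2 (volume.restrict ω)) :
    mulL χ (toL2 ω φ) = toL2 ω fun x => χ x * φ x := by
  refine toL2_congr ?_
  filter_upwards [coeFn_toL2 hφ] with x hx
  rw [hx]

theorem inner_mulL (hχ : IsTestFunction U χ) (u v : L2 ω) :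
    inner ℝ (mulL χ u) v = inner ℝ u (mulL χ v) := by
  rw [inner_L2_eq, inner_L2_eq]
  refine integral_congr_ae ?_
  filter_upwards [hχ.coeFn_mulL u, hχ.coeFn_mulL v] with x h1 h2
  rw [h1, h2]
  ring

theorem inner_mulL_toL2 (hχ : IsTestFunction U χ) (u : L2 ω)
    (hφ : MemLp φ 2 (volume.restrict ω)) :
    inner ℝ (mulL χ u) (toL2 ω φ) = inner ℝ u (toL2 ω fun x => χ x * φ x) := by
  rw [inner_mulL hχ, mulL_toL2 hφ]

/-- Inner products replace integrals of representatives, so that linearity and passage to limits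
become Hilbert space facts. -/
theorem hasWeakPartial_iff {i : Fin 2} {u g : L2 ω} :
    HasWeakPartial i u g ↔ ∀ φ, IsTestFunction ω φ →
      inner ℝ u (toL2 ω (pd i φ)) = - inner ℝ g (toL2 ω φ) := by
  refine forall_congr' fun φ => forall_congr' fun hφ => ?_
  rw [inner_toL2_right _ ((hφ.pd i).memLp ω 2), inner_toL2_right _ (hφ.memLp ω 2)]
  rfl

end toL2

/-! ### Weak derivatives -/

section weak

variable {ω U : Set Plane} {χ : Plane → ℝ} {i : Fin 2} {u v g h : L2 ω}

theorem IsTestFunction.hasWeakPartial {φ : Plane → ℝ} (hφ : ContDiff ℝ (⊤ : ℕ∞) φ)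
    (h1 : MemLp φ 2 (volume.restrict ω)) (h2 : MemLp (_root_.pd i φ) 2 (volume.restrict ω)) :
    HasWeakPartial i (toL2 ω φ) (toL2 ω (_root_.pd i φ)) := by
  rw [hasWeakPartial_iff]
  intro ψ hψ
  rw [real_inner_comm, inner_toL2_right _ h1, real_inner_comm, inner_toL2_right _ h2,
    integral_congr_ae (g := fun x => φ x * _root_.pd i ψ x),
    integral_congr_ae (f := fun x => toL2 ω ψ x * _root_.pd i φ x)
      (g := fun x => _root_.pd i φ x * ψ x),
    (hψ.pd i).setIntegral_mul, hψ.setIntegral_mul]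
  · exact integral_mul_pd hψ hφ i
  · filter_upwards [coeFn_toL2 (hψ.memLp ω 2)] with x hx
    rw [hx, mul_comm]
  · filter_upwards [coeFn_toL2 ((hψ.pd i).memLp ω 2)] with x hx
    rw [hx, mul_comm]

theorem HasWeakPartial.add (h1 : HasWeakPartial i u g) (h2 : HasWeakPartial i v h) :
    HasWeakPartial i (u + v) (g + h) := by
  rw [hasWeakPartial_iff] at *
  intro φ hφ
  rw [inner_add_left, inner_add_left, h1 φ hφ, h2 φ hφ]
  ring

theorem HasWeakPartial.smul (h1 : HasWeakPartial i u g) (c : ℝ) :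
    HasWeakPartial i (c • u) (c • g) := by
  rw [hasWeakPartial_iff] at *
  intro φ hφ
  rw [inner_smul_left, inner_smul_left, h1 φ hφ]
  ring

theorem HasWeakPartial.sub (h1 : HasWeakPartial i u g) (h2 : HasWeakPartial i v h) :
    HasWeakPartial i (u - v) (g - h) := by
  rw [hasWeakPartial_iff] at *
  intro φ hφ
  rw [inner_sub_left, inner_sub_left, h1 φ hφ, h2 φ hφ]
  ring

theorem HasWeakPartial.zero : HasWeakPartial i (0 : L2 ω) 0 := by
  rw [hasWeakPartial_iff]
  intro φ hφ
  simp

theorem HasWeakPartial.sum {ι : Type*} (s : Finset ι) {u g : ι → L2 ω}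
    (h : ∀ k ∈ s, HasWeakPartial i (u k) (g k)) :
    HasWeakPartial i (∑ k ∈ s, u k) (∑ k ∈ s, g k) := by
  classical
  induction s using Finset.induction_on with
  | empty => simpa using HasWeakPartial.zero
  | insert a s ha ih =>
    rw [Finset.sum_insert ha, Finset.sum_insert ha]
    exact (h a (by simp)).add (ih fun k hk => h k (by simp [hk]))

theorem HasWeakPartial.of_tendsto {ι : Type*} {l : Filter ι} [l.NeBot] {u' g' : ι → L2 ω}
    (h : ∀ n, HasWeakPartial i (u' n) (g' n)) (hu : Tendsto u' l (𝓝 u))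
    (hg : Tendsto g' l (𝓝 g)) : HasWeakPartial i u g := by
  rw [hasWeakPartial_iff]
  intro φ hφ
  have h1 : Tendsto (fun n => inner ℝ (u' n) (toL2 ω (pd i φ))) l
      (𝓝 (inner ℝ u (toL2 ω (pd i φ)))) := hu.inner tendsto_const_nhds
  have h2 : Tendsto (fun n => - inner ℝ (g' n) (toL2 ω φ)) l
      (𝓝 (- inner ℝ g (toL2 ω φ))) := (hg.inner tendsto_const_nhds).neg
  exact tendsto_nhds_unique h1 (h2.congr fun n => ((hasWeakPartial_iff.1 (h n)) φ hφ).symm)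

/-- The classes of test functions are dense in `L²(ω)`. -/
theorem eq_zero_of_inner_test (hω : IsOpen ω)
    (h : ∀ φ, IsTestFunction ω φ → inner ℝ u (toL2 ω φ) = 0) : u = 0 := by
  have h1 : HasWeakPartial 0 (0 : L2 ω) 0 := HasWeakPartial.zero
  -- Orthogonality to all test functions says that `u` is a weak derivative of the zero function;
  -- uniqueness then gives `u = 0`.
  have h2 : HasWeakPartial 0 (0 : L2 ω) u := by
    rw [hasWeakPartial_iff]
    intro φ hφ
    rw [h φ hφ]
    simp
  exact h2.unique hω h1

/-- The weak derivative vanishes on open sets on which the function vanishes. -/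
theorem HasWeakPartial.ae_eq_zero (hω : IsOpen ω) {O : Set Plane} (hO : IsOpen O)
    (h : HasWeakPartial i u g) (hu : ∀ᵐ x ∂volume.restrict ω, x ∈ O → u x = 0) :
    ∀ᵐ x ∂volume.restrict ω, x ∈ O → g x = 0 := by
  have hloc : LocallyIntegrable g (volume.restrict ω) :=
    (Lp.memLp g).locallyIntegrable (by norm_num)
  have key : ∀ᵐ x ∂volume, x ∈ ω ∩ O → g x = 0 := by
    refine (hω.inter hO).ae_eq_zero_of_integral_contDiff_smul_eq_zero ?_ ?_
    · rw [locallyIntegrableOn_iff (hω.inter hO).isLocallyClosed]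
      intro k hk hc
      have := hloc.integrableOn_isCompact hc
      rwa [IntegrableOn, Measure.restrict_restrict hc.measurableSet,
        inter_eq_left.mpr (hk.trans inter_subset_left)] at this
    · intro φ h1 h2 h3
      have hφ : IsTestFunction ω φ := ⟨h1, h2, h3.trans inter_subset_left⟩
      have e := h φ hφ
      have z : ∫ x in ω, u x * fderiv ℝ φ x (stdVec i) = 0 := by
        refine integral_eq_zero_of_ae ?_
        filter_upwards [hu] with x hx
        by_cases hm : x ∈ O
        · simp [hx hm]
        · have : pd i φ x = 0 :=
            (IsTestFunction.pd (ω := O) ⟨h1, h2, h3.trans inter_subset_right⟩ i).eq_zero_of_notMem hm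
          rw [Pi.zero_apply, show fderiv ℝ φ x (stdVec i) = 0 from this, mul_zero]
      rw [z, hφ.setIntegral_mul] at e
      simp only [smul_eq_mul]
      rw [← neg_eq_zero, e]
      simp [mul_comm]
  rw [ae_restrict_iff' hω.measurableSet]
  filter_upwards [key] with x hx h1 h2 using hx ⟨h1, h2⟩

end weak

/-! ### Jets and the space `H¹₀(ω)` -/

/-- Triples `(u, g₁, g₂)` of elements of `L²(ω)`. -/
abbrev Jet (ω : Set Plane) : Type := PiLp 2 fun _ : Option (Fin 2) => L2 ω

/-- The triple `(u, ∂₁ u, ∂₂ u)` of a smooth function. -/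
def jet (ω : Set Plane) (φ : Plane → ℝ) : Jet ω :=
  WithLp.toLp 2 fun o => o.elim (toL2 ω φ) fun i => toL2 ω (pd i φ)

/-- The triple with given components. -/
def mkJet {ω : Set Plane} (u : L2 ω) (g : Fin 2 → L2 ω) : Jet ω :=
  WithLp.toLp 2 fun o => o.elim u g

section jet

variable {ω U U' : Set Plane} {χ φ ψ : Plane → ℝ}

@[simp] theorem jet_none : jet ω φ none = toL2 ω φ := rfl
@[simp] theorem jet_some (i : Fin 2) : jet ω φ (some i) = toL2 ω (pd i φ) := rfl
@[simp] theorem mkJet_none (u : L2 ω) (g : Fin 2 → L2 ω) : mkJet u g none = u := rfl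
@[simp] theorem mkJet_some (u : L2 ω) (g : Fin 2 → L2 ω) (i : Fin 2) : mkJet u g (some i) = g i :=
  rfl

theorem Jet.ext {u v : Jet ω} (h : u none = v none) (h' : ∀ i : Fin 2, u (some i) = v (some i)) :
    u = v := by
  ext1 o
  cases o with
  | none => exact h
  | some i => exact h' i

theorem jet_zero : jet ω (fun _ => 0) = 0 :=
  Jet.ext (by simp [toL2_zero]) fun i => by
    have : pd i (fun _ => (0 : ℝ)) = fun _ => 0 := by ext; simp [pd]
    simp [this, toL2_zero]

theorem jet_add (hφ : IsTestFunction U φ) (hψ : IsTestFunction U ψ) :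
    jet ω (fun x => φ x + ψ x) = jet ω φ + jet ω ψ :=
  Jet.ext (toL2_add (hφ.memLp ω 2) (hψ.memLp ω 2)) fun i => by
    rw [jet_some, pd_add hφ.differentiable hψ.differentiable,
      toL2_add ((hφ.pd i).memLp ω 2) ((hψ.pd i).memLp ω 2)]
    rfl

theorem jet_const_mul (hφ : IsTestFunction U φ) (c : ℝ) :
    jet ω (fun x => c * φ x) = c • jet ω φ :=
  Jet.ext (toL2_const_mul (hφ.memLp ω 2) c) fun i => by
    rw [jet_some, pd_const_mul hφ.differentiable, toL2_const_mul ((hφ.pd i).memLp ω 2)]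
    rfl

/-- The jets on `ω` of the test functions supported in `U`. -/
def testJets (ω U : Set Plane) : Submodule ℝ (Jet ω) where
  carrier := {u | ∃ φ, IsTestFunction U φ ∧ jet ω φ = u}
  zero_mem' := ⟨_, IsTestFunction.zero, jet_zero⟩
  add_mem' := by
    rintro _ _ ⟨φ, hφ, rfl⟩ ⟨ψ, hψ, rfl⟩
    exact ⟨_, hφ.add hψ, jet_add hφ hψ⟩
  smul_mem' := by
    rintro c _ ⟨φ, hφ, rfl⟩
    exact ⟨_, hφ.const_mul c, jet_const_mul hφ c⟩

/-- The closure in `H¹(ω)` of the test functions supported in `U`. -/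
def H10 (ω U : Set Plane) : Submodule ℝ (Jet ω) := (testJets ω U).topologicalClosure

theorem H10.isClosed : IsClosed (H10 ω U : Set (Jet ω)) := Submodule.isClosed_topologicalClosure _

instance : CompleteSpace (H10 ω U) := H10.isClosed.completeSpace_coe

theorem jet_mem_H10 (hφ : IsTestFunction U φ) : jet ω φ ∈ H10 ω U :=
  Submodule.le_topologicalClosure _ ⟨φ, hφ, rfl⟩

theorem H10.mono (h : U ⊆ U') : H10 ω U ≤ H10 ω U' :=
  Submodule.topologicalClosure_mono fun _ ⟨φ, hφ, e⟩ => ⟨φ, hφ.mono h, e⟩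

/-- A closed property of jets that holds for test functions holds on `H10`. -/
theorem H10.induction {p : Jet ω → Prop} (hp : IsClosed {u | p u})
    (h : ∀ φ, IsTestFunction U φ → p (jet ω φ)) {u : Jet ω} (hu : u ∈ H10 ω U) : p u :=
  closure_minimal (s := (testJets ω U : Set (Jet ω))) (t := {u | p u})
    (by rintro _ ⟨φ, hφ, rfl⟩; exact h φ hφ) hp hu

theorem H10.exists_seq {u : Jet ω} (hu : u ∈ H10 ω U) :
    ∃ φ : ℕ → Plane → ℝ, (∀ n, IsTestFunction U (φ n)) ∧
      Tendsto (fun n => jet ω (φ n)) atTop (𝓝 u) := by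
  obtain ⟨x, hx, hlim⟩ := mem_closure_iff_seq_limit.1
    (show u ∈ closure (testJets ω U : Set (Jet ω)) from hu)
  choose φ hφ e using hx
  exact ⟨φ, hφ, by simpa only [e] using hlim⟩

theorem Jet.continuous_apply (o : Option (Fin 2)) : Continuous fun u : Jet ω => u o :=
  PiLp.continuous_apply 2 _ o

theorem Jet.tendsto_iff {ι : Type*} {l : Filter ι} {u : ι → Jet ω} {v : Jet ω} :
    Tendsto u l (𝓝 v) ↔ Tendsto (fun n => u n none) l (𝓝 (v none)) ∧
      ∀ i : Fin 2, Tendsto (fun n => u n (some i)) l (𝓝 (v (some i))) := by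
  constructor
  · intro h
    exact ⟨((Jet.continuous_apply _).tendsto v).comp h,
      fun i => ((Jet.continuous_apply _).tendsto v).comp h⟩
  · rintro ⟨h1, h2⟩
    have : Tendsto (fun n => (WithLp.ofLp (u n) : Option (Fin 2) → L2 ω)) l
        (𝓝 (WithLp.ofLp v)) := by
      rw [tendsto_pi_nhds]
      rintro (_ | i)
      · exact h1
      · exact h2 i
    exact ((PiLp.continuous_toLp 2 _).tendsto _).comp this

theorem H10.hasWeakPartial {u : Jet ω} (hu : u ∈ H10 ω U) (i : Fin 2) :
    HasWeakPartial i (u none) (u (some i)) := by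
  obtain ⟨φ, hφ, hlim⟩ := H10.exists_seq hu
  rw [Jet.tendsto_iff] at hlim
  exact HasWeakPartial.of_tendsto
    (fun n => IsTestFunction.hasWeakPartial (hφ n).smooth ((hφ n).memLp ω 2)
      (((hφ n).pd i).memLp ω 2)) hlim.1 (hlim.2 i)

theorem tendsto_toL2_iff {φ : ℕ → Plane → ℝ} (hφ : ∀ n, MemLp (φ n) 2 (volume.restrict ω))
    (u : L2 ω) : Tendsto (fun n => toL2 ω (φ n)) atTop (𝓝 u) ↔
      Tendsto (fun n => eLpNorm (fun x => φ n x - u x) 2 (volume.restrict ω)) atTop (𝓝 0) := by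
  rw [Lp.tendsto_Lp_iff_tendsto_eLpNorm']
  refine tendsto_congr fun n => ?_
  refine eLpNorm_congr_ae ?_
  filter_upwards [coeFn_toL2 (hφ n)] with x hx
  rw [Pi.sub_apply, hx]

/-- Makes H¹₀ a closed subspace of a Hilbert space: orthogonal projections, weak limits and
Lax–Milgram then apply to it directly. -/
theorem memH10_iff {u : L2 ω} :
    MemH10 u ↔ mkJet u (fun i => weakPartial i u) ∈ H10 ω ω := by
  constructor
  · rintro ⟨-, φ, hφ, h1, h2⟩
    refine H10.isClosed.mem_of_tendsto (b := atTop) (f := fun n => jet ω (φ n)) ?_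
      (Eventually.of_forall fun n => jet_mem_H10 (hφ n))
    rw [Jet.tendsto_iff]
    exact ⟨(tendsto_toL2_iff (fun n => (hφ n).memLp ω 2) u).2 h1,
      fun i => (tendsto_toL2_iff (fun n => ((hφ n).pd i).memLp ω 2) _).2 (h2 i)⟩
  · intro h
    refine ⟨fun i => ⟨_, H10.hasWeakPartial h i⟩, ?_⟩
    obtain ⟨φ, hφ, hlim⟩ := H10.exists_seq h
    rw [Jet.tendsto_iff] at hlim
    exact ⟨φ, hφ, (tendsto_toL2_iff (fun n => (hφ n).memLp ω 2) u).1 hlim.1,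
      fun i => (tendsto_toL2_iff (fun n => ((hφ n).pd i).memLp ω 2) _).1 (hlim.2 i)⟩

theorem H10.weakPartial_eq (hω : IsOpen ω) {u : Jet ω} (hu : u ∈ H10 ω U) (i : Fin 2) :
    weakPartial i (u none) = u (some i) := (H10.hasWeakPartial hu i).weakPartial_eq hω

theorem H10.memH10 (hω : IsOpen ω) {u : Jet ω} (hu : u ∈ H10 ω ω) : MemH10 (u none) := by
  rw [memH10_iff]
  convert hu using 1
  exact Jet.ext rfl fun i => H10.weakPartial_eq hω hu i

/-- Multiplication of jets by a test function. -/
def jmul (χ : Plane → ℝ) (u : Jet ω) : Jet ω :=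
  mkJet (mulL χ (u none)) fun i => mulL χ (u (some i)) + mulL (pd i χ) (u none)

theorem jmul_jet (hφ : IsTestFunction U φ) (hχ : IsTestFunction U' χ) :
    jmul χ (jet ω φ) = jet ω fun x => χ x * φ x :=
  Jet.ext (mulL_toL2 (hφ.memLp ω 2)) fun i => by
    rw [jet_some, pd_mul hχ.differentiable hφ.differentiable,
      toL2_add (((hφ.pd i).smooth_mul hχ.smooth).memLp ω 2)
        ((hφ.smooth_mul (hχ.pd i).smooth).memLp ω 2), ← mulL_toL2 (hφ.memLp ω 2),
      ← mulL_toL2 ((hφ.pd i).memLp ω 2)]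
    rfl

theorem continuous_jmul (hχ : IsTestFunction U χ) : Continuous (jmul χ : Jet ω → Jet ω) := by
  rw [continuous_iff_continuousAt]
  intro u
  refine Jet.tendsto_iff.2 ⟨?_, fun i => ?_⟩
  · exact ((mulCLM hχ).continuous.comp (Jet.continuous_apply none)).tendsto u
  · exact (((mulCLM hχ).continuous.comp (Jet.continuous_apply (some i))).add
      ((mulCLM (hχ.pd i)).continuous.comp (Jet.continuous_apply none))).tendsto u

/-- A product of test functions is supported in both sets, and multiplication is continuous on jets.
Recording the smaller set ω ∩ U is what later permits small translations. -/
theorem H10.jmul (hχ : IsTestFunction U χ) {u : Jet ω} (hu : u ∈ H10 ω ω) :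
    jmul χ u ∈ H10 ω (ω ∩ U) := by
  refine H10.induction (p := fun u => _root_.jmul χ u ∈ H10 ω (ω ∩ U))
    (H10.isClosed.preimage (continuous_jmul hχ)) (fun φ hφ => ?_) hu
  rw [jmul_jet hφ hχ]
  have h1 := hφ.smooth_mul hχ.smooth
  have h2 := hχ.mul_smooth hφ.smooth
  exact jet_mem_H10 ⟨h1.smooth, h1.compact, subset_inter h1.support h2.support⟩

end jet

/-! ### The weak Laplacian -/

/-- `Δ u = f` in weak form, for a jet `u`. -/
def HasLap {ω : Set Plane} (u : Jet ω) (f : L2 ω) : Prop :=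
  ∀ φ, IsTestFunction ω φ →
    ∑ i : Fin 2, inner ℝ (u (some i)) (toL2 ω (pd i φ)) = - inner ℝ f (toL2 ω φ)

section lap

variable {ω U : Set Plane} {χ : Plane → ℝ} {u v : Jet ω} {f g : L2 ω}

theorem hasDistribLaplacian_iff_inner {u f : L2 ω} :
    HasDistribLaplacian u f ↔ ∀ φ, IsTestFunction ω φ →
      ∑ i, inner ℝ u (toL2 ω (pd i (pd i φ))) = inner ℝ f (toL2 ω φ) := by
  refine forall_congr' fun φ => forall_congr' fun hφ => ?_
  have : ∀ i, inner ℝ u (toL2 ω (pd i (pd i φ))) = ∫ x in ω, u x * pd i (pd i φ) x :=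
    fun i => inner_toL2_right u (((hφ.pd i).pd i).memLp ω 2)
  have int : ∀ i, Integrable (fun x => u x * pd i (pd i φ) x) (volume.restrict ω) := fun i =>
    (Lp.memLp u).integrable_mul (((hφ.pd i).pd i).memLp ω 2)
  rw [inner_toL2_right _ (hφ.memLp ω 2), laplacian_eq_pd hφ.smooth]
  simp only [this, Finset.mul_sum]
  rw [integral_finsetSum _ fun i _ => int i]

theorem hasDistribLaplacian_iff_hasLap (hu : ∀ i, HasWeakPartial i (u none) (u (some i))) :
    HasDistribLaplacian (u none) f ↔ HasLap u f := by
  rw [hasDistribLaplacian_iff_inner]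
  refine forall_congr' fun φ => forall_congr' fun hφ => ?_
  have : ∀ i, inner ℝ (u none) (toL2 ω (pd i (pd i φ))) =
      - inner ℝ (u (some i)) (toL2 ω (pd i φ)) := fun i =>
    hasWeakPartial_iff.1 (hu i) _ (hφ.pd i)
  simp only [this, Finset.sum_neg_distrib]
  rw [neg_eq_iff_eq_neg]

theorem HasLap.add (hu : HasLap u f) (hv : HasLap v g) : HasLap (u + v) (f + g) := by
  intro φ hφ
  have h1 := hu φ hφ
  have h2 := hv φ hφ
  simp only [PiLp.add_apply, inner_add_left, Finset.sum_add_distrib, h1, h2]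
  ring

theorem HasLap.smul (hu : HasLap u f) (c : ℝ) : HasLap (c • u) (c • f) := by
  intro φ hφ
  have h1 := hu φ hφ
  simp only [PiLp.smul_apply, inner_smul_left, ← Finset.mul_sum, h1]
  simp

theorem HasLap.sub (hu : HasLap u f) (hv : HasLap v g) : HasLap (u - v) (f - g) := by
  have := hu.add (hv.smul (-1))
  simpa [sub_eq_add_neg] using this

theorem HasLap.zero : HasLap (0 : Jet ω) 0 := by
  intro φ hφ
  simp

theorem HasLap.sum {ι : Type*} (s : Finset ι) {u : ι → Jet ω} {f : ι → L2 ω}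
    (h : ∀ k ∈ s, HasLap (u k) (f k)) : HasLap (∑ k ∈ s, u k) (∑ k ∈ s, f k) := by
  classical
  induction s using Finset.induction_on with
  | empty => simpa using HasLap.zero
  | insert a s ha ih =>
    rw [Finset.sum_insert ha, Finset.sum_insert ha]
    exact (h a (by simp)).add (ih fun k hk => h k (by simp [hk]))

theorem HasLap.inner_eq (hu : HasLap u f) (hv : v ∈ H10 ω ω) :
    ∑ i : Fin 2, inner ℝ (u (some i)) (v (some i)) = - inner ℝ f (v none) := by
  refine H10.induction (p := fun v => ∑ i : Fin 2, inner ℝ (u (some i)) (v (some i)) =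
    - inner ℝ f (v none)) (isClosed_eq ?_ ?_) hu hv
  · exact continuous_finsetSum _ fun i _ => continuous_const.inner (Jet.continuous_apply _)
  · exact (continuous_const.inner (Jet.continuous_apply _)).neg

/-- The Laplacian of a product with a test function. -/
def lapMul (χ : Plane → ℝ) (u : Jet ω) (f : L2 ω) : L2 ω :=
  mulL χ f + (2 : ℝ) • ∑ i : Fin 2, mulL (pd i χ) (u (some i)) +
    ∑ i : Fin 2, mulL (pd i (pd i χ)) (u none)

/-- The product rule Δ(χu) = χΔu + 2∇χ·∇u + uΔχ comes from testing the equation of `u` with χφ and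
the definition of ∂ᵢu with (∂ᵢχ)φ. -/
theorem HasLap.jmul (hχ : IsTestFunction U χ)
    (hw : ∀ i, HasWeakPartial i (u none) (u (some i))) (hu : HasLap u f) :
    HasLap (jmul χ u) (lapMul χ u f) := by
  intro φ hφ
  have h1 := hu _ (hφ.smooth_mul hχ.smooth)
  have h2 : ∀ i, inner ℝ (u none) (toL2 ω fun x => pd i χ x * pd i φ x) =
      - inner ℝ (u (some i)) (toL2 ω fun x => pd i χ x * φ x) -
        inner ℝ (u none) (toL2 ω fun x => pd i (pd i χ) x * φ x) := by
    intro i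
    have h3 := hasWeakPartial_iff.1 (hw i) _ (hφ.smooth_mul (hχ.pd i).smooth)
    rw [pd_mul (hχ.pd i).differentiable hφ.differentiable,
      toL2_add (((hφ.pd i).smooth_mul (hχ.pd i).smooth).memLp ω 2)
        ((hφ.smooth_mul ((hχ.pd i).pd i).smooth).memLp ω 2), inner_add_right] at h3
    linarith
  have h4 : ∀ i, inner ℝ (u (some i)) (toL2 ω (pd i fun x => χ x * φ x)) =
      inner ℝ (u (some i)) (toL2 ω fun x => χ x * pd i φ x) +
      inner ℝ (u (some i)) (toL2 ω fun x => pd i χ x * φ x) := by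
    intro i
    rw [pd_mul hχ.differentiable hφ.differentiable,
      toL2_add (((hφ.pd i).smooth_mul hχ.smooth).memLp ω 2)
        ((hφ.smooth_mul (hχ.pd i).smooth).memLp ω 2), inner_add_right]
  have h5 : ∀ i : Fin 2, inner ℝ (_root_.jmul χ u (some i)) (toL2 ω (pd i φ)) =
      inner ℝ (u (some i)) (toL2 ω fun x => χ x * pd i φ x) +
      inner ℝ (u none) (toL2 ω fun x => pd i χ x * pd i φ x) := by
    intro i
    rw [_root_.jmul, mkJet_some, inner_add_left, inner_mulL_toL2 hχ _ ((hφ.pd i).memLp ω 2),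
      inner_mulL_toL2 (hχ.pd i) _ ((hφ.pd i).memLp ω 2)]
  rw [lapMul, inner_add_left, inner_add_left, inner_smul_left, sum_inner, sum_inner,
    inner_mulL_toL2 hχ _ (hφ.memLp ω 2)]
  simp only [inner_mulL_toL2 (hχ.pd _) _ (hφ.memLp ω 2),
    inner_mulL_toL2 ((hχ.pd _).pd _) _ (hφ.memLp ω 2), h5, h2]
  simp only [h4, Fin.sum_univ_two] at h1 ⊢
  simp only [conj_trivial]
  linarith

end lap

/-! ### Weak compactness -/

/-- Banach–Alaoglu, carried to `H` by the Riesz isomorphism. Convergence along an ultrafilter finer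
than `atTop` replaces the choice of a subsequence. -/
theorem exists_weak_limit {H : Type*} [NormedAddCommGroup H] [InnerProductSpace ℝ H]
    [CompleteSpace H] (z : ℕ → H) (C : ℝ) (hz : ∀ n, ‖z n‖ ≤ C) :
    ∃ (l : Filter ℕ) (Z : H), l.NeBot ∧ l ≤ atTop ∧
      ∀ y, Tendsto (fun n => inner ℝ (z n) y) l (𝓝 (inner ℝ Z y)) := by
  let 𝒰 : Ultrafilter ℕ := hyperfilter ℕ
  let T : ℕ → WeakDual ℝ H := fun n => StrongDual.toWeakDual (InnerProductSpace.toDual ℝ H (z n))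
  have hK := WeakDual.isCompact_closedBall (𝕜 := ℝ) (E := H) 0 C
  obtain ⟨L, -, hL⟩ := hK.ultrafilter_le_nhds (𝒰.map T) (by
    rw [le_principal_iff]
    refine Filter.mem_map.2 (Eventually.of_forall fun n => ?_)
    simpa [T] using hz n)
  have hL' : Tendsto T 𝒰 (𝓝 L) := hL
  refine ⟨𝒰, (InnerProductSpace.toDual ℝ H).symm (WeakDual.toStrongDual L), 𝒰.neBot,
    Nat.hyperfilter_le_atTop, fun y => ?_⟩
  have := ((WeakDual.eval_continuous y).tendsto L).comp hL'
  rw [show inner ℝ ((InnerProductSpace.toDual ℝ H).symm (WeakDual.toStrongDual L)) y = L y by simp]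
  exact this

/-! ### Translations -/

/-- The translate `x ↦ u (x + a)`, where `u` is extended by zero. -/
def shiftL {ω : Set Plane} (a : Plane) (u : L2 ω) : L2 ω :=
  toL2 ω fun x => ω.indicator u (x + a)

section shift

variable {ω U U' : Set Plane} {φ : Plane → ℝ}

theorem memLp_shift (hω : IsOpen ω) (a : Plane) (u : L2 ω) :
    MemLp (fun x => ω.indicator u (x + a)) 2 volume := by
  have h1 : MemLp (ω.indicator u) 2 volume :=
    (memLp_indicator_iff_restrict hω.measurableSet).2 (Lp.memLp u)
  exact h1.comp_measurePreserving (measurePreserving_add_right volume a)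

theorem coeFn_shiftL (hω : IsOpen ω) (a : Plane) (u : L2 ω) :
    shiftL a u =ᵐ[volume.restrict ω] fun x => ω.indicator u (x + a) :=
  coeFn_toL2 ((memLp_shift hω a u).restrict ω)

theorem ae_shift {p : Plane → Prop} (h : ∀ᵐ x ∂(volume : Measure Plane), p x) (a : Plane) :
    ∀ᵐ x ∂(volume : Measure Plane), p (x + a) :=
  (measurePreserving_add_right volume a).quasiMeasurePreserving.ae h

/-- Translation invariance of Lebesgue measure; extension by zero makes both sides integrals over
the whole plane. -/
theorem inner_shiftL (hω : IsOpen ω) (a : Plane) (u v : L2 ω) :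
    inner ℝ (shiftL a u) v = inner ℝ u (shiftL (-a) v) := by
  have h1 : inner ℝ (shiftL a u) v = ∫ x, ω.indicator u (x + a) * ω.indicator v x := by
    rw [inner_L2_eq, ← integral_indicator hω.measurableSet]
    have := (ae_restrict_iff' hω.measurableSet).1 (coeFn_shiftL hω a u)
    refine integral_congr_ae ?_
    filter_upwards [this] with x hx
    by_cases hm : x ∈ ω
    · simp only [indicator_of_mem hm, hx hm]
    · simp only [indicator_of_notMem hm, mul_zero]
  have h2 : inner ℝ u (shiftL (-a) v) = ∫ x, ω.indicator u x * ω.indicator v (x + -a) := by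
    rw [inner_L2_eq, ← integral_indicator hω.measurableSet]
    have := (ae_restrict_iff' hω.measurableSet).1 (coeFn_shiftL hω (-a) v)
    refine integral_congr_ae ?_
    filter_upwards [this] with x hx
    by_cases hm : x ∈ ω
    · simp only [indicator_of_mem hm, hx hm]
    · simp only [indicator_of_notMem hm, zero_mul]
  rw [h1, h2, ← integral_add_right_eq_self (fun x => ω.indicator u x * ω.indicator v (x + -a)) a]
  simp

theorem shiftL_add (hω : IsOpen ω) (a : Plane) (u v : L2 ω) :
    shiftL a (u + v) = shiftL a u + shiftL a v := by
  rw [shiftL, shiftL, shiftL, ← toL2_add ((memLp_shift hω a u).restrict ω)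
    ((memLp_shift hω a v).restrict ω)]
  refine toL2_congr (ae_restrict_of_ae ?_)
  have := ae_shift ((ae_restrict_iff' hω.measurableSet).1 (Lp.coeFn_add u v)) a
  filter_upwards [this] with x hx
  by_cases hm : x + a ∈ ω
  · simp only [indicator_of_mem hm, hx hm, Pi.add_apply]
  · simp only [indicator_of_notMem hm, add_zero]

theorem shiftL_smul (hω : IsOpen ω) (a : Plane) (c : ℝ) (u : L2 ω) :
    shiftL a (c • u) = c • shiftL a u := by
  rw [shiftL, shiftL, ← toL2_const_mul ((memLp_shift hω a u).restrict ω)]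
  refine toL2_congr (ae_restrict_of_ae ?_)
  have := ae_shift ((ae_restrict_iff' hω.measurableSet).1 (Lp.coeFn_smul c u)) a
  filter_upwards [this] with x hx
  by_cases hm : x + a ∈ ω
  · simp only [indicator_of_mem hm, hx hm, Pi.smul_apply, smul_eq_mul]
  · simp only [indicator_of_notMem hm, mul_zero]

theorem norm_shiftL_le (hω : IsOpen ω) (a : Plane) (u : L2 ω) : ‖shiftL a u‖ ≤ ‖u‖ := by
  have h1 : MemLp (ω.indicator (u : Plane → ℝ)) 2 volume :=
    (memLp_indicator_iff_restrict hω.measurableSet).2 (Lp.memLp u)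
  have h2 := eLpNorm_comp_measurePreserving (p := 2) h1.1 (measurePreserving_add_right volume a)
  rw [Lp.norm_def, Lp.norm_def]
  refine ENNReal.toReal_mono (Lp.eLpNorm_ne_top u) ?_
  calc eLpNorm (shiftL a u) 2 (volume.restrict ω)
      = eLpNorm (fun x => ω.indicator u (x + a)) 2 (volume.restrict ω) :=
        eLpNorm_congr_ae (coeFn_shiftL hω a u)
    _ ≤ eLpNorm (fun x => ω.indicator u (x + a)) 2 volume :=
        eLpNorm_mono_measure _ Measure.restrict_le_self
    _ = eLpNorm (ω.indicator u) 2 volume := h2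
    _ = eLpNorm u 2 (volume.restrict ω) := eLpNorm_indicator_eq_eLpNorm_restrict hω.measurableSet

/-- Translation as a bounded operator. -/
def shiftCLM (hω : IsOpen ω) (a : Plane) : L2 ω →L[ℝ] L2 ω :=
  LinearMap.mkContinuous
    { toFun := shiftL a
      map_add' := shiftL_add hω a
      map_smul' := shiftL_smul hω a } 1 fun u => by simpa using norm_shiftL_le hω a u

theorem IsTestFunction.shift (hφ : IsTestFunction U φ) {a : Plane}
    (h : ∀ x, x + a ∈ U → x ∈ U') : IsTestFunction U' (fun x => φ (x + a)) := by
  have ht : tsupport (fun x => φ (x + a)) = (fun x => x + a) ⁻¹' tsupport φ :=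
    tsupport_comp_eq_preimage φ (Homeomorph.addRight a)
  refine ⟨hφ.smooth.comp (contDiff_id.add contDiff_const),
    hφ.compact.comp_homeomorph (Homeomorph.addRight a), ?_⟩
  rw [ht]
  exact fun x hx => h x (hφ.support hx)

theorem pd_shift (a : Plane) (i : Fin 2) :
    pd i (fun x => φ (x + a)) = fun x => pd i φ (x + a) := by
  ext x
  simp only [pd, fderiv_comp_add_right]

theorem shiftL_toL2 (hω : IsOpen ω) (hφ : IsTestFunction ω φ) (a : Plane) :
    shiftL a (toL2 ω φ) = toL2 ω fun x => φ (x + a) := by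
  refine toL2_congr (ae_restrict_of_ae ?_)
  have := ae_shift ((ae_restrict_iff' hω.measurableSet).1 (coeFn_toL2 (hφ.memLp ω 2))) a
  filter_upwards [this] with x hx
  by_cases hm : x + a ∈ ω
  · simp only [indicator_of_mem hm, hx hm]
  · simp only [indicator_of_notMem hm, hφ.eq_zero_of_notMem hm]

/-- Translation of jets. -/
def jshift (a : Plane) (u : Jet ω) : Jet ω :=
  WithLp.toLp 2 fun o => shiftL a (u o)

@[simp] theorem jshift_apply (a : Plane) (u : Jet ω) (o : Option (Fin 2)) :
    jshift a u o = shiftL a (u o) := rfl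

theorem continuous_jshift (hω : IsOpen ω) (a : Plane) :
    Continuous (jshift a : Jet ω → Jet ω) := by
  rw [continuous_iff_continuousAt]
  intro u
  exact Jet.tendsto_iff.2
    ⟨((shiftCLM hω a).continuous.comp (Jet.continuous_apply none)).tendsto u,
    fun i => ((shiftCLM hω a).continuous.comp (Jet.continuous_apply (some i))).tendsto u⟩

theorem jshift_jet (hω : IsOpen ω) (hφ : IsTestFunction ω φ) (a : Plane) :
    jshift a (jet ω φ) = jet ω fun x => φ (x + a) :=
  Jet.ext (shiftL_toL2 hω hφ a) fun i => by
    rw [jshift_apply, jet_some, jet_some, pd_shift, shiftL_toL2 hω (hφ.pd i)]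

theorem H10.jshift (hω : IsOpen ω) (hU : U ⊆ ω) {a : Plane} (h : ∀ x, x + a ∈ U → x ∈ U')
    {u : Jet ω} (hu : u ∈ H10 ω U) : jshift a u ∈ H10 ω U' := by
  refine H10.induction (p := fun u => _root_.jshift a u ∈ H10 ω U')
    (H10.isClosed.preimage (continuous_jshift hω a)) (fun φ hφ => ?_) hu
  rw [jshift_jet hω (hφ.mono hU)]
  exact jet_mem_H10 (hφ.shift h)

/-- The derivative of a jet in direction `τ`. -/
def dirDeriv (τ : Plane) (u : Jet ω) : L2 ω := ∑ i : Fin 2, τ i • u (some i)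

theorem continuous_dirDeriv (τ : Plane) : Continuous (dirDeriv τ : Jet ω → L2 ω) :=
  continuous_finsetSum _ fun i _ => (Jet.continuous_apply (some i)).const_smul (τ i)

theorem fderiv_apply_eq (φ : Plane → ℝ) (x τ : Plane) :
    fderiv ℝ φ x τ = ∑ i : Fin 2, τ i * pd i φ x := by
  have : τ = ∑ i : Fin 2, τ i • stdVec i := by
    ext j
    fin_cases j <;> simp [stdVec]
  conv_lhs => rw [this]
  simp [pd]

theorem IsTestFunction.dir (hφ : IsTestFunction U φ) (τ : Plane) :
    IsTestFunction U (fun x => fderiv ℝ φ x τ) := by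
  simp_rw [fderiv_apply_eq]
  exact IsTestFunction.sum _ fun i _ => (hφ.pd i).const_mul _

theorem dirDeriv_jet (hφ : IsTestFunction U φ) (τ : Plane) :
    dirDeriv τ (jet ω φ) = toL2 ω fun x => fderiv ℝ φ x τ := by
  simp_rw [fderiv_apply_eq, dirDeriv, Fin.sum_univ_two, jet_some]
  rw [toL2_add (((hφ.pd 0).const_mul _).memLp ω 2) (((hφ.pd 1).const_mul _).memLp ω 2),
    toL2_const_mul ((hφ.pd 0).memLp ω 2), toL2_const_mul ((hφ.pd 1).memLp ω 2)]

/-- Differentiation under the integral sign. The dominating function C|y| is integrable because ω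
has finite measure. -/
theorem hasDerivAt_inner_shift (hb : Bornology.IsBounded ω) (y : L2 ω)
    (hφ : IsTestFunction U φ) (τ : Plane) (t : ℝ) :
    HasDerivAt (fun t : ℝ => inner ℝ y (toL2 ω fun x => φ (x + t • τ)))
      (inner ℝ y (toL2 ω fun x => fderiv ℝ φ (x + t • τ) τ)) t := by
  have : IsFiniteMeasure (volume.restrict ω) := ⟨by
    rw [Measure.restrict_apply_univ]; exact hb.measure_lt_top⟩
  have hs : ∀ t : ℝ, IsTestFunction Set.univ (fun x => φ (x + t • τ)) := fun t =>
    hφ.univ.shift fun _ _ => mem_univ _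
  have hs' : ∀ t : ℝ, IsTestFunction Set.univ (fun x => fderiv ℝ φ (x + t • τ) τ) := fun t =>
    (hφ.univ.dir τ).shift fun _ _ => mem_univ _
  obtain ⟨C, hC0, hC⟩ := (hφ.dir τ).exists_bound
  have hy : Integrable y (volume.restrict ω) := (Lp.memLp y).integrable (by norm_num)
  have e : (fun t : ℝ => inner ℝ y (toL2 ω fun x => φ (x + t • τ))) =
      fun t : ℝ => ∫ x in ω, y x * φ (x + t • τ) := by
    ext t
    exact inner_toL2_right _ ((hs t).memLp ω 2)
  rw [e, inner_toL2_right _ ((hs' t).memLp ω 2)]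
  refine (hasDerivAt_integral_of_dominated_loc_of_deriv_le (𝕜 := ℝ) (s := Set.univ)
    (F := fun t x => y x * φ (x + t • τ)) (F' := fun t x => y x * fderiv ℝ φ (x + t • τ) τ)
    (bound := fun x => |y x| * C) univ_mem ?_ ?_ ?_ ?_ ?_ ?_).2
  · exact Eventually.of_forall fun t =>
      hy.1.mul (hs t).continuous.aestronglyMeasurable
  · exact (Lp.memLp y).integrable_mul ((hs t).memLp ω 2)
  · exact hy.1.mul (hs' t).continuous.aestronglyMeasurable
  · refine Eventually.of_forall fun x s _ => ?_
    rw [norm_mul]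
    exact mul_le_mul_of_nonneg_left (hC _) (norm_nonneg _)
  · exact hy.abs.mul_const C
  · refine Eventually.of_forall fun x s _ => ?_
    have h1 : HasDerivAt (fun s : ℝ => x + s • τ) τ s := by
      simpa using ((hasDerivAt_id s).smul_const τ).const_add x
    exact ((hφ.differentiable _).hasFDerivAt.comp_hasDerivAt s h1).const_mul (y x)

/-- Difference quotients are controlled by derivatives. -/
theorem norm_shiftL_sub_le (hω : IsOpen ω) (hb : Bornology.IsBounded ω) (τ : Plane) (h : ℝ)
    {u : Jet ω} (hu : u ∈ H10 ω ω) :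
    ‖shiftL (h • τ) (u none) - u none‖ ≤ |h| * ‖dirDeriv τ u‖ := by
  refine H10.induction
    (p := fun u => ‖shiftL (h • τ) (u none) - u none‖ ≤ |h| * ‖dirDeriv τ u‖)
    (isClosed_le ?_ ?_) (fun φ hφ => ?_) hu
  · exact (((shiftCLM hω (h • τ)).continuous.comp (Jet.continuous_apply none)).sub
      (Jet.continuous_apply none)).norm
  · exact continuous_const.mul (continuous_dirDeriv τ).norm
  · rw [jet_none, dirDeriv_jet hφ, shiftL_toL2 hω hφ]
    -- Pairing the moving function with its own increment `y` reduces the claim to the mean value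
    -- inequality on the line, in the form ‖y‖² ≤ |h| ‖d‖ ‖y‖.
    set y := (toL2 ω fun x => φ (x + h • τ)) - toL2 ω φ with hy
    set d := toL2 ω fun x => fderiv ℝ φ x τ with hd
    have hder : ∀ t : ℝ, ‖inner ℝ y (toL2 ω fun x => fderiv ℝ φ (x + t • τ) τ)‖ ≤ ‖y‖ * ‖d‖ := by
      intro t
      refine (norm_inner_le_norm _ _).trans (mul_le_mul_of_nonneg_left ?_ (norm_nonneg _))
      rw [← shiftL_toL2 hω (hφ.dir τ)]
      exact norm_shiftL_le hω _ _
    have hmv := Convex.norm_image_sub_le_of_norm_hasDerivWithin_le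
      (f := fun t : ℝ => inner ℝ y (toL2 ω fun x => φ (x + t • τ))) (s := Set.univ)
      (fun t _ => (hasDerivAt_inner_shift hb y hφ τ t).hasDerivWithinAt) (fun t _ => hder t)
      convex_univ (mem_univ 0) (mem_univ h)
    simp only [zero_smul, add_zero, sub_zero] at hmv
    rw [← inner_sub_right, ← hy, real_inner_self_eq_norm_sq, norm_pow, norm_norm,
      Real.norm_eq_abs] at hmv
    rcases eq_or_ne ‖y‖ 0 with h0 | h0
    · rw [h0]; positivity
    · have : 0 < ‖y‖ := lt_of_le_of_ne (norm_nonneg _) h0.symm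
      nlinarith

end shift

/-! ### Tangential regularity -/

/-- In the ball `B(P, ρ)` the set `ω` is invariant under translations in direction `τ`. -/
def IsInvariantNear (ω : Set Plane) (P : Plane) (ρ : ℝ) (τ : Plane) : Prop :=
  ∀ x ∈ ω ∩ Metric.ball P ρ, ∀ h : ℝ, x + h • τ ∈ Metric.ball P ρ → x + h • τ ∈ ω

section tangential

variable {ω : Set Plane} {P τ : Plane} {ρ : ℝ}

/-- The difference quotient of a jet. -/
def diffQuot (τ : Plane) (h : ℝ) (u : Jet ω) : Jet ω := h⁻¹ • (jshift (h • τ) u - u)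

theorem diffQuot_apply (h : ℝ) (u : Jet ω) (o : Option (Fin 2)) :
    diffQuot τ h u o = h⁻¹ • (shiftL (h • τ) (u o) - u o) := rfl

/-- Discrete integration by parts: the adjoint of the quotient with step h is minus the quotient
with step -h. -/
theorem inner_diffQuot (hω : IsOpen ω) (h : ℝ) (u v : Jet ω) (o o' : Option (Fin 2)) :
    inner ℝ (diffQuot τ h u o) (v o') = - inner ℝ (u o) (diffQuot τ (-h) v o') := by
  rw [diffQuot_apply, diffQuot_apply, inner_smul_left, inner_smul_right, inner_sub_left,
    inner_sub_right, inner_shiftL hω, inv_neg, neg_smul]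
  simp

theorem norm_diffQuot_le (hω : IsOpen ω) (hb : Bornology.IsBounded ω) {h : ℝ} (hh : h ≠ 0)
    {u : Jet ω} (hu : u ∈ H10 ω ω) : ‖diffQuot τ h u none‖ ≤ ‖dirDeriv τ u‖ := by
  rw [diffQuot_apply, norm_smul, norm_inv, Real.norm_eq_abs,
    inv_mul_le_iff₀ (abs_pos.2 hh)]
  exact norm_shiftL_sub_le hω hb τ h hu

theorem norm_dirDeriv_sq_le (hτ : τ 0 ^ 2 + τ 1 ^ 2 = 1) (u : Jet ω) :
    ‖dirDeriv τ u‖ ^ 2 ≤ ∑ i : Fin 2, ‖u (some i)‖ ^ 2 := by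
  have h1 : ‖dirDeriv τ u‖ ≤ |τ 0| * ‖u (some 0)‖ + |τ 1| * ‖u (some 1)‖ := by
    rw [dirDeriv, Fin.sum_univ_two]
    refine (norm_add_le _ _).trans (le_of_eq ?_)
    rw [norm_smul, norm_smul, Real.norm_eq_abs, Real.norm_eq_abs]
  have h2 : ‖dirDeriv τ u‖ ^ 2 ≤ (|τ 0| * ‖u (some 0)‖ + |τ 1| * ‖u (some 1)‖) ^ 2 :=
    pow_le_pow_left₀ (norm_nonneg _) h1 2
  rw [Fin.sum_univ_two]
  have h3 := sq_abs (τ 0)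
  have h4 := sq_abs (τ 1)
  nlinarith [sq_nonneg (|τ 0| * ‖u (some 1)‖ - |τ 1| * ‖u (some 0)‖)]

theorem norm_smul_of_sq (hτ : τ 0 ^ 2 + τ 1 ^ 2 = 1) (h : ℝ) : ‖h • τ‖ = |h| := by
  rw [norm_smul, EuclideanSpace.norm_eq, Fin.sum_univ_two]
  simp [hτ]

/-- The translate of a function that lives in the ball of radius r lives in the ball of radius r +
|h|, and invariance along τ keeps its support in ω; so zero boundary values survive. -/
theorem H10.diffQuot (hω : IsOpen ω) (hτ : τ 0 ^ 2 + τ 1 ^ 2 = 1)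
    (hinv : IsInvariantNear ω P ρ τ) {r r' h : ℝ} (hr : r + |h| ≤ r') (hr' : r' ≤ ρ)
    {u : Jet ω} (hu : u ∈ H10 ω (ω ∩ Metric.ball P r)) :
    diffQuot τ h u ∈ H10 ω (ω ∩ Metric.ball P r') := by
  have hrr : r ≤ r' := by linarith [abs_nonneg h]
  refine Submodule.smul_mem _ _ (Submodule.sub_mem _ ?_
    (H10.mono (inter_subset_inter_right _ (Metric.ball_subset_ball hrr)) hu))
  refine H10.jshift hω inter_subset_left ?_ hu
  rintro x ⟨h1, h2⟩
  have hx : x ∈ Metric.ball P r' := by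
    rw [Metric.mem_ball] at *
    have : dist x (x + h • τ) = |h| := by rw [dist_self_add_right, norm_smul_of_sq hτ]
    linarith [dist_triangle x (x + h • τ) P]
  refine ⟨?_, hx⟩
  have e : x + h • τ + (-h) • τ = x := by simp
  have := hinv (x + h • τ) ⟨h1, Metric.ball_subset_ball (hrr.trans hr') h2⟩ (-h)
  rw [e] at this
  exact this (Metric.ball_subset_ball hr' hx)

/-- The gradient of a difference quotient of `w` is controlled by the Laplacian of `w`. -/
theorem sum_norm_diffQuot_le (hω : IsOpen ω) (hb : Bornology.IsBounded ω)
    (hτ : τ 0 ^ 2 + τ 1 ^ 2 = 1) (hinv : IsInvariantNear ω P ρ τ) {h : ℝ} (hh : h ≠ 0)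
    (hρ : |h| ≤ ρ / 4) {w : Jet ω} {g : L2 ω} (hw : w ∈ H10 ω (ω ∩ Metric.ball P (ρ / 4)))
    (hg : HasLap w g) : ∑ i : Fin 2, ‖diffQuot τ h w (some i)‖ ^ 2 ≤ ‖g‖ ^ 2 := by
  have hh' : -h ≠ 0 := neg_ne_zero.2 hh
  -- Two quotients will be taken, each enlarging the ball by at most ρ/4: the radii are ρ/4, ρ/2 and
  -- ρ.
  have hy : diffQuot τ h w ∈ H10 ω (ω ∩ Metric.ball P (ρ / 2)) :=
    H10.diffQuot hω hτ hinv (by linarith) (by linarith [abs_nonneg h]) hw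
  set y := diffQuot τ h w with hydef
  have hz : diffQuot τ (-h) y ∈ H10 ω (ω ∩ Metric.ball P ρ) :=
    H10.diffQuot hω hτ hinv (by rw [abs_neg]; linarith [abs_nonneg h]) le_rfl hy
  have hyω : y ∈ H10 ω ω := H10.mono inter_subset_left hy
  -- The equation of `w` is tested with D₋ₕDₕw, and one quotient is moved back. With ‖D₋ₕy‖ ≤ |y|₁
  -- this yields |y|₁² ≤ ‖g‖ |y|₁.
  have e : ∑ i : Fin 2, ‖y (some i)‖ ^ 2 = inner ℝ g (diffQuot τ (-h) y none) := by
    have h1 := hg.inner_eq (H10.mono inter_subset_left hz)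
    rw [eq_neg_iff_add_eq_zero, add_comm, ← eq_neg_iff_add_eq_zero] at h1
    rw [h1, ← Finset.sum_neg_distrib]
    refine Finset.sum_congr rfl fun i _ => ?_
    rw [← inner_diffQuot hω, ← hydef, real_inner_self_eq_norm_sq]
  have h2 : ‖diffQuot τ (-h) y none‖ ≤ ‖dirDeriv τ y‖ := norm_diffQuot_le hω hb hh' hyω
  have h3 := norm_dirDeriv_sq_le hτ y
  have h4 := real_inner_le_norm g (diffQuot τ (-h) y none)
  rw [← e] at h4
  have h5 : ∑ i : Fin 2, ‖y (some i)‖ ^ 2 ≤ ‖g‖ * ‖dirDeriv τ y‖ :=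
    h4.trans (mul_le_mul_of_nonneg_left h2 (norm_nonneg _))
  have h6 : ‖dirDeriv τ y‖ ≤ ‖g‖ := by
    by_contra! h7
    have := norm_nonneg g
    nlinarith
  calc _ ≤ ‖g‖ * ‖dirDeriv τ y‖ := h5
    _ ≤ ‖g‖ ^ 2 := by rw [sq]; exact mul_le_mul_of_nonneg_left h6 (norm_nonneg _)

/-- Such a subspace is its own double orthogonal complement, and orthogonality to a fixed vector is
preserved by weak limits. -/
theorem mem_of_weak_limit {H : Type*} [NormedAddCommGroup H] [InnerProductSpace ℝ H]
    {K : Submodule ℝ H} [K.HasOrthogonalProjection] {l : Filter ℕ} [l.NeBot] {z : ℕ → H} {Z : H}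
    (hz : ∀ n, z n ∈ K) (h : ∀ y, Tendsto (fun n => inner ℝ (z n) y) l (𝓝 (inner ℝ Z y))) :
    Z ∈ K := by
  rw [← Submodule.orthogonal_orthogonal K, Submodule.mem_orthogonal]
  intro y hy
  rw [real_inner_comm]
  refine tendsto_nhds_unique (h y) (tendsto_const_nhds.congr fun n => ?_)
  exact ((Submodule.mem_orthogonal _ _).1 hy _ (hz n)).symm

/-- Tangential derivatives of local solutions with zero boundary values have zero boundary
values. -/
theorem exists_tangential (hω : IsOpen ω) (hb : Bornology.IsBounded ω) (hρ : 0 < ρ)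
    (hτ : τ 0 ^ 2 + τ 1 ^ 2 = 1) (hinv : IsInvariantNear ω P ρ τ) {w : Jet ω} {g : L2 ω}
    (hw : w ∈ H10 ω (ω ∩ Metric.ball P (ρ / 4))) (hg : HasLap w g) :
    ∃ z ∈ H10 ω ω, z none = dirDeriv τ w := by
  let h : ℕ → ℝ := fun n => (ρ / 4) / (n + 1)
  have hpos : ∀ n, 0 < h n := fun n => by positivity
  have hle : ∀ n, |h n| ≤ ρ / 4 := fun n => by
    rw [abs_of_pos (hpos n)]
    exact div_le_self (by positivity) (by linarith [(Nat.cast_nonneg n : (0 : ℝ) ≤ n)])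
  have hlim : Tendsto h atTop (𝓝 0) := by
    have := (tendsto_one_div_add_atTop_nhds_zero_nat (𝕜 := ℝ)).const_mul (ρ / 4)
    simpa [h, div_eq_mul_inv] using this
  have hwω : w ∈ H10 ω ω := H10.mono inter_subset_left hw
  have hD : ∀ n, diffQuot τ (h n) w ∈ H10 ω ω := fun n =>
    H10.mono inter_subset_left
      (H10.diffQuot hω hτ hinv (r' := ρ / 2) (by linarith [hle n]) (by linarith) hw)
  obtain ⟨l, Z, hl, hla, hZ⟩ := exists_weak_limit (fun n => diffQuot τ (h n) w)
    (‖dirDeriv τ w‖ + ‖g‖) fun n => by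
      have h1 := norm_diffQuot_le hω hb (τ := τ) (hpos n).ne' hwω
      have h2 := sum_norm_diffQuot_le hω hb hτ hinv (hpos n).ne' (hle n) hw hg
      have h3 : ‖diffQuot τ (h n) w‖ ^ 2 = ‖diffQuot τ (h n) w none‖ ^ 2 +
          ∑ i : Fin 2, ‖diffQuot τ (h n) w (some i)‖ ^ 2 := by
        rw [PiLp.norm_sq_eq_of_L2, Fintype.sum_option]
      refine le_of_sq_le_sq ?_ (by positivity)
      rw [h3]
      nlinarith [norm_nonneg (diffQuot τ (h n) w none), norm_nonneg (dirDeriv τ w), norm_nonneg g]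
  refine ⟨Z, mem_of_weak_limit hD hZ, ?_⟩
  rw [← sub_eq_zero]
  -- Against a test function the quotients converge in two ways: weakly to `Z`, and, after the
  -- quotient is moved onto φ, to the pairing with ∂_τ w.
  refine eq_zero_of_inner_test hω fun φ hφ => ?_
  rw [inner_sub_left, sub_eq_zero]
  have h1 : Tendsto (fun n => inner ℝ (diffQuot τ (h n) w none) (toL2 ω φ)) l
      (𝓝 (inner ℝ (Z none) (toL2 ω φ))) := by
    have := hZ (mkJet (toL2 ω φ) 0)
    simpa [PiLp.inner_apply, Fintype.sum_option] using this
  have h2 : Tendsto (fun n => inner ℝ (diffQuot τ (h n) w none) (toL2 ω φ)) atTop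
      (𝓝 (inner ℝ (dirDeriv τ w) (toL2 ω φ))) := by
    have h3 := (hasDerivAt_inner_shift hb (w none) hφ τ 0).tendsto_slope_zero
    -- The adjoint quotient has step -h, so the slope of the shifted φ is taken along -h.
    have h4 : Tendsto (fun n => -h n) atTop (𝓝[≠] 0) := by
      rw [tendsto_nhdsWithin_iff]
      exact ⟨by simpa using hlim.neg, Eventually.of_forall fun n => by simpa using (hpos n).ne'⟩
    have h5 := (h3.comp h4).neg
    have e1 : inner ℝ (dirDeriv τ w) (toL2 ω φ) =
        - inner ℝ (w none) (toL2 ω fun x => fderiv ℝ φ (x + (0 : ℝ) • τ) τ) := by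
      simp only [zero_smul, add_zero]
      rw [← dirDeriv_jet hφ, dirDeriv, dirDeriv, sum_inner, inner_sum, ← Finset.sum_neg_distrib]
      refine Finset.sum_congr rfl fun i _ => ?_
      rw [inner_smul_left, inner_smul_right, jet_some,
        hasWeakPartial_iff.1 (H10.hasWeakPartial hwω i) φ hφ]
      simp
    rw [e1]
    refine h5.congr fun n => ?_
    have e2 := inner_diffQuot hω (τ := τ) (h n) w (jet ω φ) none none
    rw [jet_none] at e2
    rw [e2, diffQuot_apply, jet_none, shiftL_toL2 hω hφ, inner_smul_right, inner_sub_right]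
    simp
  exact tendsto_nhds_unique h1 (h2.mono_left hla)

end tangential

/-! ### Second derivatives -/

/-- `H i j` is the weak derivative `∂ᵢ ∂ⱼ w`. -/
def HasHess {ω : Set Plane} (w : Jet ω) (H : Fin 2 → Fin 2 → L2 ω) : Prop :=
  ∀ i j, HasWeakPartial i (w (some j)) (H i j)

/-- The weak first derivatives of the first component are the other components. -/
def IsWeakJet {ω : Set Plane} (w : Jet ω) : Prop :=
  ∀ i, HasWeakPartial i (w none) (w (some i))

section hess

variable {ω : Set Plane} {P τ : Plane} {ρ : ℝ} {v w : Jet ω} {f g : L2 ω}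
  {H H' : Fin 2 → Fin 2 → L2 ω}

theorem H10.isWeakJet {U : Set Plane} (hw : w ∈ H10 ω U) : IsWeakJet w := H10.hasWeakPartial hw

theorem HasHess.sub (h : HasHess v H) (h' : HasHess w H') :
    HasHess (v - w) (fun i j => H i j - H' i j) := fun i j => (h i j).sub (h' i j)

theorem HasHess.sum {ι : Type*} (s : Finset ι) {w : ι → Jet ω} {H : ι → Fin 2 → Fin 2 → L2 ω}
    (h : ∀ k ∈ s, HasHess (w k) (H k)) :
    HasHess (∑ k ∈ s, w k) (fun i j => ∑ k ∈ s, H k i j) := fun i j => by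
  rw [show (∑ k ∈ s, w k) (some j) = ∑ k ∈ s, w k (some j) by simp]
  exact HasWeakPartial.sum s fun k hk => h k hk i j

theorem IsWeakJet.inner_comm (hw : IsWeakJet w) {φ : Plane → ℝ} (hφ : IsTestFunction ω φ)
    (i j : Fin 2) :
    inner ℝ (w (some i)) (toL2 ω (pd j φ)) = inner ℝ (w (some j)) (toL2 ω (pd i φ)) := by
  have h1 := hasWeakPartial_iff.1 (hw i) _ (hφ.pd j)
  have h2 := hasWeakPartial_iff.1 (hw j) _ (hφ.pd i)
  rw [pd_comm hφ.smooth] at h1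
  linarith

theorem HasHess.symm (hω : IsOpen ω) (hw : IsWeakJet w) (h : HasHess w H) (i j : Fin 2) :
    H i j = H j i := by
  rw [← sub_eq_zero]
  refine eq_zero_of_inner_test hω fun φ hφ => ?_
  have h1 := hasWeakPartial_iff.1 (h i j) φ hφ
  have h2 := hasWeakPartial_iff.1 (h j i) φ hφ
  have h3 := hw.inner_comm hφ i j
  rw [inner_sub_left]
  linarith

theorem HasHess.unique (hω : IsOpen ω) (h : HasHess w H) (h' : HasHess w H') : H = H' := by
  ext1 i; ext1 j
  exact (h i j).unique hω (h' i j)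

theorem HasHess.hasLap (hω : IsOpen ω) (h : HasHess w H) (hg : HasLap w g) :
    ∑ i : Fin 2, H i i = g := by
  rw [← sub_eq_zero]
  refine eq_zero_of_inner_test hω fun φ hφ => ?_
  have h1 := hg φ hφ
  simp only [hasWeakPartial_iff.1 (h _ _) φ hφ, Finset.sum_neg_distrib] at h1
  rw [inner_sub_left, sum_inner]
  linarith

theorem dirDeriv_hasWeakPartial (h : HasHess w H) (i : Fin 2) :
    HasWeakPartial i (dirDeriv τ w) (∑ j : Fin 2, τ j • H i j) :=
  HasWeakPartial.sum _ fun j _ => (h i j).smul (τ j)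

/-- Two of the second derivatives of `w` are known, the third follows from the equation. -/
theorem exists_hess (hτ : τ 0 ^ 2 + τ 1 ^ 2 = 1) (hw : IsWeakJet w) (hg : HasLap w g) {z : Jet ω}
    (hz : IsWeakJet z) (e : z none = dirDeriv τ w) : ∃ H, HasHess w H := by
  -- `a` and `b` are ∂₀∂₀w and ∂₀∂₁w, found by solving z₀ = τ₀w₀₀ + τ₁w₀₁, z₁ = τ₀w₀₁ + τ₁w₁₁, w₀₀ +
  -- w₁₁ = g with τ₀² + τ₁² = 1.
  let a : L2 ω := τ 0 • z (some 0) - τ 1 • z (some 1) + τ 1 ^ 2 • g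
  let b : L2 ω := τ 1 • z (some 0) + τ 0 • z (some 1) - (τ 0 * τ 1) • g
  let H : Fin 2 → Fin 2 → L2 ω := ![![a, b], ![b, g - a]]
  have key : ∀ φ, IsTestFunction ω φ →
      inner ℝ (w (some 0)) (toL2 ω (pd 0 φ)) = - inner ℝ a (toL2 ω φ) ∧
      inner ℝ (w (some 0)) (toL2 ω (pd 1 φ)) = - inner ℝ b (toL2 ω φ) ∧
      inner ℝ (w (some 1)) (toL2 ω (pd 0 φ)) = - inner ℝ b (toL2 ω φ) ∧
      inner ℝ (w (some 1)) (toL2 ω (pd 1 φ)) = - inner ℝ (g - a) (toL2 ω φ) := by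
    intro φ hφ
    have h1 := hg φ hφ
    have h2 := hw.inner_comm hφ 0 1
    have h3 := hasWeakPartial_iff.1 (hz 0) φ hφ
    have h4 := hasWeakPartial_iff.1 (hz 1) φ hφ
    rw [e, dirDeriv] at h3 h4
    simp only [Fin.sum_univ_two, inner_add_left, inner_sub_left, inner_smul_left, conj_trivial, a,
      b] at h1 h3 h4 ⊢
    generalize inner ℝ (w (some 0)) (toL2 ω (pd 0 φ)) = A at *
    generalize inner ℝ (w (some 0)) (toL2 ω (pd 1 φ)) = B at *
    generalize inner ℝ (w (some 1)) (toL2 ω (pd 0 φ)) = B' at *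
    generalize inner ℝ (w (some 1)) (toL2 ω (pd 1 φ)) = D at *
    generalize inner ℝ (z (some 0)) (toL2 ω φ) = Z0 at *
    generalize inner ℝ (z (some 1)) (toL2 ω φ) = Z1 at *
    generalize inner ℝ g (toL2 ω φ) = G at *
    subst h2
    have hA : A = - (τ 0 * Z0 - τ 1 * Z1 + τ 1 ^ 2 * G) := by
      linear_combination τ 0 * h3 - τ 1 * h4 + τ 1 ^ 2 * h1 - A * hτ
    have hB : B = - (τ 1 * Z0 + τ 0 * Z1 - τ 0 * τ 1 * G) := by
      linear_combination τ 1 * h3 + τ 0 * h4 - τ 0 * τ 1 * h1 - B * hτ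
    exact ⟨hA, hB, hB, by linarith⟩
  refine ⟨H, fun i j => hasWeakPartial_iff.2 fun φ hφ => ?_⟩
  obtain ⟨h1, h2, h3, h4⟩ := key φ hφ
  fin_cases i <;> fin_cases j
  · exact h1
  · exact h3
  · exact h2
  · exact h4

/-- Gradients are orthogonal to rotated gradients because second derivatives commute. Only one of
the two functions needs zero boundary values; the other only has weak derivatives. -/
theorem inner_grad_eq {a : L2 ω} {a' : Fin 2 → L2 ω} (ha : ∀ i, HasWeakPartial i a (a' i))
    {b : Jet ω} (hb : b ∈ H10 ω ω) :
    inner ℝ (a' 0) (b (some 1)) = inner ℝ (a' 1) (b (some 0)) := by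
  refine H10.induction
    (p := fun b => inner ℝ (a' 0) (b (some 1)) = inner ℝ (a' 1) (b (some 0)))
    (isClosed_eq ?_ ?_) (fun φ hφ => ?_) hb
  · exact continuous_const.inner (Jet.continuous_apply _)
  · exact continuous_const.inner (Jet.continuous_apply _)
  · have h1 := hasWeakPartial_iff.1 (ha 0) _ (hφ.pd 1)
    have h2 := hasWeakPartial_iff.1 (ha 1) _ (hφ.pd 0)
    rw [pd_comm hφ.smooth] at h1
    rw [jet_some, jet_some]
    linarith

/-- For functions with zero boundary values on a flat piece of the boundary, the second
derivatives can be integrated by parts without a boundary term. -/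
theorem hess_inner_eq_of_tangential (hω : IsOpen ω) (hτ : τ 0 ^ 2 + τ 1 ^ 2 = 1)
    (hv : IsWeakJet v) (hw : IsWeakJet w) (hH : HasHess v H) (hH' : HasHess w H') {y z : Jet ω}
    (hy : y ∈ H10 ω ω) (hz : z ∈ H10 ω ω) (ey : y none = dirDeriv τ v)
    (ez : z none = dirDeriv τ w) :
    ∑ i : Fin 2, ∑ j : Fin 2, inner ℝ (H i j) (H' i j) =
      inner ℝ (∑ i : Fin 2, H i i) (∑ i : Fin 2, H' i i) := by
  let n : Plane := !₂[-τ 1, τ 0]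
  have y' : ∀ i : Fin 2, y (some i) = ∑ j : Fin 2, τ j • H i j := fun i =>
    (ey ▸ H10.hasWeakPartial hy i).unique hω (dirDeriv_hasWeakPartial hH i)
  have z' : ∀ i : Fin 2, z (some i) = ∑ j : Fin 2, τ j • H' i j := fun i =>
    (ez ▸ H10.hasWeakPartial hz i).unique hω (dirDeriv_hasWeakPartial hH' i)
  -- The two sides differ by 2(v₀₁, w₀₁) - (v₀₀, w₁₁) - (v₁₁, w₀₀). In the frame (τ, n) this splits
  -- into pairings of ∇∂ₙv with the rotated ∇∂_τw and the same with v and w exchanged. Both vanish,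
  -- as ∂_τv and ∂_τw are in H¹₀.
  have h1 := inner_grad_eq (fun i => dirDeriv_hasWeakPartial (τ := n) hH i) hz
  have h2 := inner_grad_eq (fun i => dirDeriv_hasWeakPartial (τ := n) hH' i) hy
  rw [y', y'] at h2
  rw [z', z'] at h1
  have n0 : n 0 = - τ 1 := rfl
  have n1 : n 1 = τ 0 := rfl
  have s1 := hH.symm hω hv 1 0
  have s2 := hH'.symm hω hw 1 0
  simp only [Fin.sum_univ_two, inner_add_left, inner_add_right, inner_smul_left, inner_smul_right,
    conj_trivial, n0, n1, s1, s2] at h1 h2 ⊢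
  rw [real_inner_comm (H 0 1) (H' 0 0), real_inner_comm (H 1 1) (H' 0 0),
    real_inner_comm (H 0 1) (H' 0 1), real_inner_comm (H 0 0) (H' 0 1),
    real_inner_comm (H 1 1) (H' 0 1), real_inner_comm (H 0 0) (H' 1 1),
    real_inner_comm (H 0 1) (H' 1 1)] at h2
  linear_combination h1 + h2 + (inner ℝ (H 0 0) (H' 1 1) + inner ℝ (H 1 1) (H' 0 0) -
    2 * inner ℝ (H 0 1) (H' 0 1)) * hτ

end hess

/-! ### Localization -/

/-- Near `P` the set `ω` is invariant under translations in some direction. -/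
def IsGoodBall (ω : Set Plane) (P : Plane) (ρ : ℝ) : Prop :=
  0 < ρ ∧ ∃ τ : Plane, τ 0 ^ 2 + τ 1 ^ 2 = 1 ∧ IsInvariantNear ω P ρ τ

section local_hess

variable {ω U : Set Plane} {P τ : Plane} {ρ : ℝ} {u v w : Jet ω} {f g : L2 ω}
  {H H' : Fin 2 → Fin 2 → L2 ω} {χ ψ φ : Plane → ℝ}

theorem mulL_add_fun (hχ : IsTestFunction U χ) (hψ : IsTestFunction U ψ) (u : L2 ω) :
    mulL (fun x => χ x + ψ x) u = mulL χ u + mulL ψ u := by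
  rw [mulL, mulL, mulL, ← toL2_add (hχ.memLp_mul u) (hψ.memLp_mul u)]
  congr 1
  ext x
  ring

theorem mulL_zero_fun (u : L2 ω) : mulL (fun _ => 0) u = 0 := by
  rw [mulL]
  simp [toL2_zero]

theorem mulL_congr (h : ∀ x ∈ ω, χ x = ψ x) (hω : IsOpen ω) (u : L2 ω) : mulL χ u = mulL ψ u := by
  refine toL2_congr ?_
  filter_upwards [ae_restrict_mem hω.measurableSet] with x hx
  rw [h x hx]

theorem pd_congr (hω : IsOpen ω) (h : ∀ x ∈ ω, χ x = ψ x) (i : Fin 2) :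
    ∀ x ∈ ω, pd i χ x = pd i ψ x := by
  intro x hx
  have : χ =ᶠ[𝓝 x] ψ := by
    filter_upwards [hω.mem_nhds hx] with y hy using h y hy
  rw [pd, pd, this.fderiv_eq]

theorem jmul_congr (hω : IsOpen ω) (h : ∀ x ∈ ω, χ x = ψ x) (u : Jet ω) : jmul χ u = jmul ψ u :=
  Jet.ext (mulL_congr h hω _) fun i => by
    rw [jmul, jmul, mkJet_some, mkJet_some, mulL_congr h hω, mulL_congr (pd_congr hω h i) hω]

theorem jmul_add_fun (hχ : IsTestFunction U χ) (hψ : IsTestFunction U ψ) (u : Jet ω) :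
    jmul (fun x => χ x + ψ x) u = jmul χ u + jmul ψ u :=
  Jet.ext (mulL_add_fun hχ hψ _) fun i => by
    simp only [jmul, mkJet_some, PiLp.add_apply]
    rw [mulL_add_fun hχ hψ, pd_add hχ.differentiable hψ.differentiable,
      mulL_add_fun (hχ.pd i) (hψ.pd i)]
    abel

theorem jmul_zero_fun (u : Jet ω) : jmul (fun _ => 0) u = 0 :=
  Jet.ext (mulL_zero_fun _) fun i => by
    have : pd i (fun _ => (0 : ℝ)) = fun _ => 0 := by ext; simp [pd]
    simp only [jmul, mkJet_some, this, mulL_zero_fun]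
    simp

theorem jmul_sum_fun {ι : Type*} (s : Finset ι) {χ : ι → Plane → ℝ}
    (h : ∀ k ∈ s, IsTestFunction U (χ k)) (u : Jet ω) :
    jmul (fun x => ∑ k ∈ s, χ k x) u = ∑ k ∈ s, jmul (χ k) u := by
  classical
  induction s using Finset.induction_on with
  | empty => simpa using jmul_zero_fun u
  | insert a s ha ih =>
    simp only [Finset.sum_insert ha]
    rw [jmul_add_fun (h a (by simp)) (IsTestFunction.sum s fun k hk => h k (by simp [hk])),
      ih fun k hk => h k (by simp [hk])]

theorem HasLap.unique (hω : IsOpen ω) (h : HasLap u f) (h' : HasLap u g) : f = g := by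
  rw [← sub_eq_zero]
  refine eq_zero_of_inner_test hω fun φ hφ => ?_
  have h1 := h φ hφ
  have h2 := h' φ hφ
  rw [inner_sub_left]
  linarith

/-- Local regularity in a ball with an invariant direction. The tangential derivative in H¹₀ is kept
in the conclusion, since it is what removes boundary terms later. -/
theorem exists_local_hess (hω : IsOpen ω) (hb : Bornology.IsBounded ω) (hρ : 0 < ρ)
    (hτ : τ 0 ^ 2 + τ 1 ^ 2 = 1) (hinv : IsInvariantNear ω P ρ τ) (hu : u ∈ H10 ω ω)
    (hf : HasLap u f) (hχ : IsTestFunction (Metric.ball P (ρ / 4)) χ) :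
    ∃ H, HasHess (jmul χ u) H ∧ ∃ z ∈ H10 ω ω, z none = dirDeriv τ (jmul χ u) := by
  have hw := H10.jmul hχ hu
  have hg := hf.jmul hχ (H10.isWeakJet hu)
  obtain ⟨z, hz, ez⟩ := exists_tangential hω hb hρ hτ hinv hw hg
  obtain ⟨H, hH⟩ := exists_hess hτ (H10.isWeakJet hw) hg (H10.isWeakJet hz) ez
  exact ⟨H, hH, z, hz, ez⟩

theorem inner_eq_zero_of_ae {O : Set Plane} {a b : L2 ω}
    (ha : ∀ᵐ x ∂volume.restrict ω, x ∈ O → a x = 0)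
    (hb : ∀ᵐ x ∂volume.restrict ω, x ∉ O → b x = 0) : inner ℝ a b = 0 := by
  rw [inner_L2_eq]
  refine integral_eq_zero_of_ae ?_
  filter_upwards [ha, hb] with x h1 h2
  by_cases hx : x ∈ O
  · simp [h1 hx]
  · simp [h2 hx]

theorem HasHess.ae_eq_zero (hω : IsOpen ω) {O : Set Plane} (hO : IsOpen O) (hw : IsWeakJet w)
    (hH : HasHess w H) (h : ∀ᵐ x ∂volume.restrict ω, x ∈ O → w none x = 0) (i j : Fin 2) :
    ∀ᵐ x ∂volume.restrict ω, x ∈ O → H i j x = 0 :=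
  (hH i j).ae_eq_zero hω hO ((hw j).ae_eq_zero hω hO h)

/-- Second derivatives can be integrated by parts if one of the functions is localized. -/
theorem hess_inner_eq_of_local (hω : IsOpen ω) (hb : Bornology.IsBounded ω)
    (hP : IsGoodBall ω P ρ) (hu : u ∈ H10 ω ω) (hf : HasLap u f)
    (hχ : IsTestFunction Set.univ χ) (hψ : IsTestFunction (Metric.ball P (ρ / 8)) ψ)
    (hH : HasHess (jmul χ u) H) (hH' : HasHess (jmul ψ u) H') :
    ∑ i : Fin 2, ∑ j : Fin 2, inner ℝ (H i j) (H' i j) =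
      inner ℝ (∑ i : Fin 2, H i i) (∑ i : Fin 2, H' i i) := by
  obtain ⟨hρ, τ, hτ, hinv⟩ := hP
  -- χ need not be localized, so it is replaced by ηχ, supported in the ball of radius ρ/4. As η = 1
  -- on the ball of radius ρ/8, second derivatives do not change where the other factor lives.
  let η : ContDiffBump P := ⟨ρ / 8, ρ / 6, by positivity, by linarith⟩
  have hη : IsTestFunction (Metric.ball P (ρ / 4)) η :=
    ⟨η.contDiff, η.hasCompactSupport, by
      rw [η.tsupport_eq]; exact Metric.closedBall_subset_ball (by change ρ / 6 < ρ / 4; linarith)⟩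
  have hηχ : IsTestFunction (Metric.ball P (ρ / 4)) (fun x => η x * χ x) :=
    hη.mul_smooth hχ.smooth
  have hψ' : IsTestFunction (Metric.ball P (ρ / 4)) ψ :=
    hψ.mono (Metric.ball_subset_ball (by linarith))
  obtain ⟨H1, hH1, y, hy, ey⟩ := exists_local_hess hω hb hρ hτ hinv hu hf hηχ
  obtain ⟨H2, hH2, z, hz, ez⟩ := exists_local_hess hω hb hρ hτ hinv hu hf hψ'
  obtain rfl := hH2.unique hω hH'
  have j1 := H10.isWeakJet (H10.jmul hηχ hu)
  have j2 := H10.isWeakJet (H10.jmul hψ' hu)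
  have j3 := H10.isWeakJet (H10.jmul hχ hu)
  have main := hess_inner_eq_of_tangential hω hτ j1 j2 hH1 hH2 hy hz ey ez
  have z1 : ∀ i j, ∀ᵐ x ∂volume.restrict ω, x ∈ Metric.ball P (ρ / 8) →
      (H i j - H1 i j : L2 ω) x = 0 := by
    refine (hH.sub hH1).ae_eq_zero hω Metric.isOpen_ball (fun i => (j3 i).sub (j1 i)) ?_
    filter_upwards [Lp.coeFn_sub (jmul χ u none) (jmul (fun x => η x * χ x) u none),
      hχ.coeFn_mulL (u none), hηχ.coeFn_mulL (u none)] with x h1 h2 h3 hx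
    rw [PiLp.sub_apply, h1, Pi.sub_apply]
    change mulL χ (u none) x - mulL (fun x => η x * χ x) (u none) x = 0
    rw [h2, h3, η.one_of_mem_closedBall (Metric.ball_subset_closedBall hx)]
    ring
  have z2 : ∀ i j, ∀ᵐ x ∂volume.restrict ω, x ∉ Metric.ball P (ρ / 8) → H2 i j x = 0 := by
    intro i j
    have := hH2.ae_eq_zero hω (isClosed_tsupport ψ).isOpen_compl j2 (by
      filter_upwards [hψ.coeFn_mulL (u none)] with x h1 hx
      change mulL ψ (u none) x = 0
      rw [h1, image_eq_zero_of_notMem_tsupport hx, zero_mul]) i j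
    filter_upwards [this] with x h1 hx
    exact h1 fun hm => hx (hψ.support hm)
  have e : ∀ i j k l, inner ℝ (H i j) (H2 k l) = inner ℝ (H1 i j) (H2 k l) := by
    intro i j k l
    rw [← sub_eq_zero, ← inner_sub_left]
    exact inner_eq_zero_of_ae (z1 i j) (z2 k l)
  simp only [Fin.sum_univ_two, inner_add_left, inner_add_right, e] at main ⊢
  exact main

/-- For a cut-off that is a sum of localized cut-offs, the second derivatives of the truncated
function exist and their norm is that of the Laplacian. -/
theorem exists_hess_of_sum (hω : IsOpen ω) (hb : Bornology.IsBounded ω) (hu : u ∈ H10 ω ω)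
    (hf : HasLap u f) (s : Finset Plane) (ρ : Plane → ℝ) (hρ : ∀ P ∈ s, IsGoodBall ω P (ρ P))
    {χ : Plane → Plane → ℝ} (hχ : ∀ P ∈ s, IsTestFunction (Metric.ball P (ρ P / 8)) (χ P)) :
    ∃ H, HasHess (jmul (fun x => ∑ P ∈ s, χ P x) u) H ∧
      ∑ i : Fin 2, ∑ j : Fin 2, ‖H i j‖ ^ 2 = ‖∑ i : Fin 2, H i i‖ ^ 2 := by
  have hχ' : ∀ P ∈ s, IsTestFunction Set.univ (χ P) := fun P hP => (hχ P hP).univ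
  have ex : ∀ P, ∃ H, P ∈ s → HasHess (jmul (χ P) u) H := by
    intro P
    by_cases hP : P ∈ s
    · obtain ⟨h0, τ, hτ, hinv⟩ := hρ P hP
      obtain ⟨H, hH, -⟩ := exists_local_hess hω hb h0 hτ hinv hu hf
        ((hχ P hP).mono (Metric.ball_subset_ball (by linarith)))
      exact ⟨H, fun _ => hH⟩
    · exact ⟨0, fun h => absurd h hP⟩
  choose H hH using ex
  have hsum := HasHess.sum s fun P hP => hH P hP
  rw [← jmul_sum_fun s hχ' u] at hsum
  refine ⟨_, hsum, ?_⟩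
  -- The Hessian of the whole sum is paired with that of each localized piece. Summation over the
  -- pieces turns the second factor into the whole Hessian too.
  have key : ∀ P ∈ s, _ := fun P hP =>
    hess_inner_eq_of_local hω hb (hρ P hP) hu hf (IsTestFunction.sum s hχ') (hχ P hP) hsum (hH P hP)
  have := Finset.sum_congr (rfl : s = s) key
  simp only [← real_inner_self_eq_norm_sq]
  rw [Finset.sum_comm, ← inner_sum] at this
  have e2 : ∀ i : Fin 2, ∑ P ∈ s, ∑ j : Fin 2, inner ℝ (∑ k ∈ s, H k i j) (H P i j) =
      ∑ j : Fin 2, inner ℝ (∑ k ∈ s, H k i j) (∑ k ∈ s, H k i j) := by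
    intro i
    rw [Finset.sum_comm]
    refine Finset.sum_congr rfl fun j _ => ?_
    rw [inner_sum]
  simp only [e2] at this
  rw [this]
  congr 1
  rw [Finset.sum_comm]

/-- A smooth partition of unity on a compact set, subordinate to balls. -/
theorem exists_partition {K : Set Plane} (hK : IsCompact K) (ρ : Plane → ℝ)
    (hρ : ∀ P ∈ K, 0 < ρ P) :
    ∃ (s : Finset Plane) (χ : Plane → Plane → ℝ), (∀ P ∈ s, P ∈ K) ∧
      (∀ P ∈ s, IsTestFunction (Metric.ball P (ρ P)) (χ P)) ∧
      ∀ x ∈ K, ∑ P ∈ s, χ P x = 1 := by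
  obtain ⟨s, hs, hcov⟩ := hK.elim_nhds_subcover (fun P => Metric.ball P (ρ P))
    fun P hP => Metric.ball_mem_nhds P (hρ P hP)
  obtain ⟨f, hf⟩ := SmoothPartitionOfUnity.exists_isSubordinate (modelWithCornersSelf ℝ Plane)
    hK.isClosed (fun P : s => Metric.ball (P : Plane) (ρ P)) (fun _ => Metric.isOpen_ball)
    (fun x hx => by
      obtain ⟨P, hP, h⟩ := mem_iUnion₂.1 (hcov hx)
      exact mem_iUnion.2 ⟨⟨P, hP⟩, h⟩)
  refine ⟨s, fun P => if h : P ∈ s then f ⟨P, h⟩ else 0, hs, fun P hP => ?_, fun x hx => ?_⟩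
  · simp only [hP, dif_pos]
    have hsub := hf ⟨P, hP⟩
    refine ⟨(f ⟨P, hP⟩).contMDiff.contDiff, ?_, hsub⟩
    exact (Metric.isBounded_ball.subset hsub).isCompact_closure.of_isClosed_subset
      (isClosed_tsupport _) subset_closure
  · have h1 := f.sum_eq_one hx
    rw [finsum_eq_sum_of_fintype] at h1
    rw [← h1, ← Finset.sum_coe_sort s]
    refine Finset.sum_congr rfl fun P _ => ?_
    simp

end local_hess

/-! ### Geometry of polygonal domains -/

section geometry

variable {K : ℕ} [NeZero K] {poly : Polygon Plane K} {ω : Set Plane}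

theorem edgeSet_eq_segment (poly : Polygon Plane K) (i : Fin K) :
    poly.edgeSet ℝ i = segment ℝ (poly i) (poly (i + 1)) := by
  obtain ⟨m, rfl⟩ := Nat.exists_eq_succ_of_ne_zero (NeZero.ne K)
  rw [Polygon.edgeSet, finRotate_apply, affineSegment_eq_segment]

namespace IsPolygonalDomain

theorem vertex_ne (h : IsPolygonalDomain poly ω) (i : Fin K) : poly i ≠ poly (i + 1) := by
  obtain ⟨m, rfl⟩ := Nat.exists_eq_succ_of_ne_zero (NeZero.ne K)
  have := h.nondegenerate.hasNondegenerateEdges i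
  rwa [finRotate_apply] at this

theorem frontier_cases (h : IsPolygonalDomain poly ω) {P : Plane} (hP : P ∈ frontier ω) :
    (∃ i, P = poly i) ∨ ∃ k, P ∈ openSide poly k := by
  rw [h.frontier_eq, Polygon.boundary, mem_iUnion] at hP
  obtain ⟨k, hk⟩ := hP
  rw [edgeSet_eq_segment, ← insert_endpoints_openSegment] at hk
  rcases hk with rfl | rfl | hk
  · exact Or.inl ⟨k, rfl⟩
  · exact Or.inl ⟨k + 1, rfl⟩
  · exact Or.inr ⟨k, hk⟩

theorem notMem_edge (h : IsPolygonalDomain poly ω) {k j : Fin K} (hj : j ≠ k) {P : Plane}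
    (hP : P ∈ openSide poly k) : P ∉ poly.edgeSet ℝ j := by
  intro hPj
  have hPk : P ∈ poly.edgeSet ℝ k := by
    rw [edgeSet_eq_segment]; exact openSegment_subset_segment ℝ _ _ hP
  rcases eq_or_ne j (k + 1) with rfl | h1
  · have := (h.adjacent_sides k).subset ⟨hPk, hPj⟩
    rw [mem_singleton_iff] at this
    rw [this] at hP
    exact h.vertex_ne k (right_mem_openSegment_iff.1 hP)
  rcases eq_or_ne k (j + 1) with rfl | h2
  · have := (h.adjacent_sides j).subset ⟨hPj, hPk⟩
    rw [mem_singleton_iff] at this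
    rw [this] at hP
    exact h.vertex_ne (j + 1) (left_mem_openSegment_iff.1 hP)
  · exact (Set.disjoint_left.1 (h.other_sides j k hj h1 h2)) hPj hPk

theorem isCompact_edge (i : Fin K) : IsCompact (poly.edgeSet ℝ i) := by
  rw [edgeSet_eq_segment, segment_eq_image_lineMap]
  exact isCompact_Icc.image AffineMap.lineMap_continuous

theorem exists_mem_frontier (hω : IsOpen ω) {s : Set Plane} (hs : IsPreconnected s)
    (h1 : (s ∩ ω).Nonempty) (h2 : (s ∩ ωᶜ).Nonempty) : ∃ z ∈ s, z ∈ frontier ω := by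
  by_contra! h
  have hsub : s ⊆ ω ∪ (closure ω)ᶜ := fun x hx => by
    by_cases hxω : x ∈ ω
    · exact Or.inl hxω
    · refine Or.inr fun hc => h x hx ?_
      rw [hω.frontier_eq]
      exact ⟨hc, hxω⟩
  obtain ⟨y, hys, hy⟩ := h2
  obtain ⟨z, -, hz, hz'⟩ := hs _ _ hω isClosed_closure.isOpen_compl hsub h1
    ⟨y, hys, (hsub hys).resolve_left hy⟩
  exact hz' (subset_closure hz)

theorem exists_goodBall_interior (hω : IsOpen ω) {P : Plane} (hP : P ∈ ω) :
    ∃ ρ, IsGoodBall ω P ρ ∧ Metric.ball P ρ ⊆ ω := by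
  obtain ⟨ρ, hρ, hsub⟩ := Metric.isOpen_iff.1 hω P hP
  exact ⟨ρ, ⟨hρ, stdVec 0, by simp [stdVec], fun x _ h hx => hsub hx⟩, hsub⟩

/-- A small ball centred inside a side meets the boundary only in a chord of that side. A segment
parallel to the side that leaves ω would meet this chord, so its starting point would lie on it,
although ω is open. -/
theorem exists_goodBall_side (h : IsPolygonalDomain poly ω) {k : Fin K} {P : Plane}
    (hP : P ∈ openSide poly k) : ∃ ρ, IsGoodBall ω P ρ ∧
      ∀ j, j ≠ k → Disjoint (Metric.ball P ρ) (poly.edgeSet ℝ j) := by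
  have h1 : ∀ᶠ ρ in 𝓝[>] (0 : ℝ), ∀ j, j ≠ k →
      Disjoint (Metric.ball P ρ) (poly.edgeSet ℝ j) := by
    rw [eventually_all]
    intro j
    by_cases hj : j = k
    · exact Eventually.of_forall fun _ h => absurd hj h
    have ho : (poly.edgeSet ℝ j)ᶜ ∈ 𝓝 P :=
      (isCompact_edge j).isClosed.isOpen_compl.mem_nhds (h.notMem_edge hj hP)
    obtain ⟨ρ, hρ, hsub⟩ := Metric.mem_nhds_iff.1 ho
    filter_upwards [Ioo_mem_nhdsGT hρ] with r hr _
    exact Set.disjoint_left.2 fun x hx hm => hsub (Metric.ball_subset_ball hr.2.le hx) hm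
  set A := poly k with hA
  set B := poly (k + 1) with hB
  have hAB : B - A ≠ 0 := sub_ne_zero.2 (h.vertex_ne k).symm
  have hd : 0 < ‖B - A‖ := norm_pos_iff.2 hAB
  have hP' := hP
  rw [openSide, openSegment_eq_image'] at hP'
  obtain ⟨t, ⟨ht0, ht1⟩, rfl⟩ := hP'
  have h2 : ∀ᶠ ρ in 𝓝[>] (0 : ℝ), 0 < ρ ∧ ρ < t * ‖B - A‖ ∧ ρ < (1 - t) * ‖B - A‖ := by
    filter_upwards [Ioo_mem_nhdsGT (mul_pos ht0 hd),
      Ioo_mem_nhdsGT (mul_pos (sub_pos.2 ht1) hd)] with r h1 h2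
    exact ⟨h1.1, h1.2, h2.2⟩
  obtain ⟨ρ, hdis, hρ0, hρt, hρt'⟩ := (h1.and h2).exists
  refine ⟨ρ, ⟨hρ0, ‖B - A‖⁻¹ • (B - A), ?_, ?_⟩, hdis⟩
  · have : ‖‖B - A‖⁻¹ • (B - A)‖ ^ 2 = 1 := by
      rw [norm_smul, norm_inv, norm_norm, inv_mul_cancel₀ hd.ne', one_pow]
    rwa [EuclideanSpace.norm_sq_eq, Fin.sum_univ_two, Real.norm_eq_abs, Real.norm_eq_abs, sq_abs,
      sq_abs] at this
  -- The radius is below the distances from the centre to both endpoints, so the chord in the ball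
  -- does not leave the side.
  · have online : ∀ s : ℝ, A + s • (B - A) ∈ Metric.ball (A + t • (B - A)) ρ →
        A + s • (B - A) ∈ frontier ω := by
      intro s hs
      rw [Metric.mem_ball, dist_add_left, dist_eq_norm, ← sub_smul, norm_smul,
        Real.norm_eq_abs] at hs
      have h3 : |s - t| < t := lt_of_mul_lt_mul_right (hs.trans hρt) hd.le
      have h4 : |s - t| < 1 - t := lt_of_mul_lt_mul_right (hs.trans hρt') hd.le
      rw [abs_lt] at h3 h4
      rw [h.frontier_eq, Polygon.boundary, mem_iUnion]
      refine ⟨k, ?_⟩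
      rw [edgeSet_eq_segment, segment_eq_image']
      exact ⟨s, ⟨by linarith, by linarith⟩, rfl⟩
    rintro x ⟨hxω, hxb⟩ a hya
    by_contra hy
    set τ := ‖B - A‖⁻¹ • (B - A) with hτ
    have hseg : segment ℝ x (x + a • τ) ⊆ Metric.ball (A + t • (B - A)) ρ :=
      (convex_ball _ _).segment_subset hxb hya
    -- A crossing point `z` must lie on side `k`; since the segment is parallel to that side, `x`
    -- lies on the same line.
    obtain ⟨z, hz, hzf⟩ := exists_mem_frontier h.isOpen
      (convex_segment (𝕜 := ℝ) x (x + a • τ)).isPreconnected ⟨x, left_mem_segment ℝ _ _, hxω⟩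
      ⟨_, right_mem_segment ℝ _ _, hy⟩
    have hzb := hseg hz
    rw [h.frontier_eq, Polygon.boundary, mem_iUnion] at hzf
    obtain ⟨j, hj⟩ := hzf
    have hjk : j = k := by
      by_contra hne
      exact Set.disjoint_left.1 (hdis j hne) hzb hj
    rw [hjk, edgeSet_eq_segment, segment_eq_image'] at hj
    obtain ⟨s, -, hs⟩ := hj
    rw [segment_eq_image'] at hz
    obtain ⟨b, -, hb⟩ := hz
    have hx : x = A + (s - b * a * ‖B - A‖⁻¹) • (B - A) := by
      have e1 : x + b • (x + a • τ - x) = A + s • (B - A) := hb.trans hs.symm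
      rw [add_sub_cancel_left, hτ, smul_smul, smul_smul] at e1
      rw [sub_smul, ← add_sub_assoc, ← e1, add_sub_assoc, ← sub_smul]
      simp [mul_assoc]
    rw [hx] at hxω hxb
    have := online _ hxb
    rw [h.isOpen.frontier_eq] at this
    exact this.2 hxω

end IsPolygonalDomain

/-- Near `P` the set `ω` is a sector with half opening angle `κ` and bisector `b`. -/
structure IsSector (ω : Set Plane) (P : Plane) (ρ : ℝ) (b c : Plane) (κ : ℝ) : Prop where
  pos : 0 < ρ
  norm_b : ‖b‖ = 1
  norm_c : ‖c‖ = 1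
  inner_bc : inner ℝ b c = 0
  mem_iff : ∀ r θ : ℝ, 0 < r → r < ρ → |θ| ≤ Real.pi →
    (P + (r * Real.cos θ) • b + (r * Real.sin θ) • c ∈ ω ↔ |θ| < κ)

theorem norm_inv_norm_smul {e : Plane} (he : e ≠ 0) : ‖‖e‖⁻¹ • e‖ = 1 := by
  rw [norm_smul, norm_inv, norm_norm, inv_mul_cancel₀ (norm_pos_iff.2 he).ne']

/-- Polar coordinates with respect to the bisector of a convex cone. -/
theorem exists_frame {e g : Plane} (he : e ≠ 0) (hg : g ≠ 0) (h : ∀ t : ℝ, e ≠ t • g) :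
    ∃ (b c : Plane) (κ : ℝ), ‖b‖ = 1 ∧ ‖c‖ = 1 ∧ inner ℝ b c = 0 ∧ 0 < κ ∧ κ < Real.pi / 2 ∧
      ∀ r θ : ℝ, 0 < r →
        ((∃ s t : ℝ, 0 < s ∧ 0 < t ∧ (r * Real.cos θ) • b + (r * Real.sin θ) • c = s • e + t • g) ↔
          0 < Real.sin (κ - θ) ∧ 0 < Real.sin (κ + θ)) ∧
        ((∃ s t : ℝ, 0 ≤ s ∧ 0 ≤ t ∧ (r * Real.cos θ) • b + (r * Real.sin θ) • c = s • e + t • g) ↔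
          0 ≤ Real.sin (κ - θ) ∧ 0 ≤ Real.sin (κ + θ)) := by
  have he' : 0 < ‖e‖ := norm_pos_iff.2 he
  have hg' : 0 < ‖g‖ := norm_pos_iff.2 hg
  set e1 : Plane := ‖e‖⁻¹ • e with he1
  set g1 : Plane := ‖g‖⁻¹ • g with hg1
  have ne1 : ‖e1‖ = 1 := norm_inv_norm_smul he
  have ng1 : ‖g1‖ = 1 := norm_inv_norm_smul hg
  have ee : e = ‖e‖ • e1 := by rw [he1, smul_inv_smul₀ he'.ne']
  have eg : g = ‖g‖ • g1 := by rw [hg1, smul_inv_smul₀ hg'.ne']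
  have hS : e1 + g1 ≠ 0 := by
    intro h0
    refine h (- (‖e‖ * ‖g‖⁻¹)) ?_
    rw [neg_smul, mul_smul, ← hg1]
    nth_rw 1 [ee]
    rw [← smul_neg, eq_neg_of_add_eq_zero_left h0]
  have hD : g1 - e1 ≠ 0 := by
    intro h0
    refine h (‖e‖ * ‖g‖⁻¹) ?_
    rw [mul_smul, ← hg1]
    nth_rw 1 [ee]
    rw [sub_eq_zero.1 h0]
  have pS : 0 < ‖e1 + g1‖ := norm_pos_iff.2 hS
  have pD : 0 < ‖g1 - e1‖ := norm_pos_iff.2 hD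
  have par : ‖e1 + g1‖ ^ 2 + ‖g1 - e1‖ ^ 2 = 4 := by
    have := norm_add_sq_real e1 g1
    have h2 := norm_sub_sq_real g1 e1
    rw [real_inner_comm] at h2
    rw [this, h2, ne1, ng1]
    ring
  set S := ‖e1 + g1‖ with hSd
  set D := ‖g1 - e1‖ with hDd
  -- Half the angle between the unit vectors: |e₁ + g₁| = 2 cos κ and |g₁ - e₁| = 2 sin κ. The
  -- vectors themselves sit at the angles -κ and κ.
  set κ := Real.arccos (S / 2) with hκ
  have S2 : S / 2 < 1 := by nlinarith
  have ck : Real.cos κ = S / 2 := Real.cos_arccos (by linarith) S2.le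
  have sk : Real.sin κ = D / 2 := by
    rw [hκ, Real.sin_arccos, show 1 - (S / 2) ^ 2 = (D / 2) ^ 2 by nlinarith,
      Real.sqrt_sq (by positivity)]
  have k0 : 0 < κ := Real.arccos_pos.2 S2
  have k1 : κ < Real.pi / 2 := Real.arccos_lt_pi_div_two.2 (by positivity)
  set b : Plane := S⁻¹ • (e1 + g1) with hb
  set c : Plane := D⁻¹ • (g1 - e1) with hc
  have nb : ‖b‖ = 1 := norm_inv_norm_smul hS
  have nc : ‖c‖ = 1 := norm_inv_norm_smul hD
  have ibc : inner ℝ b c = 0 := by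
    rw [hb, hc, inner_smul_left, inner_smul_right, inner_add_left, inner_sub_right,
      inner_sub_right, real_inner_self_eq_norm_sq, real_inner_self_eq_norm_sq, ne1, ng1,
      real_inner_comm e1 g1]
    simp
  have icb : inner ℝ c b = 0 := by rw [real_inner_comm]; exact ibc
  have bb : inner ℝ b b = 1 := by rw [real_inner_self_eq_norm_sq, nb, one_pow]
  have cc : inner ℝ c c = 1 := by rw [real_inner_self_eq_norm_sq, nc, one_pow]
  have e1' : e1 = Real.cos κ • b - Real.sin κ • c := by
    rw [ck, sk, hb, hc, smul_smul, smul_smul, show S / 2 * S⁻¹ = 1 / 2 by field_simp,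
      show D / 2 * D⁻¹ = 1 / 2 by field_simp]
    module
  have g1' : g1 = Real.cos κ • b + Real.sin κ • c := by
    rw [ck, sk, hb, hc, smul_smul, smul_smul, show S / 2 * S⁻¹ = 1 / 2 by field_simp,
      show D / 2 * D⁻¹ = 1 / 2 by field_simp]
    module
  have ck0 : 0 < Real.cos κ := by rw [ck]; positivity
  have sk0 : 0 < Real.sin κ := by rw [sk]; positivity
  -- Coordinates in the basis (e, g) are positive multiples of sin(κ - θ) and sin(κ + θ), so
  -- membership in the cone becomes a pair of sign conditions.
  have coord : ∀ r θ s t : ℝ, (r * Real.cos θ) • b + (r * Real.sin θ) • c = s • e + t • g ↔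
      r * Real.sin (κ - θ) = 2 * Real.sin κ * Real.cos κ * ‖e‖ * s ∧
      r * Real.sin (κ + θ) = 2 * Real.sin κ * Real.cos κ * ‖g‖ * t := by
    intro r θ s t
    have exp : s • e + t • g = ((s * ‖e‖ + t * ‖g‖) * Real.cos κ) • b +
        ((t * ‖g‖ - s * ‖e‖) * Real.sin κ) • c := by
      nth_rw 1 [ee, eg]
      rw [e1', g1']
      module
    have eqv : (r * Real.cos θ) • b + (r * Real.sin θ) • c = s • e + t • g ↔
        r * Real.cos θ = (s * ‖e‖ + t * ‖g‖) * Real.cos κ ∧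
        r * Real.sin θ = (t * ‖g‖ - s * ‖e‖) * Real.sin κ := by
      rw [exp]
      constructor
      · intro hh
        have i1 := congrArg (fun v => inner ℝ b v) hh
        have i2 := congrArg (fun v => inner ℝ c v) hh
        simp only [inner_add_right, inner_smul_right, bb, cc, ibc, icb] at i1 i2
        constructor <;> linarith
      · rintro ⟨h1, h2⟩
        rw [h1, h2]
    rw [eqv, Real.sin_sub, Real.sin_add]
    constructor
    · rintro ⟨h1, h2⟩
      constructor
      · linear_combination Real.sin κ * h1 - Real.cos κ * h2
      · linear_combination Real.sin κ * h1 + Real.cos κ * h2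
    · rintro ⟨h1, h2⟩
      constructor
      · refine mul_left_cancel₀ sk0.ne' ?_
        linear_combination (h1 + h2) / 2
      · refine mul_left_cancel₀ ck0.ne' ?_
        linear_combination (h2 - h1) / 2
  refine ⟨b, c, κ, nb, nc, ibc, k0, k1, fun r θ hr => ?_⟩
  have p1 : 0 < 2 * Real.sin κ * Real.cos κ * ‖e‖ := by positivity
  have p2 : 0 < 2 * Real.sin κ * Real.cos κ * ‖g‖ := by positivity
  simp only [coord]
  constructor
  · constructor
    · rintro ⟨s, t, hs, ht, h1, h2⟩
      exact ⟨pos_of_mul_pos_right (h1 ▸ mul_pos p1 hs) hr.le,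
        pos_of_mul_pos_right (h2 ▸ mul_pos p2 ht) hr.le⟩
    · rintro ⟨h1, h2⟩
      exact ⟨r * Real.sin (κ - θ) / _, r * Real.sin (κ + θ) / _, div_pos (mul_pos hr h1) p1,
        div_pos (mul_pos hr h2) p2, (mul_div_cancel₀ _ p1.ne').symm,
        (mul_div_cancel₀ _ p2.ne').symm⟩
  · constructor
    · rintro ⟨s, t, hs, ht, h1, h2⟩
      exact ⟨nonneg_of_mul_nonneg_right (h1 ▸ mul_nonneg p1.le hs) hr,
        nonneg_of_mul_nonneg_right (h2 ▸ mul_nonneg p2.le ht) hr⟩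
    · rintro ⟨h1, h2⟩
      exact ⟨r * Real.sin (κ - θ) / _, r * Real.sin (κ + θ) / _,
        div_nonneg (mul_nonneg hr.le h1) p1.le, div_nonneg (mul_nonneg hr.le h2) p2.le,
        (mul_div_cancel₀ _ p1.ne').symm, (mul_div_cancel₀ _ p2.ne').symm⟩

theorem dist_polar {P b c : Plane} (hb : ‖b‖ = 1) (hc : ‖c‖ = 1) (hbc : inner ℝ b c = 0)
    {r : ℝ} (hr : 0 ≤ r) (θ : ℝ) :
    dist (P + (r * Real.cos θ) • b + (r * Real.sin θ) • c) P = r := by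
  rw [add_assoc, dist_self_add_left]
  have : ‖(r * Real.cos θ) • b + (r * Real.sin θ) • c‖ ^ 2 = r ^ 2 := by
    rw [norm_add_sq_real, norm_smul, norm_smul, hb, hc, inner_smul_left, inner_smul_right, hbc]
    simp only [Real.norm_eq_abs, mul_one, sq_abs, mul_zero, add_zero]
    linear_combination r ^ 2 * Real.sin_sq_add_cos_sq θ
  exact (pow_left_inj₀ (norm_nonneg _) hr two_ne_zero).1 this

theorem IsPolygonalDomain.not_parallel (h : IsPolygonalDomain poly ω) (i : Fin K) :
    poly (i - 1) - poly i ≠ 0 ∧ poly (i + 1) - poly i ≠ 0 ∧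
      ∀ t : ℝ, poly (i - 1) - poly i ≠ t • (poly (i + 1) - poly i) := by
  have h1 := h.nondegenerate (i - 1)
  have e1 : i - 1 + 1 = i := sub_add_cancel i 1
  have e2 : i - 1 + 2 = i + 1 := by
    rw [show (2 : Fin K) = 1 + 1 from Fin.ext (Nat.add_mod 1 1 K), ← add_assoc, e1]
  rw [e1, e2, affineIndependent_iff_not_collinear_set] at h1
  have h2 := h.vertex_ne (i - 1)
  rw [e1] at h2
  refine ⟨sub_ne_zero.2 h2, sub_ne_zero.2 (h.vertex_ne i).symm, fun t ht => h1 ?_⟩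
  rw [collinear_iff_of_mem (p₀ := poly i) (by simp)]
  refine ⟨poly (i + 1) - poly i, ?_⟩
  rintro p (rfl | rfl | rfl)
  · exact ⟨t, by rw [← ht]; simp⟩
  · exact ⟨0, by simp⟩
  · exact ⟨1, by simp⟩

/-- For |θ| ≤ π and κ < π/2, both sin(κ - θ) and sin(κ + θ) are positive exactly when |θ| < κ. -/
theorem IsPolygonalDomain.exists_sector_convex (h : IsPolygonalDomain poly ω) {i : Fin K}
    (hi : IsConvexCorner poly ω i) :
    ∃ ρ b c κ, IsSector ω (poly i) ρ b c κ ∧ 0 < κ ∧ κ < Real.pi / 2 := by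
  obtain ⟨n1, n2, n3⟩ := h.not_parallel i
  obtain ⟨b, c, κ, hb, hc, hbc, k0, k1, hk⟩ := exists_frame n1 n2 n3
  obtain ⟨ρ, hρ, hω⟩ := hi
  refine ⟨ρ, b, c, κ, ⟨hρ, hb, hc, hbc, fun r θ hr hrρ hθ => ?_⟩, k0, k1⟩
  have hx := hω (poly i + (r * Real.cos θ) • b + (r * Real.sin θ) • c)
    (by rw [Metric.mem_ball, dist_polar hb hc hbc hr.le]; exact hrρ)
  simp only [add_assoc, add_right_inj] at hx
  rw [add_assoc, hx, (hk r θ hr).1]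
  rw [abs_le] at hθ
  constructor
  · rintro ⟨h1, h2⟩
    rw [abs_lt]
    constructor
    · by_contra! h3
      exact h2.not_ge (Real.sin_nonpos_of_nonpos_of_neg_pi_le (by linarith) (by linarith))
    · by_contra! h3
      exact h1.not_ge (Real.sin_nonpos_of_nonpos_of_neg_pi_le (by linarith) (by linarith))
  · intro h1
    rw [abs_lt] at h1
    exact ⟨Real.sin_pos_of_pos_of_lt_pi (by linarith) (by linarith),
      Real.sin_pos_of_pos_of_lt_pi (by linarith) (by linarith)⟩

/-- The complement of a closed sector of half angle κ is a sector about the opposite bisector with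
half angle π - κ; hence the replacement of b by -b and of θ by π - θ. -/
theorem IsPolygonalDomain.exists_sector_reentrant (h : IsPolygonalDomain poly ω) {i : Fin K}
    (hi : IsReentrantCorner poly ω i) :
    ∃ ρ b c κ, IsSector ω (poly i) ρ b c κ ∧ 0 < κ ∧ κ < Real.pi := by
  obtain ⟨n1, n2, n3⟩ := h.not_parallel i
  obtain ⟨b, c, κ, hb, hc, hbc, k0, k1, hk⟩ := exists_frame n1 n2 n3
  obtain ⟨ρ, hρ, hω⟩ := hi
  have hb' : ‖-b‖ = 1 := by rw [norm_neg, hb]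
  have hbc' : inner ℝ (-b) c = 0 := by rw [inner_neg_left, hbc, neg_zero]
  refine ⟨ρ, -b, c, Real.pi - κ, ⟨hρ, hb', hc, hbc', fun r θ hr hrρ hθ => ?_⟩, by linarith,
    by linarith⟩
  have hx := hω (poly i + (r * Real.cos θ) • (-b) + (r * Real.sin θ) • c)
    (by rw [Metric.mem_ball, dist_polar hb' hc hbc' hr.le]; exact hrρ)
  have e1 : (r * Real.cos θ) • (-b) + (r * Real.sin θ) • c =
      (r * Real.cos (Real.pi - θ)) • b + (r * Real.sin (Real.pi - θ)) • c := by
    rw [Real.cos_pi_sub, Real.sin_pi_sub]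
    module
  simp only [add_assoc, add_right_inj, e1] at hx
  rw [add_assoc, e1, hx, (hk r _ hr).2, show κ - (Real.pi - θ) = κ + θ - Real.pi by ring,
    show κ + (Real.pi - θ) = Real.pi - (θ - κ) by ring, Real.sin_pi_sub, Real.sin_sub_pi]
  rw [abs_le] at hθ
  constructor
  · intro h1
    by_contra! h2
    refine h1 ?_
    rcases le_abs.1 h2 with h3 | h3
    · exact ⟨neg_nonneg.2 (by
        rw [← neg_nonneg, ← Real.sin_sub_pi]
        exact Real.sin_nonneg_of_nonneg_of_le_pi (by linarith) (by linarith)),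
        Real.sin_nonneg_of_nonneg_of_le_pi (by linarith) (by linarith)⟩
    · refine ⟨neg_nonneg.2 (Real.sin_nonpos_of_nonpos_of_neg_pi_le (by linarith) (by linarith)), ?_⟩
      rw [← Real.sin_add_two_pi]
      exact Real.sin_nonneg_of_nonneg_of_le_pi (by linarith) (by linarith)
  · rintro h1 ⟨h2, h3⟩
    rw [abs_lt] at h1
    rcases le_total 0 θ with h4 | h4
    · have := Real.sin_pos_of_pos_of_lt_pi (x := κ + θ) (by linarith) (by linarith)
      linarith
    · have := Real.sin_neg_of_neg_of_neg_pi_lt (x := θ - κ) (by linarith) (by linarith)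
      linarith

end geometry

/-! ### Functions truncated away from the corners -/

section truncation

variable {K : ℕ} [NeZero K] {poly : Polygon Plane K} {ω : Set Plane} {u v w : Jet ω} {f g : L2 ω}
  {χ ψ : Plane → ℝ}

/-- The second derivatives of `w` exist and are bounded by `g`. -/
def HessBound (w : Jet ω) (g : L2 ω) : Prop :=
  ∃ H, HasHess w H ∧ ∑ i : Fin 2, ∑ j : Fin 2, ‖H i j‖ ^ 2 ≤ ‖g‖ ^ 2

theorem HasHess.memH2 (hω : IsOpen ω) (hw : IsWeakJet w) {H : Fin 2 → Fin 2 → L2 ω}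
    (hH : HasHess w H) : MemH2 (w none) :=
  ⟨fun i => ⟨_, hw i⟩, fun i j => by
    rw [(hw i).weakPartial_eq hω]
    exact ⟨_, hH j i⟩⟩

theorem HasHess.weakLaplacian_eq (hω : IsOpen ω) (hw : IsWeakJet w) {H : Fin 2 → Fin 2 → L2 ω}
    (hH : HasHess w H) (hg : HasLap w g) : weakLaplacian (w none) = g := by
  rw [← hH.hasLap hω hg, weakLaplacian]
  refine Finset.sum_congr rfl fun i _ => ?_
  rw [(hw i).weakPartial_eq hω, (hH i i).weakPartial_eq hω]

theorem HessBound.seminormH2_le (hω : IsOpen ω) (hw : IsWeakJet w) (h : HessBound w g) :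
    seminormH2 (w none) ≤ ‖g‖ := by
  obtain ⟨H, hH, hle⟩ := h
  rw [seminormH2, ← Real.sqrt_sq (norm_nonneg g)]
  refine Real.sqrt_le_sqrt (le_of_eq_of_le ?_ hle)
  refine Finset.sum_congr rfl fun i _ => Finset.sum_congr rfl fun j _ => ?_
  rw [(hw j).weakPartial_eq hω, (hH i j).weakPartial_eq hω]

/-- Bounds on second derivatives pass to limits. -/
theorem HessBound.of_tendsto (hω : IsOpen ω) {u : ℕ → Jet ω} {g : ℕ → L2 ω} {U : Jet ω} {G : L2 ω}
    (hu : ∀ n, HessBound (u n) (g n)) (hd : ∀ n m, HessBound (u n - u m) (g n - g m))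
    (hU : Tendsto u atTop (𝓝 U)) (hG : Tendsto g atTop (𝓝 G)) : HessBound U G := by
  choose H hH hle using hu
  -- Second derivatives are unique, so the bound for the difference of two functions bounds the
  -- difference of their Hessians: these form Cauchy sequences.
  have hdiff : ∀ n m i j, ‖H n i j - H m i j‖ ≤ ‖g n - g m‖ := by
    intro n m i j
    obtain ⟨H', hH', hle'⟩ := hd n m
    obtain rfl := hH'.unique hω ((hH n).sub (hH m))
    refine le_of_sq_le_sq ?_ (norm_nonneg _)
    refine le_trans ?_ hle'
    have h1 : ‖H n i j - H m i j‖ ^ 2 ≤ ∑ j, ‖H n i j - H m i j‖ ^ 2 :=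
      Finset.single_le_sum (f := fun j => ‖H n i j - H m i j‖ ^ 2) (fun _ _ => sq_nonneg _)
        (Finset.mem_univ j)
    exact h1.trans (Finset.single_le_sum (f := fun i => ∑ j, ‖H n i j - H m i j‖ ^ 2)
      (fun _ _ => Finset.sum_nonneg fun _ _ => sq_nonneg _) (Finset.mem_univ i))
  have hc : ∀ i j, ∃ L, Tendsto (fun n => H n i j) atTop (𝓝 L) := by
    intro i j
    refine cauchySeq_tendsto_of_complete ?_
    have hcg := hG.cauchySeq
    rw [Metric.cauchySeq_iff] at hcg ⊢
    intro ε hε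
    obtain ⟨N, hN⟩ := hcg ε hε
    refine ⟨N, fun m hm n hn => lt_of_le_of_lt ?_ (hN m hm n hn)⟩
    rw [dist_eq_norm, dist_eq_norm]
    exact hdiff m n i j
  choose L hL using hc
  rw [Jet.tendsto_iff] at hU
  refine ⟨L, fun i j => HasWeakPartial.of_tendsto (fun n => hH n i j) (hU.2 j) (hL i j), ?_⟩
  refine le_of_tendsto_of_tendsto' (b := atTop) ?_ (hG.norm.pow 2) hle
  exact tendsto_finsetSum _ fun i _ => tendsto_finsetSum _ fun j _ => (hL i j).norm.pow 2

theorem jmul_ae_eq_zero (hω : IsOpen ω) (hψ : IsTestFunction univ ψ) (hu : u ∈ H10 ω ω) :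
    (∀ᵐ x ∂volume.restrict ω, x ∈ (tsupport ψ)ᶜ → jmul ψ u none x = 0) ∧
      ∀ i : Fin 2, ∀ᵐ x ∂volume.restrict ω, x ∈ (tsupport ψ)ᶜ → jmul ψ u (some i) x = 0 := by
  have h0 : ∀ᵐ x ∂volume.restrict ω, x ∈ (tsupport ψ)ᶜ → jmul ψ u none x = 0 := by
    filter_upwards [hψ.coeFn_mulL (u none)] with x h1 hx
    change mulL ψ (u none) x = 0
    rw [h1, image_eq_zero_of_notMem_tsupport hx, zero_mul]
  exact ⟨h0, fun i => (H10.isWeakJet (H10.jmul hψ hu) i).ae_eq_zero hω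
    (isClosed_tsupport ψ).isOpen_compl h0⟩

/-- The weak form of the equation holds for test functions that do not vanish on the boundary, if
the solution is localized away from the part of the boundary that meets their support. -/
theorem HasLap.sum_inner_of_support (hω : IsOpen ω) {S : Set Plane} (hS : IsClosed S)
    (hw : ∀ i : Fin 2, ∀ᵐ x ∂volume.restrict ω, x ∉ S → w (some i) x = 0)
    (hg0 : ∀ᵐ x ∂volume.restrict ω, x ∉ S → g x = 0) (hg : HasLap w g)
    (hχ : IsTestFunction univ χ) (hd : S ∩ tsupport χ ∩ closure ω ⊆ ω) :
    ∑ i : Fin 2, inner ℝ (w (some i)) (toL2 ω (pd i χ)) = - inner ℝ g (toL2 ω χ) := by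
  set A := S ∩ tsupport χ ∩ closure ω with hA
  have hAc : IsCompact A := by
    rw [hA, inter_assoc, inter_comm S, inter_assoc]
    exact hχ.compact.isCompact.inter_right (isClosed_closure.inter hS)
  -- A cut-off η in C_c^∞(ω) equal to 1 near the compact set `A` makes ηχ an admissible test
  -- function; it has the same value and gradient as χ at the points of ω where `w` lives.
  obtain ⟨δ, hδ, hsub⟩ := hAc.exists_cthickening_subset_open hω hd
  have hBc : IsCompact (Metric.cthickening δ A) := hAc.cthickening
  have hball : ∀ P : Plane, ∃ ρ, P ∈ ω → 0 < ρ ∧ Metric.ball P ρ ⊆ ω := fun P => by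
    by_cases hP : P ∈ ω
    · obtain ⟨ρ, h1, h2⟩ := Metric.isOpen_iff.1 hω P hP
      exact ⟨ρ, fun _ => ⟨h1, h2⟩⟩
    · exact ⟨0, fun h => absurd h hP⟩
  choose ρ hρ using hball
  obtain ⟨s, θ, hs, hθ, hsum⟩ := exists_partition hBc ρ fun P hP => (hρ P (hsub hP)).1
  have hη : IsTestFunction ω fun x => ∑ P ∈ s, θ P x :=
    IsTestFunction.sum s fun P hP => (hθ P hP).mono (hρ P (hsub (hs P hP))).2
  set η : Plane → ℝ := fun x => ∑ P ∈ s, θ P x with hηd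
  have h1 := hg _ (hη.mul_smooth hχ.smooth)
  have hz : ∀ x ∈ ω, x ∈ S → ∀ᶠ y in 𝓝 x, χ y = η y * χ y := by
    intro x hx hxS
    by_cases hxχ : x ∈ tsupport χ
    · have hxA : x ∈ A := ⟨⟨hxS, hxχ⟩, subset_closure hx⟩
      have : Metric.thickening δ A ∈ 𝓝 x :=
        Metric.isOpen_thickening.mem_nhds (Metric.self_subset_thickening hδ A hxA)
      filter_upwards [this] with y hy
      rw [hηd]
      simp only
      rw [hsum y (Metric.thickening_subset_cthickening δ A hy), one_mul]
    · filter_upwards [(isClosed_tsupport χ).isOpen_compl.mem_nhds hxχ] with y hy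
      rw [image_eq_zero_of_notMem_tsupport hy, mul_zero]
  have e1 : inner ℝ g (toL2 ω fun x => η x * χ x) = inner ℝ g (toL2 ω χ) := by
    rw [inner_toL2_right _ (hχ.memLp ω 2), inner_toL2_right _ ((hη.mul_smooth hχ.smooth).memLp ω 2)]
    refine integral_congr_ae ?_
    filter_upwards [hg0, ae_restrict_mem hω.measurableSet] with x h2 hx
    by_cases hxS : x ∈ S
    · rw [← (hz x hx hxS).self_of_nhds]
    · rw [h2 hxS, zero_mul, zero_mul]
  have e2 : ∀ i : Fin 2, inner ℝ (w (some i)) (toL2 ω (pd i fun x => η x * χ x)) =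
      inner ℝ (w (some i)) (toL2 ω (pd i χ)) := by
    intro i
    rw [inner_toL2_right _ ((hχ.pd i).memLp ω 2),
      inner_toL2_right _ (((hη.mul_smooth hχ.smooth).pd i).memLp ω 2)]
    refine integral_congr_ae ?_
    filter_upwards [hw i, ae_restrict_mem hω.measurableSet] with x h2 hx
    by_cases hxS : x ∈ S
    · have : χ =ᶠ[𝓝 x] fun y => η y * χ y := hz x hx hxS
      rw [pd, pd, ← this.fderiv_eq]
    · rw [h2 hxS, zero_mul, zero_mul]
  rw [e1] at h1
  simpa only [e2] using h1

/-- A singular harmonic function is orthogonal to the Laplacians of localized functions. -/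
theorem inner_singular_local (h : IsPolygonalDomain poly ω) {ps : L2 ω}
    (hps : IsSingularHarmonic poly ps) (hu : u ∈ H10 ω ω) (hf : HasLap u f) {k : Fin K} {P : Plane}
    {ρ : ℝ} (hP : IsGoodBall ω P ρ)
    (hk : ∀ j, j ≠ k → Disjoint (Metric.ball P ρ ∩ frontier ω) (openSide poly j))
    (hψ : IsTestFunction (Metric.ball P (ρ / 8)) ψ) : inner ℝ ps (lapMul ψ u f) = 0 := by
  have hb := h.isBounded
  obtain ⟨hρ, τ, hτ, hinv⟩ := hP
  obtain ⟨H, hH, -⟩ := exists_local_hess h.isOpen hb hρ hτ hinv hu hf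
    (hψ.mono (Metric.ball_subset_ball (by linarith)))
  have hw : jmul ψ u ∈ H10 ω ω := H10.mono inter_subset_left (H10.jmul hψ hu)
  have hwj := H10.isWeakJet hw
  have hg := hf.jmul hψ (H10.isWeakJet hu)
  have hlap := hH.weakLaplacian_eq h.isOpen hwj hg
  rw [← hlap]
  -- The localized function is admissible in the trace condition on side `k`: near every other side
  -- it vanishes, so Green's formula against functions supported there has no boundary term.
  refine hps.trace_zero k _ (H10.memH10 h.isOpen hw) (hH.memH2 h.isOpen hwj) fun j hj χ h1 h2 h3 => ?_
  have hχ : IsTestFunction univ χ := ⟨h1, h2, subset_univ _⟩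
  obtain ⟨z0, z1⟩ := jmul_ae_eq_zero h.isOpen hψ.univ hu
  have hg0 : ∀ᵐ x ∂volume.restrict ω, x ∉ tsupport ψ → lapMul ψ u f x = 0 := by
    rw [← hH.hasLap h.isOpen hg, Fin.sum_univ_two]
    filter_upwards [hH.ae_eq_zero h.isOpen (isClosed_tsupport ψ).isOpen_compl hwj z0 0 0,
      hH.ae_eq_zero h.isOpen (isClosed_tsupport ψ).isOpen_compl hwj z0 1 1,
      Lp.coeFn_add (H 0 0) (H 1 1)] with x h4 h5 h6 hx
    rw [h6, Pi.add_apply, h4 hx, h5 hx, add_zero]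
  have main := hg.sum_inner_of_support h.isOpen (isClosed_tsupport ψ) z1 hg0 hχ (by
    rintro x ⟨⟨hx1, hx2⟩, hx3⟩
    by_contra hx
    have hxf : x ∈ frontier ω := by rw [h.isOpen.frontier_eq]; exact ⟨hx3, hx⟩
    exact Set.disjoint_left.1 (hk j hj)
      ⟨Metric.ball_subset_ball (by linarith) (hψ.support hx1), hxf⟩ (h3 ⟨hx2, hxf⟩))
  rw [hlap]
  rw [inner_toL2_right _ (hχ.memLp ω 2)] at main
  simp only [inner_toL2_right _ ((hχ.pd _).memLp ω 2)] at main
  have int1 : Integrable (fun x => lapMul ψ u f x * χ x) (volume.restrict ω) :=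
    (Lp.memLp _).integrable_mul (hχ.memLp ω 2)
  have int2 : ∀ i : Fin 2, Integrable (fun x => jmul ψ u (some i) x * pd i χ x)
    (volume.restrict ω) := fun i => (Lp.memLp _).integrable_mul ((hχ.pd i).memLp ω 2)
  simp only [H10.weakPartial_eq h.isOpen hw]
  change ∫ x in ω, (lapMul ψ u f x * χ x + ∑ i, jmul ψ u (some i) x * pd i χ x) = 0
  rw [integral_add int1 (integrable_finsetSum _ fun i _ => int2 i),
    integral_finsetSum _ fun i _ => int2 i, main]
  ring

/-- Cut-offs that vanish near the corners: the truncated function is in `H²(ω)`, and its Laplacian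
is orthogonal to the singular harmonic functions. -/
theorem truncation (h : IsPolygonalDomain poly ω) {ps : L2 ω}
    (hps : IsSingularHarmonic poly ps) (hu : u ∈ H10 ω ω) (hf : HasLap u f)
    (hχ : IsTestFunction univ χ) (hv : ∀ i, poly i ∉ tsupport χ) :
    HessBound (jmul χ u) (lapMul χ u f) ∧ inner ℝ ps (lapMul χ u f) = 0 := by
  have hgood : ∀ P : Plane, ∃ ρ, P ∈ tsupport χ ∩ closure ω → IsGoodBall ω P ρ ∧
      ∃ k, ∀ j, j ≠ k → Disjoint (Metric.ball P ρ ∩ frontier ω) (openSide poly j) := by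
    intro P
    by_cases hP : P ∈ tsupport χ ∩ closure ω
    swap
    · exact ⟨0, fun h => absurd h hP⟩
    by_cases hPω : P ∈ ω
    · obtain ⟨ρ, h1, h2⟩ := IsPolygonalDomain.exists_goodBall_interior h.isOpen hPω
      -- An interior ball touches no side, so the index 0 is an arbitrary choice.
      refine ⟨ρ, fun _ => ⟨h1, 0, fun j _ => ?_⟩⟩
      rw [Set.disjoint_left]
      rintro x ⟨hx1, hx2⟩ -
      rw [h.isOpen.frontier_eq] at hx2
      exact hx2.2 (h2 hx1)
    · have hPf : P ∈ frontier ω := by rw [h.isOpen.frontier_eq]; exact ⟨hP.2, hPω⟩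
      rcases h.frontier_cases hPf with ⟨i, rfl⟩ | ⟨k, hk⟩
      · exact absurd hP.1 (hv i)
      · obtain ⟨ρ, h1, h2⟩ := h.exists_goodBall_side hk
        refine ⟨ρ, fun _ => ⟨h1, k, fun j hj => ?_⟩⟩
        refine (h2 j hj).mono inter_subset_left ?_
        rw [edgeSet_eq_segment]
        exact openSegment_subset_segment ℝ _ _
  choose ρ hρ using hgood
  have hKc : IsCompact (tsupport χ ∩ closure ω) := hχ.compact.isCompact.inter_right isClosed_closure
  obtain ⟨s, θ, hs, hθ, hsum⟩ := exists_partition hKc (fun P => ρ P / 8)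
    fun P hP => by have := (hρ P hP).1.1; positivity
  have hθ' : ∀ P ∈ s, IsTestFunction (Metric.ball P (ρ P / 8)) (fun x => θ P x * χ x) :=
    fun P hP => (hθ P hP).mul_smooth hχ.smooth
  have hθu : ∀ P ∈ s, IsTestFunction univ (fun x => θ P x * χ x) := fun P hP => (hθ' P hP).univ
  have e : ∀ x ∈ ω, χ x = ∑ P ∈ s, θ P x * χ x := by
    intro x hx
    rw [← Finset.sum_mul]
    by_cases hxχ : x ∈ tsupport χ
    · rw [hsum x ⟨hxχ, subset_closure hx⟩, one_mul]
    · rw [image_eq_zero_of_notMem_tsupport hxχ, mul_zero]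
  obtain ⟨H, hH, hle⟩ := exists_hess_of_sum h.isOpen h.isBounded hu hf s ρ
    (fun P hP => (hρ P (hs P hP)).1) hθ'
  have hj := jmul_congr h.isOpen e u
  rw [← hj] at hH
  have hlap := hf.jmul hχ (H10.isWeakJet hu)
  refine ⟨⟨H, hH, ?_⟩, ?_⟩
  · rw [hle, hH.hasLap h.isOpen hlap]
  -- Orthogonality holds piece by piece, because each piece touches at most one side; the Laplacians
  -- of the pieces add up.
  · have hlap2 : HasLap (jmul χ u) (∑ P ∈ s, lapMul (fun x => θ P x * χ x) u f) := by
      rw [hj, jmul_sum_fun s hθu]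
      exact HasLap.sum s fun P hP => hf.jmul (hθu P hP) (H10.isWeakJet hu)
    rw [hlap.unique h.isOpen hlap2, inner_sum]
    refine Finset.sum_eq_zero fun P hP => ?_
    obtain ⟨h1, k, h2⟩ := hρ P (hs P hP)
    exact inner_singular_local h hps hu hf h1 h2 (hθ' P hP)

end truncation

/-! ### Removing the truncation at the corners -/

section corner

variable {K : ℕ} [NeZero K] {poly : Polygon Plane K} {ω U : Set Plane} {u : Jet ω} {f : L2 ω}
  {χ : Plane → ℝ} {P : Plane}

/-- The Dirichlet energy in a ball. -/
def ballEnergy (u : Jet ω) (P : Plane) (ρ : ℝ) : ℝ :=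
  ∑ i : Fin 2, ∫ x in ω ∩ Metric.ball P ρ, u (some i) x ^ 2

/-- The decay at a corner that characterizes the regular solutions. -/
structure CornerDecay (u : Jet ω) (f : L2 ω) (P : Plane) : Prop where
  energy : Tendsto (fun ρ => ballEnergy u P ρ / ρ ^ 2) (𝓝[>] 0) (𝓝 0)
  poincare : ∃ C, ∀ᶠ ρ in 𝓝[>] (0 : ℝ),
    ∫ x in ω ∩ Metric.ball P ρ, u none x ^ 2 ≤ C * ρ ^ 2 * ballEnergy u P ρ
  vanish : ∀ᶠ ρ in 𝓝[>] (0 : ℝ), ∀ᵐ x ∂volume.restrict ω, x ∈ Metric.ball P ρ → f x = 0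

theorem integrable_sq_L2 (v : L2 ω) : Integrable (fun x => v x ^ 2) (volume.restrict ω) := by
  simpa [sq] using integrable_mul_L2 v v

theorem integral_ball_le_energy (u : Jet ω) (P : Plane) (ρ : ℝ) (i : Fin 2) :
    ∫ x in ω ∩ Metric.ball P ρ, u (some i) x ^ 2 ≤ ballEnergy u P ρ :=
  Finset.single_le_sum (f := fun i : Fin 2 => ∫ x in ω ∩ Metric.ball P ρ, u (some i) x ^ 2)
    (fun _ _ => integral_nonneg fun _ => sq_nonneg _) (Finset.mem_univ i)

theorem norm_sq_eq_integral (v : L2 ω) : ‖v‖ ^ 2 = ∫ x in ω, v x ^ 2 := by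
  rw [← real_inner_self_eq_norm_sq, inner_L2_eq]
  simp only [sq]

theorem norm_mulL_sq_le (hχ : IsTestFunction U χ) {C ρ : ℝ} (hC : ∀ x, |χ x| ≤ C)
    (h0 : ∀ x, x ∉ Metric.ball P ρ → χ x = 0) (v : L2 ω) :
    ‖mulL χ v‖ ^ 2 ≤ C ^ 2 * ∫ x in ω ∩ Metric.ball P ρ, v x ^ 2 := by
  have hm : MeasurableSet (Metric.ball P ρ) := Metric.isOpen_ball.measurableSet
  rw [norm_sq_eq_integral, ← integral_const_mul]
  rw [show ∫ x in ω ∩ Metric.ball P ρ, C ^ 2 * v x ^ 2 =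
    ∫ x in ω, (Metric.ball P ρ).indicator (fun x => C ^ 2 * v x ^ 2) x by
      rw [setIntegral_indicator hm]]
  refine integral_mono_ae (integrable_sq_L2 _) (((integrable_sq_L2 v).const_mul _).indicator hm) ?_
  filter_upwards [hχ.coeFn_mulL v] with x hx
  rw [hx]
  by_cases h : x ∈ Metric.ball P ρ
  · rw [indicator_of_mem h, mul_pow]
    refine mul_le_mul_of_nonneg_right ?_ (sq_nonneg _)
    rw [← sq_abs]
    exact pow_le_pow_left₀ (abs_nonneg _) (hC x) 2
  · rw [indicator_of_notMem h, h0 x h]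
    simp

/-- A smooth bump function of size `ε` at `P`. -/
def cornerBump (P : Plane) (ε : ℝ) (x : Plane) : ℝ :=
  (⟨1, 2, one_pos, one_lt_two⟩ : ContDiffBump (0 : Plane)) (ε⁻¹ • (x - P))

theorem cornerBump_smooth (P : Plane) (ε : ℝ) : ContDiff ℝ (⊤ : ℕ∞) (cornerBump P ε) :=
  by
  have h : ContDiff ℝ (⊤ : ℕ∞) fun x : Plane => ε⁻¹ • (x - P) :=
    (contDiff_id.sub contDiff_const).const_smul ε⁻¹
  exact (ContDiffBump.contDiff _).comp h

theorem cornerBump_one {ε : ℝ} (hε : 0 < ε) {x : Plane} (hx : dist x P ≤ ε) :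
    cornerBump P ε x = 1 := by
  refine ContDiffBump.one_of_mem_closedBall _ ?_
  rw [mem_closedBall_zero_iff, norm_smul, norm_inv, Real.norm_of_nonneg hε.le, ← dist_eq_norm]
  change ε⁻¹ * dist x P ≤ 1
  rw [inv_mul_le_iff₀ hε]
  linarith

theorem tsupport_cornerBump {ε : ℝ} (hε : 0 < ε) :
    tsupport (cornerBump P ε) ⊆ Metric.closedBall P (2 * ε) := by
  refine closure_minimal (fun x hx => ?_) Metric.isClosed_closedBall
  have h1 := (ContDiffBump.support_eq (⟨1, 2, one_pos, one_lt_two⟩ : ContDiffBump (0 : Plane))).subset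
    (show ε⁻¹ • (x - P) ∈ Function.support _ from hx)
  rw [mem_ball_zero_iff, norm_smul, norm_inv, Real.norm_of_nonneg hε.le, ← dist_eq_norm] at h1
  change ε⁻¹ * dist x P < 2 at h1
  rw [inv_mul_lt_iff₀ hε] at h1
  rw [Metric.mem_closedBall]
  linarith

theorem cornerBump_test {ε : ℝ} (hε : 0 < ε) :
    IsTestFunction (Metric.ball P (3 * ε)) (cornerBump P ε) :=
  ⟨cornerBump_smooth P ε,
    (isCompact_closedBall P (2 * ε)).of_isClosed_subset (isClosed_tsupport _)
      (tsupport_cornerBump hε),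
    (tsupport_cornerBump hε).trans (Metric.closedBall_subset_ball (by linarith))⟩

theorem pd_comp_scale {φ : Plane → ℝ} (hφ : Differentiable ℝ φ) (P : Plane) (a : ℝ) (i : Fin 2) :
    pd i (fun x => φ (a • (x - P))) = fun x => a * pd i φ (a • (x - P)) := by
  ext x
  have h1 : HasFDerivAt (fun x : Plane => a • (x - P)) (a • ContinuousLinearMap.id ℝ Plane) x :=
    ((hasFDerivAt_id x).sub_const P).const_smul a
  have h2 : HasFDerivAt (fun x => φ (a • (x - P))) _ x := (hφ (a • (x - P))).hasFDerivAt.comp x h1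
  rw [pd, h2.fderiv]
  simp [pd]

/-- The derivatives of the bump functions scale. -/
theorem exists_cornerBump_bound : ∃ C, ∀ (P : Plane) (ε : ℝ), 0 < ε →
    (∀ x, |cornerBump P ε x| ≤ C) ∧ (∀ i x, |pd i (cornerBump P ε) x| ≤ C * ε⁻¹) ∧
      ∀ i x, |pd i (pd i (cornerBump P ε)) x| ≤ C * (ε⁻¹) ^ 2 := by
  let b : ContDiffBump (0 : Plane) := ⟨1, 2, one_pos, one_lt_two⟩
  have hb : IsTestFunction univ b := ⟨b.contDiff, b.hasCompactSupport, subset_univ _⟩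
  obtain ⟨C0, p0, h0⟩ := hb.exists_bound
  choose C1 p1 h1 using fun i => (hb.pd i).exists_bound
  choose C2 p2 h2 using fun i => ((hb.pd i).pd i).exists_bound
  have q1 : ∀ i, C1 i ≤ ∑ i, C1 i := fun i =>
    Finset.single_le_sum (fun i _ => p1 i) (Finset.mem_univ i)
  have q2 : ∀ i, C2 i ≤ ∑ i, C2 i := fun i =>
    Finset.single_le_sum (fun i _ => p2 i) (Finset.mem_univ i)
  have q1' : 0 ≤ ∑ i, C1 i := Finset.sum_nonneg fun i _ => p1 i
  have q2' : 0 ≤ ∑ i, C2 i := Finset.sum_nonneg fun i _ => p2 i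
  refine ⟨C0 + ∑ i, C1 i + ∑ i, C2 i, fun P ε hε => ?_⟩
  have hε' : 0 < ε⁻¹ := inv_pos.2 hε
  have e1 : ∀ i, pd i (cornerBump P ε) = fun x => ε⁻¹ * pd i b (ε⁻¹ • (x - P)) := fun i =>
    pd_comp_scale hb.differentiable P ε⁻¹ i
  have e2 : ∀ i, pd i (pd i (cornerBump P ε)) =
      fun x => ε⁻¹ * (ε⁻¹ * pd i (pd i b) (ε⁻¹ • (x - P))) := fun i => by
    rw [e1, pd_const_mul (φ := fun x => pd i b (ε⁻¹ • (x - P))),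
      pd_comp_scale (hb.pd i).differentiable]
    have hd : Differentiable ℝ fun x : Plane => ε⁻¹ • (x - P) :=
      (differentiable_id.sub_const P).const_smul ε⁻¹
    exact (hb.pd i).differentiable.comp hd
  refine ⟨fun x => ?_, fun i x => ?_, fun i x => ?_⟩
  · have := h0 (ε⁻¹ • (x - P))
    exact this.trans (by linarith)
  · rw [e1]
    simp only
    rw [abs_mul, abs_of_pos hε', mul_comm]
    exact mul_le_mul_of_nonneg_right ((h1 i _).trans (by linarith [q1 i])) hε'.le
  · rw [e2]
    simp only
    rw [abs_mul, abs_mul, abs_of_pos hε', ← mul_assoc, ← sq, mul_comm]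
    exact mul_le_mul_of_nonneg_right ((h2 i _).trans (by linarith [q2 i])) (sq_nonneg _)

theorem tendsto_zero_of_sq_le {E : Type*} [NormedAddCommGroup E] {l : Filter ℝ} {a : ℝ → E}
    {b : ℝ → ℝ} {C : ℝ} (h : ∀ᶠ ε in l, ‖a ε‖ ^ 2 ≤ C * b ε) (hb : Tendsto b l (𝓝 0)) :
    Tendsto a l (𝓝 0) := by
  have h1 : Tendsto (fun ε => ‖a ε‖ ^ 2) l (𝓝 0) := by
    refine tendsto_of_tendsto_of_tendsto_of_le_of_le' tendsto_const_nhds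
      (by simpa using hb.const_mul C) (Eventually.of_forall fun _ => sq_nonneg _) h
  have h2 := h1.sqrt
  simp only [Real.sqrt_zero, Real.sqrt_sq (norm_nonneg _)] at h2
  exact tendsto_zero_iff_norm_tendsto_zero.2 h2

/-- Under the decay condition the part of `u` near the corner is negligible. -/
theorem CornerDecay.tendsto (h : CornerDecay u f P) :
    Tendsto (fun ε => jmul (cornerBump P ε) u) (𝓝[>] 0) (𝓝 0) ∧
      Tendsto (fun ε => lapMul (cornerBump P ε) u f) (𝓝[>] 0) (𝓝 0) := by
  obtain ⟨C, hC⟩ := exists_cornerBump_bound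
  obtain ⟨A, hA⟩ := h.poincare
  have hscale : Tendsto (fun ε : ℝ => 3 * ε) (𝓝[>] 0) (𝓝[>] 0) := by
    rw [tendsto_nhdsWithin_iff]
    constructor
    · have : Tendsto (fun ε : ℝ => 3 * ε) (𝓝 0) (𝓝 (3 * 0)) := (continuous_const_mul 3).tendsto 0
      rw [mul_zero] at this
      exact this.mono_left nhdsWithin_le_nhds
    · filter_upwards [self_mem_nhdsWithin] with ε hε
      simpa using hε
  have hb := h.energy.comp hscale
  have hA' := hscale.eventually hA
  have hf' := hscale.eventually h.vanish
  have hpos : ∀ᶠ ε in 𝓝[>] (0 : ℝ), 0 < ε ∧ ε ≤ 1 := by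
    filter_upwards [Ioc_mem_nhdsGT one_pos] with ε hε using hε
  have E0 : ∀ ρ, 0 ≤ ballEnergy u P ρ := fun ρ =>
    Finset.sum_nonneg fun i _ => integral_nonneg fun _ => sq_nonneg _
  have off : ∀ {φ : Plane → ℝ} {ε : ℝ}, IsTestFunction (Metric.ball P (3 * ε)) φ →
      ∀ x, x ∉ Metric.ball P (3 * ε) → φ x = 0 := fun hφ x hx => hφ.eq_zero_of_notMem hx
  have eE : ∀ ε : ℝ, 0 < ε → ballEnergy u P (3 * ε) =
      9 * ε ^ 2 * (ballEnergy u P (3 * ε) / (3 * ε) ^ 2) := by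
    intro ε hε
    field_simp
    ring
  have t0 : Tendsto (fun ε => mulL (cornerBump P ε) (u none)) (𝓝[>] 0) (𝓝 0) := by
    refine tendsto_zero_of_sq_le (C := C ^ 2 * (|A| * 81)) ?_ hb
    filter_upwards [hpos, hA'] with ε ⟨h1, h2⟩ h3
    have hc := cornerBump_test (P := P) h1
    refine (norm_mulL_sq_le hc (hC P ε h1).1 (off hc) _).trans ?_
    rw [mul_assoc]
    refine mul_le_mul_of_nonneg_left (h3.trans ?_) (sq_nonneg _)
    have q : 0 ≤ ballEnergy u P (3 * ε) / (3 * ε) ^ 2 := div_nonneg (E0 _) (sq_nonneg _)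
    rw [Function.comp_apply]
    nth_rw 1 [eE ε h1]
    rw [show A * (3 * ε) ^ 2 * (9 * ε ^ 2 * (ballEnergy u P (3 * ε) / (3 * ε) ^ 2)) =
      A * (81 * ε ^ 4) * (ballEnergy u P (3 * ε) / (3 * ε) ^ 2) by ring]
    refine mul_le_mul_of_nonneg_right ?_ q
    have : ε ^ 4 ≤ 1 := pow_le_one₀ h1.le h2
    have h5 : (0 : ℝ) ≤ 81 * ε ^ 4 := by positivity
    calc A * (81 * ε ^ 4) ≤ |A| * (81 * ε ^ 4) := mul_le_mul_of_nonneg_right (le_abs_self A) h5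
      _ ≤ |A| * 81 := mul_le_mul_of_nonneg_left (by linarith) (abs_nonneg A)
  have t1 : ∀ i : Fin 2, Tendsto (fun ε => mulL (cornerBump P ε) (u (some i))) (𝓝[>] 0) (𝓝 0) := by
    intro i
    refine tendsto_zero_of_sq_le (C := C ^ 2 * 9) ?_ hb
    filter_upwards [hpos] with ε ⟨h1, h2⟩
    have hc := cornerBump_test (P := P) h1
    refine (norm_mulL_sq_le hc (hC P ε h1).1 (off hc) _).trans ?_
    rw [mul_assoc]
    refine mul_le_mul_of_nonneg_left ((integral_ball_le_energy _ _ _ _).trans ?_) (sq_nonneg _)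
    have q : 0 ≤ ballEnergy u P (3 * ε) / (3 * ε) ^ 2 := div_nonneg (E0 _) (sq_nonneg _)
    rw [Function.comp_apply]
    nth_rw 1 [eE ε h1]
    refine mul_le_mul_of_nonneg_right ?_ q
    have : ε ^ 2 ≤ 1 := pow_le_one₀ h1.le h2
    linarith
  -- Here the scaling is critical: |∇χ|² is of order ε⁻², so o(ε²) for the energy is exactly what is
  -- needed.
  have t2 : ∀ i : Fin 2, Tendsto (fun ε => mulL (pd i (cornerBump P ε)) (u (some i))) (𝓝[>] 0)
      (𝓝 0) := by
    intro i
    refine tendsto_zero_of_sq_le (C := C ^ 2 * 9) ?_ hb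
    filter_upwards [hpos] with ε ⟨h1, h2⟩
    have hc := (cornerBump_test (P := P) h1).pd i
    refine (norm_mulL_sq_le hc ((hC P ε h1).2.1 i) (off hc) _).trans ?_
    have h3 := integral_ball_le_energy u P (3 * ε) i
    rw [eE ε h1] at h3
    refine (mul_le_mul_of_nonneg_left h3 (sq_nonneg _)).trans (le_of_eq ?_)
    rw [Function.comp_apply]
    field_simp
  have t3 : ∀ i : Fin 2, Tendsto (fun ε => mulL (pd i (cornerBump P ε)) (u none)) (𝓝[>] 0)
      (𝓝 0) := by
    intro i
    refine tendsto_zero_of_sq_le (C := C ^ 2 * (|A| * 81)) ?_ hb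
    filter_upwards [hpos, hA'] with ε ⟨h1, h2⟩ h3
    have hc := (cornerBump_test (P := P) h1).pd i
    refine (norm_mulL_sq_le hc ((hC P ε h1).2.1 i) (off hc) _).trans ?_
    rw [eE ε h1] at h3
    refine (mul_le_mul_of_nonneg_left h3 (sq_nonneg _)).trans ?_
    have q : 0 ≤ ballEnergy u P (3 * ε) / (3 * ε) ^ 2 := div_nonneg (E0 _) (sq_nonneg _)
    rw [Function.comp_apply]
    set Q := ballEnergy u P (3 * ε) / (3 * ε) ^ 2 with hQ
    have e : (C * ε⁻¹) ^ 2 * (A * (3 * ε) ^ 2 * (9 * ε ^ 2 * Q)) = C ^ 2 * (A * 81 * ε ^ 2) * Q := by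
      field_simp
      ring
    rw [e]
    refine mul_le_mul_of_nonneg_right (mul_le_mul_of_nonneg_left ?_ (sq_nonneg _)) q
    have : ε ^ 2 ≤ 1 := pow_le_one₀ h1.le h2
    have h5 : (0 : ℝ) ≤ 81 * ε ^ 2 := by positivity
    calc A * 81 * ε ^ 2 = A * (81 * ε ^ 2) := by ring
      _ ≤ |A| * (81 * ε ^ 2) := mul_le_mul_of_nonneg_right (le_abs_self A) h5
      _ ≤ |A| * 81 := mul_le_mul_of_nonneg_left (by linarith) (abs_nonneg A)
  -- Critical again: second derivatives of the bump contribute ε⁻⁴ after squaring, while the local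
  -- Poincaré inequality gives ∫u² ≤ Cε² o(ε²).
  have t4 : ∀ i : Fin 2, Tendsto (fun ε => mulL (pd i (pd i (cornerBump P ε))) (u none)) (𝓝[>] 0)
      (𝓝 0) := by
    intro i
    refine tendsto_zero_of_sq_le (C := C ^ 2 * (A * 81)) ?_ hb
    filter_upwards [hpos, hA'] with ε ⟨h1, h2⟩ h3
    have hc := ((cornerBump_test (P := P) h1).pd i).pd i
    refine (norm_mulL_sq_le hc ((hC P ε h1).2.2 i) (off hc) _).trans ?_
    rw [eE ε h1] at h3
    refine (mul_le_mul_of_nonneg_left h3 (sq_nonneg _)).trans (le_of_eq ?_)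
    rw [Function.comp_apply]
    set Q := ballEnergy u P (3 * ε) / (3 * ε) ^ 2 with hQ
    field_simp
    ring
  have t5 : Tendsto (fun ε => mulL (cornerBump P ε) f) (𝓝[>] 0) (𝓝 0) := by
    refine tendsto_const_nhds.congr' ?_
    filter_upwards [hpos, hf'] with ε h1 h3
    rw [mulL, ← toL2_zero]
    refine toL2_congr ?_
    filter_upwards [h3] with x hx
    by_cases hm : x ∈ Metric.ball P (3 * ε)
    · rw [hx hm, mul_zero]
    · rw [off (cornerBump_test h1.1) x hm, zero_mul]
  constructor
  · rw [Jet.tendsto_iff]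
    refine ⟨t0, fun i => ?_⟩
    have := (t1 i).add (t3 i)
    rw [add_zero] at this
    exact this
  · have := (t5.add ((tendsto_finsetSum Finset.univ fun i _ => t2 i).const_smul (2 : ℝ))).add
      (tendsto_finsetSum Finset.univ fun i _ => t4 i)
    simp only [Finset.sum_const_zero, smul_zero, add_zero] at this
    exact this

/-- Solutions that decay at the corners are in `H²(ω)`. -/
theorem regular_of_decay (h : IsPolygonalDomain poly ω) {ps : L2 ω}
    (hps : IsSingularHarmonic poly ps) (hu : u ∈ H10 ω ω) (hf : HasLap u f)
    (hd : ∀ i, CornerDecay u f (poly i)) : HessBound u f ∧ inner ℝ ps f = 0 := by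
  classical
  let V : Finset Plane := Finset.univ.image poly
  have hV : ∀ P ∈ V, CornerDecay u f P := fun P hP => by
    obtain ⟨i, -, rfl⟩ := Finset.mem_image.1 hP
    exact hd i
  obtain ⟨R, hR⟩ := ((h.isBounded.union (V.finite_toSet.isBounded))).subset_closedBall (0 : Plane)
  -- A cut-off that is 1 near ω and near all vertices; it makes 1 minus the corner bumps compactly
  -- supported without changing `u`.
  let b : ContDiffBump (0 : Plane) :=
    ⟨max R 0 + 1, max R 0 + 2, by positivity, by linarith⟩
  have hb1 : ∀ x ∈ ω ∪ V, ∀ᶠ y in 𝓝 x, b y = 1 := by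
    intro x hx
    have hm : x ∈ Metric.ball (0 : Plane) (max R 0 + 1) :=
      Metric.closedBall_subset_ball (by linarith [le_max_left R 0]) (hR hx)
    filter_upwards [Metric.isOpen_ball.mem_nhds hm] with y hy
    exact b.one_of_mem_closedBall (Metric.ball_subset_closedBall hy)
  have hb : IsTestFunction univ b := ⟨b.contDiff, b.hasCompactSupport, subset_univ _⟩
  have hbu : jmul b u = u := by
    have hone : ∀ v : L2 ω, mulL b v = v := fun v => by
      rw [mulL]
      nth_rw 2 [← toL2_coeFn v]
      refine toL2_congr ?_
      filter_upwards [ae_restrict_mem h.isOpen.measurableSet] with x hx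
      rw [(hb1 x (Or.inl hx)).self_of_nhds, one_mul]
    refine Jet.ext (hone _) fun i => ?_
    have hz : mulL (pd i b) (u none) = 0 := by
      rw [← mulL_zero_fun (u none)]
      refine mulL_congr (fun x hx => ?_) h.isOpen _
      have : (b : Plane → ℝ) =ᶠ[𝓝 x] fun _ => 1 := hb1 x (Or.inl hx)
      rw [pd, this.fderiv_eq]
      simp
    rw [jmul, mkJet_some, hone, hz, add_zero]
  obtain ⟨δ, hδ, hsep⟩ : ∃ δ > 0, ∀ P ∈ V, ∀ Q ∈ V, P ≠ Q → δ ≤ dist P Q := by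
    have : ∀ᶠ δ in 𝓝[>] (0 : ℝ), ∀ P ∈ V, ∀ Q ∈ V, P ≠ Q → δ ≤ dist P Q := by
      refine (Finset.eventually_all V).2 fun P _ => (Finset.eventually_all V).2 fun Q _ => ?_
      by_cases hPQ : P = Q
      · exact Eventually.of_forall fun _ hh => absurd hPQ hh
      · filter_upwards [Ioo_mem_nhdsGT (dist_pos.2 hPQ)] with δ hδ _ using hδ.2.le
    obtain ⟨δ, h1, h2⟩ := (this.and self_mem_nhdsWithin).exists
    exact ⟨δ, h2, h1⟩
  -- A bump of scale e lives in a ball of radius 3e. With 4e ≤ δ, no other bump reaches the ball of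
  -- radius e about a vertex, where the sum of all bumps is therefore 1.
  let e : ℕ → ℝ := fun n => (δ / 4) / (n + 1)
  have epos : ∀ n, 0 < e n := fun n => by positivity
  have ele : ∀ n, e n ≤ δ / 4 := fun n =>
    div_le_self (by positivity) (by linarith [(Nat.cast_nonneg n : (0 : ℝ) ≤ n)])
  have elim : Tendsto e atTop (𝓝[>] 0) := by
    rw [tendsto_nhdsWithin_iff]
    refine ⟨?_, Eventually.of_forall fun n => epos n⟩
    have := (tendsto_one_div_add_atTop_nhds_zero_nat (𝕜 := ℝ)).const_mul (δ / 4)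
    simpa [e, div_eq_mul_inv] using this
  let χ : ℕ → Plane → ℝ := fun n x => b x - ∑ P ∈ V, cornerBump P (e n) x
  have hB : ∀ n, ∀ P ∈ V, IsTestFunction univ (cornerBump P (e n)) := fun n P _ =>
    (cornerBump_test (epos n)).univ
  have hχ : ∀ n, IsTestFunction univ (χ n) := fun n => hb.sub (IsTestFunction.sum V (hB n))
  have hχ0 : ∀ n, ∀ Q ∈ V, ∀ᶠ y in 𝓝 Q, χ n y = 0 := by
    intro n Q hQ
    filter_upwards [hb1 Q (Or.inr hQ), Metric.ball_mem_nhds Q (epos n)] with y h1 h2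
    have h3 : ∑ P ∈ V, cornerBump P (e n) y = 1 := by
      rw [Finset.sum_eq_single_of_mem Q hQ, cornerBump_one (epos n) (Metric.mem_ball.1 h2).le]
      intro P hP hPQ
      refine (cornerBump_test (epos n)).eq_zero_of_notMem fun hm => ?_
      have h4 := hsep P hP Q hQ hPQ
      have h5 := dist_triangle_left P Q y
      rw [Metric.mem_ball] at hm h2
      have := ele n
      linarith
    change b y - _ = 0
    rw [h1, h3, sub_self]
  have hsupp : ∀ n m i, poly i ∉ tsupport (χ n) ∧ poly i ∉ tsupport (fun x => χ n x - χ m x) := by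
    intro n m i
    have hi : poly i ∈ V := Finset.mem_image_of_mem _ (Finset.mem_univ i)
    rw [notMem_tsupport_iff_eventuallyEq, notMem_tsupport_iff_eventuallyEq]
    refine ⟨hχ0 n _ hi, ?_⟩
    filter_upwards [hχ0 n _ hi, hχ0 m _ hi] with y h1 h2
    rw [h1, h2]
    simp
  have hwu := H10.isWeakJet hu
  have neg1 : ∀ n, IsTestFunction univ (fun x => (-1 : ℝ) * ∑ P ∈ V, cornerBump P (e n) x) :=
    fun n => (IsTestFunction.sum V (hB n)).const_mul _
  have hcm : ∀ {ψ : Plane → ℝ} (_ : IsTestFunction univ ψ),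
      jmul (fun x => (-1 : ℝ) * ψ x) u = - jmul ψ u := fun {ψ} hψ => by
    have h0 := jmul_add_fun hψ (hψ.const_mul (-1)) u
    have h1 : (fun x => ψ x + (-1 : ℝ) * ψ x) = fun _ => 0 := by ext; ring
    rw [h1, jmul_zero_fun] at h0
    exact (neg_eq_of_add_eq_zero_right h0.symm).symm
  have jsub : ∀ {φ ψ : Plane → ℝ} (_ : IsTestFunction univ φ) (_ : IsTestFunction univ ψ),
      jmul (fun x => φ x - ψ x) u = jmul φ u - jmul ψ u := fun {φ ψ} hφ hψ => by
    have h0 := jmul_add_fun hφ (hψ.const_mul (-1)) u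
    rw [hcm hψ] at h0
    simpa [sub_eq_add_neg] using h0
  have jχ : ∀ n, jmul (χ n) u = u - ∑ P ∈ V, jmul (cornerBump P (e n)) u := fun n => by
    rw [jsub hb (IsTestFunction.sum V (hB n)), hbu, jmul_sum_fun V (hB n)]
  have lχ : ∀ n, lapMul (χ n) u f = f - ∑ P ∈ V, lapMul (cornerBump P (e n)) u f := fun n => by
    refine (hf.jmul (hχ n) hwu).unique h.isOpen ?_
    rw [jχ n]
    exact hf.sub (HasLap.sum V fun P hP => hf.jmul (hB n P hP) hwu)
  have limu : Tendsto (fun n => jmul (χ n) u) atTop (𝓝 u) := by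
    simp only [jχ]
    have := tendsto_const_nhds (x := u) |>.sub
      (tendsto_finsetSum V fun P hP => (hV P hP).tendsto.1.comp elim)
    simpa using this
  have limf : Tendsto (fun n => lapMul (χ n) u f) atTop (𝓝 f) := by
    simp only [lχ]
    have := tendsto_const_nhds (x := f) |>.sub
      (tendsto_finsetSum V fun P hP => (hV P hP).tendsto.2.comp elim)
    simpa using this
  have T := fun n => truncation h hps hu hf (hχ n) fun i => (hsupp n n i).1
  refine ⟨HessBound.of_tendsto h.isOpen (fun n => (T n).1) (fun n m => ?_) limu limf, ?_⟩
  -- The difference of two cut-offs also vanishes near the vertices, so the same bound applies to it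
  -- and provides the Cauchy property.
  · have T2 := (truncation h hps hu hf ((hχ n).sub (hχ m)) fun i => (hsupp n m i).2).1
    rw [jsub (hχ n) (hχ m)] at T2
    have hl : lapMul (fun x => χ n x - χ m x) u f = lapMul (χ n) u f - lapMul (χ m) u f := by
      refine (hf.jmul ((hχ n).sub (hχ m)) hwu).unique h.isOpen ?_
      rw [jsub (hχ n) (hχ m)]
      exact (hf.jmul (hχ n) hwu).sub (hf.jmul (hχ m) hwu)
    rwa [hl] at T2
  · have : Tendsto (fun n => inner ℝ ps (lapMul (χ n) u f)) atTop (𝓝 (inner ℝ ps f)) :=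
      tendsto_const_nhds.inner limf
    refine tendsto_nhds_unique this (tendsto_const_nhds.congr fun n => ((T n).2).symm)

end corner

/-! ### One-dimensional lemmas -/

section oneDim

/-- A locally integrable function with vanishing weak derivative is constant. -/
theorem exists_ae_eq_const {a b : ℝ} (hab : a < b) {F : ℝ → ℝ}
    (hF : LocallyIntegrableOn F (Ioo a b))
    (h : ∀ ξ : ℝ → ℝ, ContDiff ℝ (⊤ : ℕ∞) ξ → HasCompactSupport ξ → tsupport ξ ⊆ Ioo a b →
      ∫ r, F r * deriv ξ r = 0) : ∃ C, ∀ᵐ r, r ∈ Ioo a b → F r = C := by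
  have hc : (a + b) / 2 ∈ Ioo a b := ⟨by linarith, by linarith⟩
  let η : ContDiffBump ((a + b) / 2) := ⟨(b - a) / 8, (b - a) / 4, by linarith, by linarith⟩
  have hηs : tsupport (η.normed volume) ⊆ Ioo a b := by
    rw [η.tsupport_normed_eq, Real.closedBall_eq_Icc]
    intro x hx
    change x ∈ Icc ((a + b) / 2 - (b - a) / 4) ((a + b) / 2 + (b - a) / 4) at hx
    exact ⟨by linarith [hx.1], by linarith [hx.2]⟩
  set η0 : ℝ → ℝ := η.normed volume with hη0
  have hη : ContDiff ℝ (⊤ : ℕ∞) η0 := η.contDiff_normed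
  have hηc : HasCompactSupport η0 := η.hasCompactSupport_normed
  have hηi : ∫ r, η0 r = 1 := η.integral_normed
  have int : ∀ ξ : ℝ → ℝ, Continuous ξ → HasCompactSupport ξ → tsupport ξ ⊆ Ioo a b →
      Integrable fun r => F r * ξ r := by
    intro ξ h1 h2 h3
    have hI : IntegrableOn F (tsupport ξ) := hF.integrableOn_compact_subset h3 h2
    obtain ⟨C, hC⟩ := h2.exists_bound_of_continuous h1
    have h4 : IntegrableOn (fun r => F r * ξ r) (tsupport ξ) :=
      Integrable.mul_bdd (c := C) hI h1.aestronglyMeasurable (Eventually.of_forall hC)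
    refine (integrableOn_iff_integrable_of_support_subset ?_).1 h4
    intro x hx
    exact subset_tsupport ξ fun h0 => hx (by simp [h0])
  let C := ∫ r, F r * η0 r
  refine ⟨C, ?_⟩
  have key : ∀ᵐ r, r ∈ Ioo a b → F r - C = 0 := by
    refine isOpen_Ioo.ae_eq_zero_of_integral_contDiff_smul_eq_zero
      (hF.sub (locallyIntegrable_const C |>.locallyIntegrableOn _)) fun ξ h1 h2 h3 => ?_
    -- Subtracting m times a fixed bump of integral 1 leaves a function ζ of mean zero, whose
    -- primitive has compact support and is an admissible test function.
    set m := ∫ r, ξ r with hm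
    let ζ : ℝ → ℝ := fun r => ξ r - m * η0 r
    have hζ : ContDiff ℝ (⊤ : ℕ∞) ζ := h1.sub (contDiff_const.mul hη)
    have ξi : Integrable ξ := h1.continuous.integrable_of_hasCompactSupport h2
    have ηi : Integrable η0 := hη.continuous.integrable_of_hasCompactSupport hηc
    have hζi : Integrable ζ := ξi.sub (ηi.const_mul m)
    have hζ0 : ∫ r, ζ r = 0 := by
      rw [integral_sub ξi (ηi.const_mul m), integral_const_mul, hηi, ← hm]
      ring
    -- the support of `ζ`
    obtain ⟨a', b', ha', hb', hab', hξ, hη'⟩ : ∃ a' b', a < a' ∧ b' < b ∧ a' < b' ∧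
        tsupport ξ ⊆ Icc a' b' ∧ tsupport η0 ⊆ Icc a' b' := by
      have hK : IsCompact (tsupport ξ ∪ tsupport η0) := h2.isCompact.union hηc.isCompact
      have hne : (tsupport ξ ∪ tsupport η0).Nonempty := by
        refine Nonempty.inr ?_
        by_contra he
        rw [not_nonempty_iff_eq_empty, tsupport_eq_empty_iff] at he
        rw [he] at hηi
        simp at hηi
      have hsub : tsupport ξ ∪ tsupport η0 ⊆ Ioo a b := union_subset h3 hηs
      have m1 := hsub (hK.sInf_mem hne)
      have m2 := hsub (hK.sSup_mem hne)
      have hle : sInf (tsupport ξ ∪ tsupport η0) ≤ sSup (tsupport ξ ∪ tsupport η0) :=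
        csInf_le hK.bddBelow (hK.sSup_mem hne)
      refine ⟨(a + sInf (tsupport ξ ∪ tsupport η0)) / 2, (b + sSup (tsupport ξ ∪ tsupport η0)) / 2,
        by linarith [m1.1], by linarith [m2.2], by linarith [m1.1, m2.2], ?_, ?_⟩
      · intro x hx
        have i1 := csInf_le hK.bddBelow (Or.inl hx : x ∈ tsupport ξ ∪ tsupport η0)
        have i2 := le_csSup hK.bddAbove (Or.inl hx : x ∈ tsupport ξ ∪ tsupport η0)
        exact ⟨by linarith [m1.1], by linarith [m2.2]⟩
      · intro x hx
        have i1 := csInf_le hK.bddBelow (Or.inr hx : x ∈ tsupport ξ ∪ tsupport η0)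
        have i2 := le_csSup hK.bddAbove (Or.inr hx : x ∈ tsupport ξ ∪ tsupport η0)
        exact ⟨by linarith [m1.1], by linarith [m2.2]⟩
    have ζ0 : ∀ x, x ∉ Icc a' b' → ζ x = 0 := fun x hx => by
      change ξ x - m * η0 x = 0
      rw [image_eq_zero_of_notMem_tsupport fun hh => hx (hξ hh),
        image_eq_zero_of_notMem_tsupport fun hh => hx (hη' hh)]
      ring
    let Z : ℝ → ℝ := fun r => ∫ s in a'..r, ζ s
    have hZd : ∀ r, HasDerivAt Z (ζ r) r := fun r =>
      intervalIntegral.integral_hasDerivAt_right (hζ.continuous.intervalIntegrable _ _)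
        (hζ.continuous.stronglyMeasurableAtFilter _ _) hζ.continuous.continuousAt
    have hZ' : deriv Z = ζ := funext fun r => (hZd r).deriv
    have hZs : ContDiff ℝ (⊤ : ℕ∞) Z := by
      rw [contDiff_infty_iff_deriv]
      exact ⟨fun r => (hZd r).differentiableAt, by rw [hZ']; exact hζ⟩
    have Z0 : ∀ r, r ∉ Icc a' b' → Z r = 0 := by
      intro r hr
      rw [mem_Icc, not_and_or, not_le, not_le] at hr
      rcases hr with hr | hr
      · change ∫ s in a'..r, ζ s = 0
        rw [intervalIntegral.integral_symm, neg_eq_zero]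
        refine intervalIntegral.integral_zero_ae ?_
        have : ∀ᵐ s : ℝ, s ≠ a' := by simp [ae_iff, measure_singleton]
        filter_upwards [this] with s hs1 hs
        rw [uIoc_of_le hr.le] at hs
        exact ζ0 s fun hh => hs1 (le_antisymm hs.2 hh.1)
      · change ∫ s in a'..r, ζ s = 0
        rw [intervalIntegral.integral_of_le (hab'.le.trans hr.le), ← hζ0]
        refine setIntegral_eq_integral_of_ae_compl_eq_zero ?_
        have : ∀ᵐ s : ℝ, s ≠ a' := by simp [ae_iff, measure_singleton]
        filter_upwards [this] with s hs1 hs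
        refine ζ0 s fun hh => hs ⟨lt_of_le_of_ne hh.1 hs1.symm, hh.2.trans hr.le⟩
    have hZt : tsupport Z ⊆ Icc a' b' :=
      closure_minimal (fun r hr => by
        by_contra hh
        exact hr (Z0 r hh)) isClosed_Icc
    have hZc : HasCompactSupport Z := isCompact_Icc.of_isClosed_subset (isClosed_tsupport _) hZt
    have main := h Z hZs hZc (hZt.trans fun x hx => ⟨ha'.trans_le hx.1, hx.2.trans_lt hb'⟩)
    rw [hZ'] at main
    have i1 := int ξ h1.continuous h2 h3
    have i2 := int η0 hη.continuous hηc hηs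
    have e1 : ∫ r, F r * ζ r = (∫ r, F r * ξ r) - m * C := by
      rw [← integral_const_mul, ← integral_sub i1 (i2.const_mul m)]
      refine integral_congr_ae (Eventually.of_forall fun r => ?_)
      change F r * (ξ r - m * η0 r) = _
      ring
    have e2 : ∫ r, ξ r • (F r - C) = (∫ r, F r * ξ r) - m * C := by
      rw [hm, ← integral_mul_const, ← integral_sub i1 (ξi.mul_const C)]
      refine integral_congr_ae (Eventually.of_forall fun r => ?_)
      simp only [smul_eq_mul]
      ring
    rw [e2, ← e1, main]
  filter_upwards [key] with r hr hm using sub_eq_zero.1 (hr hm)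

/-- The weak solutions of `r f' = l f`. -/
theorem exists_ae_eq_rpow {ρ l : ℝ} (hρ : 0 < ρ) {f : ℝ → ℝ}
    (hf : LocallyIntegrableOn f (Ioo 0 ρ))
    (h : ∀ ψ : ℝ → ℝ, ContDiff ℝ (⊤ : ℕ∞) ψ → HasCompactSupport ψ → tsupport ψ ⊆ Ioo 0 ρ →
      ∫ r, f r * (deriv ψ r + l * ψ r / r) = 0) :
    ∃ C, ∀ᵐ r, r ∈ Ioo 0 ρ → f r = C * r ^ l := by
  have hcont : ContinuousOn (fun r : ℝ => r ^ (-l)) (Ioo 0 ρ) := fun r hr =>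
    (Real.continuousAt_rpow_const r (-l) (Or.inl hr.1.ne')).continuousWithinAt
  have hF : LocallyIntegrableOn (fun r => r ^ (-l) * f r) (Ioo 0 ρ) :=
    hf.continuousOn_mul hcont isOpen_Ioo.isLocallyClosed
  obtain ⟨C, hC⟩ := exists_ae_eq_const hρ hF fun ξ h1 h2 h3 => by
    -- Integrating factor: ψ' + lψ/r = r^{-l} ξ', so the hypothesis says that r^{-l} f has weak
    -- derivative zero.
    let ψ : ℝ → ℝ := fun r => r ^ (-l) * ξ r
    have hs : tsupport ψ ⊆ tsupport ξ := tsupport_mul_subset_right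
    have hψ : ContDiff ℝ (⊤ : ℕ∞) ψ := by
      refine contDiff_iff_contDiffAt.2 fun r => ?_
      by_cases hr : r ∈ tsupport ψ
      · have hr0 := (h3 (hs hr)).1
        exact (Real.contDiffAt_rpow_const_of_ne hr0.ne').mul h1.contDiffAt
      · exact contDiffAt_const.congr_of_eventuallyEq (notMem_tsupport_iff_eventuallyEq.1 hr)
    have := h ψ hψ h2.mul_left (hs.trans h3)
    rw [← this]
    refine integral_congr_ae (Eventually.of_forall fun r => ?_)
    simp only
    by_cases hr : r ∈ Ioo 0 ρ
    · have d1 : HasDerivAt (fun r : ℝ => r ^ (-l)) (-l * r ^ (-l - 1)) r :=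
        Real.hasDerivAt_rpow_const (Or.inl hr.1.ne')
      have d2 : HasDerivAt ξ (deriv ξ r) r := (h1.differentiable (by simp) r).hasDerivAt
      have d3 : deriv ψ r = -l * r ^ (-l - 1) * ξ r + r ^ (-l) * deriv ξ r := (d1.mul d2).deriv
      rw [d3, Real.rpow_sub_one hr.1.ne']
      have := hr.1.ne'
      change _ = f r * (_ + l * (r ^ (-l) * ξ r) / r)
      field_simp
      ring
    · have hr1 : r ∉ tsupport ξ := fun hh => hr (h3 hh)
      have hr2 : r ∉ tsupport ψ := fun hh => hr1 (hs hh)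
      have z1 : deriv ξ r = 0 :=
        image_eq_zero_of_notMem_tsupport fun hh => hr1 (tsupport_deriv_subset hh)
      have z2 : deriv ψ r = 0 :=
        image_eq_zero_of_notMem_tsupport fun hh => hr2 (tsupport_deriv_subset hh)
      rw [z1, z2, image_eq_zero_of_notMem_tsupport hr2]
      simp
  refine ⟨C, ?_⟩
  filter_upwards [hC] with r hr hm
  have h1 := hr hm
  rw [← h1, mul_comm, ← mul_assoc, ← Real.rpow_add hm.1]
  simp

end oneDim

/-! ### Fourier series on an interval -/

section fourier

open Complex in
/-- Parseval's identity for the combined sine and cosine coefficients of two functions. -/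
theorem hasSum_sq_integral_cos_add_sin {κ : ℝ} (hκ : 0 < κ) {p q : ℝ → ℝ}
    (hp : MemLp p 2 (volume.restrict (Ioo (-κ) κ)))
    (hq : MemLp q 2 (volume.restrict (Ioo (-κ) κ))) :
    HasSum (fun k : ℤ => (∫ θ in Ioo (-κ) κ,
        (q θ * Real.cos (k * (Real.pi / (2 * κ)) * (θ + κ)) +
          p θ * Real.sin (k * (Real.pi / (2 * κ)) * (θ + κ)))) ^ 2)
      (2 * κ * ∫ θ in Ioo (-κ) κ, (p θ ^ 2 + q θ ^ 2)) := by
  let H : ℝ → ℂ := fun x => (q x : ℂ) + (p x : ℂ) * I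
  have hH : MemLp H 2 (volume.restrict (Ioo (-κ) κ)) :=
    (hq.ofReal (K := ℂ)).add ((hp.ofReal (K := ℂ)).mul_const I)
  -- Reflection about -κ extends q evenly and p oddly to an interval of length 4κ, whose Fourier
  -- frequencies are kπ/(2κ). Ordinary Parseval for F then gives the combined cosine and sine
  -- coefficients.
  let F : ℝ → ℂ := (Ioo (-κ) κ).piecewise H fun x => (starRingEnd ℂ) (H (-2 * κ - x))
  have hab : -3 * κ < κ := by linarith
  have e0 : Ioo (-κ) κ =ᵐ[volume] Ioc (-κ) κ := Ioo_ae_eq_Ioc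
  have hHc : MemLp H 2 (volume.restrict (Ioc (-κ) κ)) := by
    rwa [← Measure.restrict_congr_set e0]
  have hrefl : MemLp (fun x => (starRingEnd ℂ) (H (-2 * κ - x))) 2
      (volume.restrict (Ioo (-3 * κ) (-κ))) := by
    have mp := ((Measure.measurePreserving_sub_left volume (-2 * κ : ℝ)).restrict_preimage
      (measurableSet_Ioo : MeasurableSet (Ioo (-κ) κ)))
    have e : (fun x : ℝ => -2 * κ - x) ⁻¹' Ioo (-κ) κ = Ioo (-3 * κ) (-κ) := by
      ext x
      simp only [mem_preimage, mem_Ioo]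
      constructor <;> rintro ⟨h1, h2⟩ <;> constructor <;> linarith
    rw [e] at mp
    exact (hH.comp_measurePreserving mp).star
  have hF : MemLp F 2 (volume.restrict (Ioc (-3 * κ) κ)) := by
    refine MemLp.piecewise measurableSet_Ioo ?_ ?_
    · have : Ioo (-κ) κ ⊆ Ioc (-3 * κ) κ := fun x hx => ⟨by linarith [hx.1], hx.2.le⟩
      rwa [Measure.restrict_restrict measurableSet_Ioo, inter_eq_left.2 this]
    · rw [Measure.restrict_restrict measurableSet_Ioo.compl]
      have : ((Ioo (-κ) κ)ᶜ ∩ Ioc (-3 * κ) κ : Set ℝ) =ᵐ[volume] Ioo (-3 * κ) (-κ) := by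
        have h1 : ∀ᵐ x : ℝ, x ≠ -κ := by simp [ae_iff, measure_singleton]
        have h2 : ∀ᵐ x : ℝ, x ≠ κ := by simp [ae_iff, measure_singleton]
        filter_upwards [h1, h2] with x h1 h2
        refine propext ⟨fun ⟨h3, h4⟩ => ⟨h4.1, ?_⟩, fun h3 => ⟨fun h4 => ?_, h3.1, ?_⟩⟩
        · by_contra! h5
          exact h3 ⟨lt_of_le_of_ne h5 h1.symm, lt_of_le_of_ne h4.2 h2⟩
        · exact absurd h4.1 (not_lt.2 h3.2.le)
        · exact h3.2.le.trans (by linarith)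
      rwa [Measure.restrict_congr_set this]
  have key := hasSum_sq_fourierCoeffOn hab hF
  have Fi : IntervalIntegrable F volume (-3 * κ) κ := by
    rw [intervalIntegrable_iff_integrableOn_Ioc_of_le hab.le]
    exact hF.integrable one_le_two
  have hHi : IntegrableOn H (Ioo (-κ) κ) := hH.integrable one_le_two
  -- splitting an integral against `F`
  have split : ∀ (G : ℝ → ℂ → ℂ), IntervalIntegrable (fun x => G x (F x)) volume (-3 * κ) κ →
      ∫ x in (-3 * κ)..κ, G x (F x) = (∫ x in (-κ)..κ, G (-2 * κ - x) ((starRingEnd ℂ) (H x))) +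
        ∫ x in (-κ)..κ, G x (H x) := by
    intro G hG
    have s1 : IntervalIntegrable (fun x => G x (F x)) volume (-3 * κ) (-κ) :=
      hG.mono_set (by
        rw [uIcc_of_le hab.le, uIcc_of_le (by linarith)]
        exact Icc_subset_Icc_right (by linarith))
    have s2 : IntervalIntegrable (fun x => G x (F x)) volume (-κ) κ :=
      hG.mono_set (by
        rw [uIcc_of_le hab.le, uIcc_of_le (by linarith)]
        exact Icc_subset_Icc_left (by linarith))
    rw [← intervalIntegral.integral_add_adjacent_intervals s1 s2]
    congr 1
    · have := intervalIntegral.integral_comp_sub_left (a := -3 * κ) (b := -κ)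
        (fun x => G (-2 * κ - x) ((starRingEnd ℂ) (H x))) (-2 * κ)
      rw [show -2 * κ - -κ = -κ by ring, show -2 * κ - -3 * κ = κ by ring] at this
      rw [← this, intervalIntegral.integral_of_le (by linarith),
        intervalIntegral.integral_of_le (by linarith)]
      refine setIntegral_congr_fun measurableSet_Ioc fun x hx => ?_
      have : F x = (starRingEnd ℂ) (H (-2 * κ - x)) :=
        piecewise_eq_of_notMem _ _ _ fun h => absurd h.1 (not_lt.2 hx.2)
      simp only [this]
      rw [show -2 * κ - (-2 * κ - x) = x by ring]
    · rw [intervalIntegral.integral_of_le (by linarith),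
        intervalIntegral.integral_of_le (by linarith), integral_Ioc_eq_integral_Ioo,
        integral_Ioc_eq_integral_Ioo]
      refine setIntegral_congr_fun measurableSet_Ioo fun x hx => ?_
      have : F x = H x := piecewise_eq_of_mem _ _ _ hx
      simp only [this]
  have hnorm : ∫ x in (-3 * κ)..κ, ‖F x‖ ^ 2 = 2 * ∫ θ in Ioo (-κ) κ, (p θ ^ 2 + q θ ^ 2) := by
    have hsq : IntervalIntegrable (fun x => ‖F x‖ ^ 2) volume (-3 * κ) κ := by
      rw [intervalIntegrable_iff_integrableOn_Ioc_of_le hab.le]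
      exact hF.integrable_norm_pow (by norm_num)
    have hc : ∫ x in (-3 * κ)..κ, (((‖F x‖ ^ 2 : ℝ)) : ℂ) =
        ((2 * ∫ θ in Ioo (-κ) κ, (p θ ^ 2 + q θ ^ 2) : ℝ) : ℂ) := by
      have hsqc : IntervalIntegrable (fun x => ((‖F x‖ ^ 2 : ℝ) : ℂ)) volume (-3 * κ) κ :=
        ⟨Integrable.ofReal hsq.1, Integrable.ofReal hsq.2⟩
      have := split (fun _ z => ((‖z‖ ^ 2 : ℝ) : ℂ)) hsqc
      rw [this]
      have e : ∀ x, ‖H x‖ ^ 2 = p x ^ 2 + q x ^ 2 := fun x => by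
        rw [← Complex.normSq_eq_norm_sq]
        simp [H, Complex.normSq_apply]
        ring
      simp only [RCLike.norm_conj, e]
      rw [intervalIntegral.integral_ofReal, intervalIntegral.integral_of_le (by linarith),
        integral_Ioc_eq_integral_Ioo]
      push_cast
      ring
    rw [intervalIntegral.integral_ofReal] at hc
    exact_mod_cast hc
  rw [hnorm] at key
  have coeff : ∀ k : ℤ, ‖fourierCoeffOn hab F k‖ = (2 * κ)⁻¹ * |∫ θ in Ioo (-κ) κ,
        (q θ * Real.cos (k * (Real.pi / (2 * κ)) * (θ + κ)) +
          p θ * Real.sin (k * (Real.pi / (2 * κ)) * (θ + κ)))| := by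
    intro k
    let a : ℝ := k * (Real.pi / (2 * κ))
    -- The phase is measured from the reflection point -κ, so reflection conjugates `E`. The two
    -- halves of the coefficient are then conjugate, and their sum is twice a real part.
    let E : ℝ → ℂ := fun x => Complex.exp (((-(a * (x + κ)) : ℝ) : ℂ) * I)
    have hE : Continuous E := by fun_prop
    have hEs : ∀ x, E (-2 * κ - x) = (starRingEnd ℂ) (E x) := fun x => by
      simp only [E]
      rw [← Complex.exp_conj, map_mul, Complex.conj_ofReal, Complex.conj_I]
      congr 1
      push_cast
      ring
    have hf : ∀ x : ℝ, (fourier (-k) (x : AddCircle (κ - -3 * κ)) : ℂ) =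
        Complex.exp (((a * κ : ℝ) : ℂ) * I) * E x := fun x => by
      rw [fourier_coe_apply, ← Complex.exp_add]
      congr 1
      simp only [a]
      push_cast
      have : (κ : ℂ) ≠ 0 := by exact_mod_cast hκ.ne'
      have h4 : (κ : ℂ) - -3 * κ = 4 * κ := by ring
      rw [h4]
      field_simp
      ring
    have hEF : IntervalIntegrable (fun x => E x * F x) volume (-3 * κ) κ :=
      Fi.continuousOn_mul hE.continuousOn
    have hEH : IntegrableOn (fun x => E x * H x) (Ioo (-κ) κ) := by
      refine Integrable.bdd_mul (c := 1) hHi hE.aestronglyMeasurable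
        (Eventually.of_forall fun x => ?_)
      rw [Complex.norm_exp_ofReal_mul_I]
    have sp := split (fun x z => E x * z) hEF
    have s1 : ∫ x in (-κ)..κ, E (-2 * κ - x) * (starRingEnd ℂ) (H x) =
        (starRingEnd ℂ) (∫ x in (-κ)..κ, E x * H x) := by
      rw [intervalIntegral.integral_of_le (by linarith),
        intervalIntegral.integral_of_le (by linarith), ← integral_conj]
      refine integral_congr_ae (Eventually.of_forall fun x => ?_)
      simp only [hEs, map_mul]
    have s2 : (∫ x in (-κ)..κ, E x * H x).re = ∫ θ in Ioo (-κ) κ,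
        (q θ * Real.cos (k * (Real.pi / (2 * κ)) * (θ + κ)) +
          p θ * Real.sin (k * (Real.pi / (2 * κ)) * (θ + κ))) := by
      rw [intervalIntegral.integral_of_le (by linarith), integral_Ioc_eq_integral_Ioo]
      have := integral_re (𝕜 := ℂ) hEH
      refine this.symm.trans (integral_congr_ae (Eventually.of_forall fun x => ?_))
      simp only [E, H, RCLike.re_eq_complex_re, Complex.mul_re, Complex.exp_ofReal_mul_I_re,
        Complex.exp_ofReal_mul_I_im, Real.cos_neg, Real.sin_neg]
      simp
      ring
    rw [fourierCoeffOn_eq_integral]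
    have : ∫ x in (-3 * κ)..κ, (fourier (-k) (x : AddCircle (κ - -3 * κ)) : ℂ) • F x =
        Complex.exp (((a * κ : ℝ) : ℂ) * I) * ∫ x in (-3 * κ)..κ, E x * F x := by
      rw [← intervalIntegral.integral_const_mul]
      refine intervalIntegral.integral_congr fun x _ => ?_
      simp only [hf, smul_eq_mul, mul_assoc]
    rw [this, sp, s1, add_comm, Complex.add_conj, norm_smul, norm_mul,
      Complex.norm_exp_ofReal_mul_I, one_mul, Complex.norm_real, Real.norm_eq_abs, Real.norm_eq_abs,
      s2, abs_mul, abs_two, abs_of_pos (by apply one_div_pos.2; linarith)]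
    rw [show κ - -3 * κ = 4 * κ by ring]
    field_simp
    ring
  simp only [coeff, mul_pow, sq_abs] at key
  have main := key.mul_left ((2 * κ) ^ 2)
  have e1 : ∀ a : ℝ, (2 * κ) ^ 2 * ((2 * κ)⁻¹ ^ 2 * a) = a := fun a => by field_simp
  have e2 : ∀ a : ℝ, (2 * κ) ^ 2 * ((κ - -3 * κ)⁻¹ • (2 * a)) = 2 * κ * a := fun a => by
    rw [show κ - -3 * κ = 4 * κ by ring, smul_eq_mul]
    field_simp
    ring
  simpa only [e1, e2] using main

/-- The one-dimensional Poincaré inequality. -/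
theorem integral_sq_le_of_eq_zero {κ : ℝ} (hκ : 0 < κ) {h h' : ℝ → ℝ}
    (hd : ∀ θ, HasDerivAt h (h' θ) θ) (hc : Continuous h') (h0 : h (-κ) = 0) (h1 : h κ = 0) :
    ∫ θ in Ioo (-κ) κ, h θ ^ 2 ≤ 4 * κ ^ 2 * ∫ θ in Ioo (-κ) κ, h' θ ^ 2 := by
  have hcont : Continuous h := continuous_iff_continuousAt.2 fun θ => (hd θ).continuousAt
  have ii : ∀ {g : ℝ → ℝ}, Continuous g → IntervalIntegrable g volume (-κ) κ :=
    fun hg => hg.intervalIntegrable _ _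
  have e : ∀ g : ℝ → ℝ, ∫ θ in Ioo (-κ) κ, g θ = ∫ θ in (-κ)..κ, g θ := fun g => by
    rw [intervalIntegral.integral_of_le (by linarith), integral_Ioc_eq_integral_Ioo]
  rw [e, e]
  -- The integrand is the derivative of θh². Together with 2θhh' ≥ -h²/2 - 2θ²h'² and |θ| ≤ κ this
  -- gives the constant 4κ².
  have ftc : ∫ θ in (-κ)..κ, (h θ ^ 2 + θ * (2 * h θ * h' θ)) = 0 := by
    rw [intervalIntegral.integral_eq_sub_of_hasDerivAt (f := fun θ => θ * h θ ^ 2)]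
    · rw [h0, h1]
      ring
    · intro θ _
      refine ((hasDerivAt_id θ).mul ((hd θ).pow 2)).congr_deriv ?_
      simp
    · exact ii (by fun_prop)
  have le : ∫ θ in (-κ)..κ, (h θ ^ 2 + θ * (2 * h θ * h' θ)) ≥
      ∫ θ in (-κ)..κ, (1 / 2 * h θ ^ 2 - 2 * κ ^ 2 * h' θ ^ 2) := by
    refine intervalIntegral.integral_mono_on (by linarith) (ii (by fun_prop)) (ii (by fun_prop))
      fun θ hθ => ?_
    have : θ ^ 2 ≤ κ ^ 2 := sq_le_sq' hθ.1 hθ.2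
    nlinarith [sq_nonneg (h θ + 2 * θ * h' θ), mul_nonneg (sub_nonneg.2 this) (sq_nonneg (h' θ))]
  rw [ftc, intervalIntegral.integral_sub (ii (by fun_prop)) (ii (by fun_prop)),
    intervalIntegral.integral_const_mul, intervalIntegral.integral_const_mul] at le
  linarith

end fourier

/-! ### Polar coordinates at a corner -/

section polar

variable {ω : Set Plane} {P : Plane} {ρ κ : ℝ} {T : ℂ ≃ₗᵢ[ℝ] Plane}

/-- Polar coordinates with pole `P`; the isometry `T` fixes the axis. -/
def polarMap (P : Plane) (T : ℂ ≃ₗᵢ[ℝ] Plane) (p : ℝ × ℝ) : Plane :=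
  P + T (p.1 * Complex.exp (p.2 * Complex.I))

/-- Near `P`, the set `ω` is the sector `|θ| < κ`. -/
structure IsPolarSector (ω : Set Plane) (P : Plane) (T : ℂ ≃ₗᵢ[ℝ] Plane) (ρ κ : ℝ) : Prop where
  pos : 0 < ρ
  angle_pos : 0 < κ
  angle_lt : κ < Real.pi
  mem_iff : ∀ r θ : ℝ, 0 < r → r < ρ → |θ| ≤ Real.pi → (polarMap P T (r, θ) ∈ ω ↔ |θ| < κ)

theorem IsPolarSector.mono (h : IsPolarSector ω P T ρ κ) {ρ' : ℝ} (h0 : 0 < ρ') (h1 : ρ' ≤ ρ) :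
    IsPolarSector ω P T ρ' κ :=
  ⟨h0, h.angle_pos, h.angle_lt, fun r θ hr hr' hθ => h.mem_iff r θ hr (hr'.trans_le h1) hθ⟩

theorem IsSector.exists_isPolarSector {b c : Plane} (h : IsSector ω P ρ b c κ) (h0 : 0 < κ)
    (h1 : κ < Real.pi) : ∃ T : ℂ ≃ₗᵢ[ℝ] Plane, IsPolarSector ω P T ρ κ := by
  let L : ℂ →ₗ[ℝ] Plane :=
    { toFun := fun z => z.re • b + z.im • c
      map_add' := fun z w => by simp [add_smul]; abel
      map_smul' := fun a z => by simp [mul_smul] }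
  let L' : ℂ →ₗᵢ[ℝ] Plane := ⟨L, fun z => by
    rw [← sq_eq_sq₀ (norm_nonneg _) (norm_nonneg _)]
    change ‖z.re • b + z.im • c‖ ^ 2 = _
    rw [norm_add_sq_real, norm_smul, norm_smul, h.norm_b, h.norm_c, inner_smul_left,
      inner_smul_right, h.inner_bc, ← Complex.normSq_eq_norm_sq, Complex.normSq_apply]
    simp [sq]⟩
  refine ⟨L'.toLinearIsometryEquiv (by simp), h.pos, h0, h1, fun r θ hr hr' hθ => ?_⟩
  rw [← h.mem_iff r θ hr hr' hθ, polarMap, Complex.exp_mul_I, LinearIsometry.toLinearIsometryEquiv,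
    add_assoc]
  have : L (r * (Complex.cos θ + Complex.sin θ * Complex.I)) =
      (r * Real.cos θ) • b + (r * Real.sin θ) • c := by
    change (r * (Complex.cos θ + Complex.sin θ * Complex.I)).re • b +
      (r * (Complex.cos θ + Complex.sin θ * Complex.I)).im • c = _
    simp [← Complex.ofReal_cos, ← Complex.ofReal_sin]
  rw [← this]
  rfl

theorem dist_polarMap (P : Plane) (T : ℂ ≃ₗᵢ[ℝ] Plane) {r : ℝ} (hr : 0 ≤ r) (θ : ℝ) :
    dist (polarMap P T (r, θ)) P = r := by
  rw [polarMap, dist_eq_norm, add_sub_cancel_left, T.norm_map, norm_mul,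
    Complex.norm_exp_ofReal_mul_I, Complex.norm_real, Real.norm_of_nonneg hr, mul_one]

theorem continuous_polarMap : Continuous (polarMap P T) := by
  unfold polarMap
  fun_prop

theorem exists_polarMap (T : ℂ ≃ₗᵢ[ℝ] Plane) (x : Plane) :
    ∃ θ, θ ∈ Ioc (-Real.pi) Real.pi ∧ polarMap P T (dist x P, θ) = x := by
  refine ⟨(T.symm (x - P)).arg, Complex.arg_mem_Ioc _, ?_⟩
  have : dist x P = ‖T.symm (x - P)‖ := by rw [T.symm.norm_map, dist_eq_norm]
  rw [polarMap, this, Complex.norm_mul_exp_arg_mul_I, T.apply_symm_apply, add_sub_cancel]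

theorem measurePreserving_add_isometry (P : Plane) (T : ℂ ≃ₗᵢ[ℝ] Plane) :
    MeasurePreserving (fun z => P + T z) volume volume :=
  (measurePreserving_add_left volume P).comp T.measurePreserving

theorem measurableEmbedding_add_isometry (P : Plane) (T : ℂ ≃ₗᵢ[ℝ] Plane) :
    MeasurableEmbedding (fun z => P + T z) :=
  (T.toHomeomorph.trans (Homeomorph.addLeft P)).measurableEmbedding

theorem polarMap_eq (P : Plane) (T : ℂ ≃ₗᵢ[ℝ] Plane) (p : ℝ × ℝ) :
    polarMap P T p = P + T (Complex.polarCoord.symm p) := by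
  rw [polarMap, Complex.polarCoord_symm_apply, Complex.exp_mul_I]
  simp

theorem IsPolarSector.mem_inter_ball_iff (h : IsPolarSector ω P T ρ κ) {p : ℝ × ℝ}
    (hp : p ∈ polarCoord.target) :
    polarMap P T p ∈ ω ∩ Metric.ball P ρ ↔ p ∈ Ioo 0 ρ ×ˢ Ioo (-κ) κ := by
  have h0 : 0 < p.1 := hp.1
  have h1 : |p.2| ≤ Real.pi := abs_le.2 ⟨hp.2.1.le, hp.2.2.le⟩
  rw [mem_inter_iff, Metric.mem_ball, dist_polarMap P T h0.le p.2, mem_prod, mem_Ioo, mem_Ioo,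
    ← abs_lt]
  constructor
  · rintro ⟨h2, h3⟩
    exact ⟨⟨h0, h3⟩, (h.mem_iff p.1 p.2 h0 h3 h1).1 h2⟩
  · rintro ⟨h2, h3⟩
    exact ⟨(h.mem_iff p.1 p.2 h0 h2.2 h1).2 h3, h2.2⟩

theorem IsPolarSector.rect_subset (h : IsPolarSector ω P T ρ κ) :
    Ioo 0 ρ ×ˢ Ioo (-κ) κ ⊆ polarCoord.target := fun p hp =>
  ⟨hp.1.1, ⟨by linarith [hp.2.1, h.angle_lt], by linarith [hp.2.2, h.angle_lt]⟩⟩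

theorem measurableSet_rect : MeasurableSet (Ioo 0 ρ ×ˢ Ioo (-κ) κ) :=
  measurableSet_Ioo.prod measurableSet_Ioo

/-- Change to polar coordinates with Jacobian r. Since κ < π, the rectangle lies in the domain of
the chart and avoids its cut. -/
theorem IsPolarSector.setIntegral_eq (h : IsPolarSector ω P T ρ κ) (hω : MeasurableSet ω)
    (F : Plane → ℝ) : ∫ x in ω ∩ Metric.ball P ρ, F x =
      ∫ p in Ioo 0 ρ ×ˢ Ioo (-κ) κ, p.1 * F (polarMap P T p) := by
  have hm : MeasurableSet (ω ∩ Metric.ball P ρ) := hω.inter Metric.isOpen_ball.measurableSet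
  rw [← integral_indicator hm,
    ← (measurePreserving_add_isometry P T).integral_comp (measurableEmbedding_add_isometry P T),
    ← Complex.integral_comp_polarCoord_symm, ← inter_eq_right.2 h.rect_subset,
    ← setIntegral_indicator measurableSet_rect]
  refine setIntegral_congr_fun polarCoord.open_target.measurableSet fun p hp => ?_
  have := h.mem_inter_ball_iff hp
  simp only [← polarMap_eq, smul_eq_mul]
  by_cases hq : p ∈ Ioo 0 ρ ×ˢ Ioo (-κ) κ
  · rw [indicator_of_mem hq, indicator_of_mem (this.2 hq)]
  · rw [indicator_of_notMem hq, indicator_of_notMem (mt this.1 hq), mul_zero]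

theorem IsPolarSector.setLIntegral_eq (h : IsPolarSector ω P T ρ κ) (hω : MeasurableSet ω)
    (F : Plane → ℝ≥0∞) : ∫⁻ x in ω ∩ Metric.ball P ρ, F x =
      ∫⁻ p in Ioo 0 ρ ×ˢ Ioo (-κ) κ, ENNReal.ofReal p.1 * F (polarMap P T p) := by
  have hm : MeasurableSet (ω ∩ Metric.ball P ρ) := hω.inter Metric.isOpen_ball.measurableSet
  rw [← lintegral_indicator hm,
    ← (measurePreserving_add_isometry P T).lintegral_comp_emb
      (measurableEmbedding_add_isometry P T),
    ← Complex.lintegral_comp_polarCoord_symm, ← inter_eq_right.2 h.rect_subset,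
    inter_comm polarCoord.target, ← Measure.restrict_restrict measurableSet_rect,
    ← lintegral_indicator measurableSet_rect]
  refine setLIntegral_congr_fun polarCoord.open_target.measurableSet fun p hp => ?_
  have := h.mem_inter_ball_iff hp
  simp only [← polarMap_eq, smul_eq_mul]
  by_cases hq : p ∈ Ioo 0 ρ ×ˢ Ioo (-κ) κ
  · rw [indicator_of_mem hq, indicator_of_mem (this.2 hq)]
  · rw [indicator_of_notMem hq, indicator_of_notMem (mt this.1 hq), mul_zero]

theorem IsPolarSector.integrableOn_comp (h : IsPolarSector ω P T ρ κ) (hω : MeasurableSet ω)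
    {F : Plane → ℝ} (hF : StronglyMeasurable F) (hi : Integrable F (volume.restrict ω)) :
    IntegrableOn (fun p : ℝ × ℝ => p.1 * F (polarMap P T p)) (Ioo 0 ρ ×ˢ Ioo (-κ) κ) := by
  refine ⟨(continuous_fst.stronglyMeasurable.mul
    (hF.comp_measurable continuous_polarMap.measurable)).aestronglyMeasurable, ?_⟩
  have h1 : IntegrableOn F (ω ∩ Metric.ball P ρ) := hi.mono_measure
    (Measure.restrict_mono inter_subset_left le_rfl)
  have h2 := h1.2
  rw [hasFiniteIntegral_iff_enorm, h.setLIntegral_eq hω] at h2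
  rw [hasFiniteIntegral_iff_enorm]
  refine lt_of_le_of_lt (setLIntegral_mono' measurableSet_rect fun p hp => ?_) h2
  rw [enorm_mul, Real.enorm_of_nonneg hp.1.1.le]

/-! ### The gradient in polar coordinates -/

/-- The gradient of the jet `u` at a point, as a vector. -/
def gradVec (u : Jet ω) (x : Plane) : Plane := ∑ i : Fin 2, u (some i) x • stdVec i

/-- The radial and the angular component of the gradient of `u`. -/
def polarGrad (P : Plane) (T : ℂ ≃ₗᵢ[ℝ] Plane) (u : Jet ω) (p : ℝ × ℝ) : ℂ :=
  T.symm (gradVec u (polarMap P T p)) * Complex.exp (-(p.2 * Complex.I))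

theorem norm_gradVec_sq (u : Jet ω) (x : Plane) :
    ‖gradVec u x‖ ^ 2 = ∑ i : Fin 2, u (some i) x ^ 2 := by
  rw [gradVec, EuclideanSpace.norm_sq_eq]
  simp [Fin.sum_univ_two, stdVec]

theorem polarGrad_sq (u : Jet ω) (p : ℝ × ℝ) :
    (polarGrad P T u p).re ^ 2 + (polarGrad P T u p).im ^ 2 =
      ∑ i : Fin 2, u (some i) (polarMap P T p) ^ 2 := by
  rw [← norm_gradVec_sq, ← T.symm.norm_map, ← mul_one ‖_‖,
    ← Complex.norm_exp_ofReal_mul_I (-p.2), ← norm_mul, ← Complex.normSq_eq_norm_sq,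
    Complex.normSq_apply, polarGrad]
  simp [sq]

theorem gradVec_eq (u : Jet ω) (r θ : ℝ) : gradVec u (polarMap P T (r, θ)) =
    (polarGrad P T u (r, θ)).re • T (Complex.exp (θ * Complex.I)) +
      (polarGrad P T u (r, θ)).im • T (Complex.I * Complex.exp (θ * Complex.I)) := by
  rw [← map_smul, ← map_smul, ← map_add, ← T.symm_apply_eq]
  set z := polarGrad P T u (r, θ) with hz
  have h1 : z.re • Complex.exp (θ * Complex.I) +
      z.im • (Complex.I * Complex.exp (θ * Complex.I)) = z * Complex.exp (θ * Complex.I) := by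
    nth_rw 3 [← Complex.re_add_im z]
    simp only [Complex.real_smul]
    ring
  rw [h1, hz, polarGrad, mul_assoc, ← Complex.exp_add]
  simp

theorem measurable_polarGrad (u : Jet ω) : Measurable (polarGrad P T u) := by
  unfold polarGrad gradVec
  refine Measurable.mul ?_ (by fun_prop)
  refine T.symm.continuous.measurable.comp ?_
  refine Finset.measurable_sum _ fun i _ => ?_
  exact ((Lp.stronglyMeasurable (u (some i))).measurable.comp
    continuous_polarMap.measurable).smul_const _

theorem IsPolarSector.integrableOn_polarGrad_sq (h : IsPolarSector ω P T ρ κ)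
    (hω : MeasurableSet ω) (u : Jet ω) :
    IntegrableOn (fun p : ℝ × ℝ => p.1 * ((polarGrad P T u p).re ^ 2 + (polarGrad P T u p).im ^ 2))
      (Ioo 0 ρ ×ˢ Ioo (-κ) κ) := by
  simp only [polarGrad_sq, Finset.mul_sum]
  refine integrable_finsetSum _ fun i _ => ?_
  exact h.integrableOn_comp hω (F := fun x => u (some i) x ^ 2)
    ((Lp.stronglyMeasurable (u (some i))).pow 2) (integrable_sq_L2 _)

theorem IsPolarSector.ballEnergy_eq (h : IsPolarSector ω P T ρ κ)
    (hω : MeasurableSet ω) (u : Jet ω) : ballEnergy u P ρ =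
      ∫ r in Ioo 0 ρ, r * ∫ θ in Ioo (-κ) κ,
        ((polarGrad P T u (r, θ)).re ^ 2 + (polarGrad P T u (r, θ)).im ^ 2) := by
  rw [ballEnergy, ← integral_finsetSum, h.setIntegral_eq hω, Measure.volume_eq_prod,
    setIntegral_prod]
  · simp only [polarGrad_sq, integral_const_mul]
  · have := h.integrableOn_polarGrad_sq hω u
    simp only [polarGrad_sq] at this
    exact this
  · intro i _
    exact (integrable_sq_L2 _).mono_measure (Measure.restrict_mono inter_subset_left le_rfl)

end polar

/-! ### Functions that are smooth in `ω` only -/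

section interior

variable {ω : Set Plane} {φ S G : Plane → ℝ} {u : Jet ω} {f : L2 ω}

/-- On the support of a test function, a function that is smooth in `ω` is a test function. -/
theorem IsTestFunction.exists_localization (hω : IsOpen ω) (hφ : IsTestFunction ω φ)
    (hS : ∀ x ∈ ω, ContDiffAt ℝ (⊤ : ℕ∞) S x) :
    ∃ ψ, IsTestFunction ω ψ ∧ ∀ x ∈ tsupport φ, ψ =ᶠ[𝓝 x] S := by
  obtain ⟨K, hK, h1, h2⟩ := exists_compact_between hφ.compact hω hφ.support
  obtain ⟨χ, c1, c2, -⟩ := exists_contMDiffMap_one_nhds_of_subset_interior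
    (modelWithCornersSelf ℝ Plane) (n := (⊤ : ℕ∞)) (isClosed_tsupport φ) h1
  have hχ : ContDiff ℝ (⊤ : ℕ∞) χ := χ.contMDiff.contDiff
  have ht : tsupport (fun x => χ x * S x) ⊆ K := by
    refine closure_minimal (fun x hx => ?_) hK.isClosed
    by_contra h
    exact hx (by simp [c2 x h])
  refine ⟨fun x => χ x * S x, ⟨contDiff_iff_contDiffAt.2 fun x => ?_,
    hK.of_isClosed_subset (isClosed_tsupport _) ht, ht.trans h2⟩, fun x hx => ?_⟩
  · by_cases hx : x ∈ tsupport (fun x => χ x * S x)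
    · exact hχ.contDiffAt.mul (hS x (h2 (ht hx)))
    · exact contDiffAt_const.congr_of_eventuallyEq (notMem_tsupport_iff_eventuallyEq.1 hx)
  · have := (eventually_nhdsSet_iff_forall.1 c1) x hx
    filter_upwards [this] with y hy
    rw [hy, one_mul]

theorem Filter.EventuallyEq.pd_eq {x : Plane} (h : S =ᶠ[𝓝 x] G) (i : Fin 2) :
    pd i S x = pd i G x := by
  rw [pd, pd, h.fderiv_eq]

theorem aestronglyMeasurable_of_contDiffAt (hω : IsOpen ω)
    (hS : ∀ x ∈ ω, ContDiffAt ℝ (⊤ : ℕ∞) S x) :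
    AEStronglyMeasurable S (volume.restrict ω) :=
  ContinuousOn.aestronglyMeasurable
    (fun x hx => (hS x hx).continuousAt.continuousWithinAt) hω.measurableSet

theorem contDiffAt_pd (hS : ∀ x ∈ ω, ContDiffAt ℝ (⊤ : ℕ∞) S x) (i : Fin 2) :
    ∀ x ∈ ω, ContDiffAt ℝ (⊤ : ℕ∞) (pd i S) x := fun x hx =>
  ((hS x hx).fderiv_right (m := (⊤ : ℕ∞)) (by simp)).clm_apply contDiffAt_const

theorem memLp_of_bound (hω : IsOpen ω) (hb : Bornology.IsBounded ω)
    (hS : ∀ x ∈ ω, ContDiffAt ℝ (⊤ : ℕ∞) S x) {C : ℝ} (hC : ∀ x ∈ ω, |S x| ≤ C) :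
    MemLp S 2 (volume.restrict ω) := by
  have : IsFiniteMeasure (volume.restrict ω) := ⟨by
    rw [Measure.restrict_apply_univ]
    exact hb.measure_lt_top⟩
  exact MemLp.of_bound (aestronglyMeasurable_of_contDiffAt hω hS) C
    ((ae_restrict_iff' hω.measurableSet).2 (Eventually.of_forall hC))

theorem hasWeakPartial_of_contDiffAt (hω : IsOpen ω) (hS : ∀ x ∈ ω, ContDiffAt ℝ (⊤ : ℕ∞) S x)
    (h0 : MemLp S 2 (volume.restrict ω)) {i : Fin 2} (h1 : MemLp (pd i S) 2 (volume.restrict ω)) :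
    HasWeakPartial i (toL2 ω S) (toL2 ω (pd i S)) := by
  rw [hasWeakPartial_iff]
  intro φ hφ
  obtain ⟨ψ, hψ, h⟩ := hφ.exists_localization hω hS
  rw [real_inner_comm, real_inner_comm (toL2 ω φ), inner_toL2_right _ h0, inner_toL2_right _ h1]
  have e1 : ∫ x in ω, toL2 ω (pd i φ) x * S x = ∫ x in ω, ψ x * pd i φ x := by
    refine integral_congr_ae ?_
    filter_upwards [coeFn_toL2 ((hφ.pd i).memLp ω 2)] with x hx
    rw [hx, mul_comm]
    by_cases hm : x ∈ tsupport φ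
    · rw [(h x hm).self_of_nhds]
    · have : pd i φ x = 0 := image_eq_zero_of_notMem_tsupport fun hh =>
        hm (tsupport_fderiv_apply_subset ℝ _ hh)
      rw [this, mul_zero, mul_zero]
  have e2 : ∫ x in ω, toL2 ω φ x * pd i S x = ∫ x in ω, pd i ψ x * φ x := by
    refine integral_congr_ae ?_
    filter_upwards [coeFn_toL2 (hφ.memLp ω 2)] with x hx
    rw [hx, mul_comm]
    by_cases hm : x ∈ tsupport φ
    · rw [(h x hm).pd_eq]
    · rw [image_eq_zero_of_notMem_tsupport hm, mul_zero, mul_zero]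
  rw [e1, e2, (hφ.pd i).setIntegral_mul, hφ.setIntegral_mul, integral_mul_pd hφ hψ.smooth]

/-- A gradient and a rotated gradient are orthogonal. -/
theorem inner_pd_comm (hω : IsOpen ω) (hG : ∀ x ∈ ω, ContDiffAt ℝ (⊤ : ℕ∞) G x)
    (h1 : ∀ i, MemLp (pd i G) 2 (volume.restrict ω)) (hu : u ∈ H10 ω ω) (i j : Fin 2) :
    inner ℝ (u (some i)) (toL2 ω (pd j G)) = inner ℝ (u (some j)) (toL2 ω (pd i G)) := by
  refine H10.induction (p := fun u => inner ℝ (u (some i)) (toL2 ω (pd j G)) =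
    inner ℝ (u (some j)) (toL2 ω (pd i G))) (isClosed_eq ?_ ?_) (fun φ hφ => ?_) hu
  · exact (Jet.continuous_apply _).inner continuous_const
  · exact (Jet.continuous_apply _).inner continuous_const
  · obtain ⟨ψ, hψ, h⟩ := hφ.exists_localization hω hG
    have e : ∀ i j : Fin 2, inner ℝ (toL2 ω (pd i φ)) (toL2 ω (pd j G)) =
        - ∫ x, pd i (pd j ψ) x * φ x := by
      intro i j
      rw [inner_toL2_right _ (h1 j), ← integral_mul_pd hφ (hψ.pd j).smooth,
        ← (hφ.pd i).setIntegral_mul]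
      refine integral_congr_ae ?_
      filter_upwards [coeFn_toL2 ((hφ.pd i).memLp ω 2)] with x hx
      rw [hx, mul_comm]
      by_cases hm : x ∈ tsupport φ
      · rw [(h x hm).pd_eq]
      · have : pd i φ x = 0 := image_eq_zero_of_notMem_tsupport fun hh =>
          hm (tsupport_fderiv_apply_subset ℝ _ hh)
        rw [this, mul_zero, mul_zero]
    simp only [jet_some]
    rw [e, e, pd_comm hψ.smooth]

/-- A smooth function that leaves zero and is close to the identity. -/
theorem exists_truncation : ∃ (τ : ℝ → ℝ) (C : ℝ), ContDiff ℝ (⊤ : ℕ∞) τ ∧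
    (∀ t, |t| ≤ 1 → τ t = 0) ∧ (∀ t, |τ t - t| ≤ C) ∧ ∀ t, |deriv τ t| ≤ C := by
  let b : ContDiffBump (0 : ℝ) := ⟨1, 2, one_pos, one_lt_two⟩
  have hb : ContDiff ℝ (⊤ : ℕ∞) b := b.contDiff
  have hs : ContDiff ℝ (⊤ : ℕ∞) fun t => t * b t := contDiff_id.mul hb
  have hc : HasCompactSupport fun t => t * b t := b.hasCompactSupport.mul_left
  obtain ⟨C, hC⟩ := hc.exists_bound_of_continuous hs.continuous
  obtain ⟨D, hD⟩ := hc.deriv.exists_bound_of_continuous (hs.continuous_deriv (by simp))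
  refine ⟨fun t => t - t * b t, max C (1 + D), contDiff_id.sub hs, fun t ht => ?_, fun t => ?_,
    fun t => ?_⟩
  · have : b t = 1 := b.one_of_mem_closedBall (by simpa using ht)
    simp [this]
  · rw [show t - t * b t - t = -(t * b t) by ring, abs_neg]
    exact (hC t).trans (le_max_left _ _)
  · have hd : DifferentiableAt ℝ (fun t => t * b t) t := (hs.differentiable (by simp)) t
    have : deriv (fun t => t - t * b t) t = 1 - deriv (fun t => t * b t) t := by
      rw [deriv_fun_sub differentiableAt_fun_id hd]
      simp
    rw [this]
    refine (abs_sub _ _).trans ?_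
    rw [abs_one]
    exact (add_le_add_right (hD t) 1).trans (le_max_right _ _)

theorem norm_toL2_le_of_bound {μ' : ℝ} {φ : Plane → ℝ} (hμ : (volume ω).toReal = μ')
    (hfin : volume ω ≠ ⊤) (hφ : MemLp φ 2 (volume.restrict ω)) {C : ℝ} (hC0 : 0 ≤ C)
    (hC : ∀ᵐ x ∂volume.restrict ω, |φ x| ≤ C) : ‖toL2 ω φ‖ ≤ C * √μ' := by
  have h0 : 0 ≤ μ' := hμ ▸ ENNReal.toReal_nonneg
  refine le_of_sq_le_sq ?_ (by positivity)
  rw [norm_sq_eq_integral, mul_pow, Real.sq_sqrt h0, ← hμ]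
  have hfm : IsFiniteMeasure (volume.restrict ω) := ⟨by
    rw [Measure.restrict_apply_univ]
    exact hfin.lt_top⟩
  calc ∫ x in ω, toL2 ω φ x ^ 2 ≤ ∫ x in ω, C ^ 2 := by
        refine integral_mono_ae (integrable_sq_L2 _) (integrable_const _) ?_
        filter_upwards [coeFn_toL2 hφ, hC] with x hx h
        rw [hx]
        exact sq_le_sq' (abs_le.1 h).1 (abs_le.1 h).2
    _ = C ^ 2 * (volume ω).toReal := by
        rw [setIntegral_const, smul_eq_mul, mul_comm, Measure.real]

/-- A bounded function with bounded gradient that vanishes at the boundary is in `H¹₀(ω)`. -/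
theorem jet_mem_H10_of_vanishing (hω : IsOpen ω) (hb : Bornology.IsBounded ω)
    (hS : ∀ x ∈ ω, ContDiffAt ℝ (⊤ : ℕ∞) S x) {C : ℝ} (hC : ∀ x ∈ ω, |S x| ≤ C)
    (hC' : ∀ i, ∀ x ∈ ω, |pd i S x| ≤ C)
    (hv : ∀ ε > 0, ∃ K, IsCompact K ∧ K ⊆ ω ∧ ∀ x ∈ ω, ε < |S x| → x ∈ K) :
    jet ω S ∈ H10 ω ω := by
  classical
  rcases ω.eq_empty_or_nonempty with rfl | ⟨x0, hx0⟩
  · have : jet ∅ S = 0 := by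
      have hz : ∀ v : L2 ∅, v = 0 := fun v => by
        rw [← norm_eq_zero, ← sq_eq_zero_iff, norm_sq_eq_integral]
        simp
      exact Jet.ext (hz _) fun i => hz _
    rw [this]
    exact Submodule.zero_mem _
  have C0 : 0 ≤ C := (abs_nonneg _).trans (hC x0 hx0)
  obtain ⟨τ, D, hτ, hτ0, hτ1, hτ2⟩ := exists_truncation
  have D0 : 0 ≤ D := (abs_nonneg _).trans (hτ2 0)
  let N : ℕ → ℝ := fun n => (n : ℝ) + 1
  have Npos : ∀ n, 0 < N n := fun n => by positivity
  -- N⁻¹τ(N S) is zero where |S| ≤ 1/N, hence compactly supported in ω. It is within D/N of S, and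
  -- its gradient stays bounded by that of S up to a constant.
  let s : ℕ → Plane → ℝ := fun n x => if x ∈ ω then (N n)⁻¹ * τ (N n * S x) else 0
  have hs : ∀ n, IsTestFunction ω (s n) := by
    intro n
    obtain ⟨K, hK, h1, h2⟩ := hv ((N n)⁻¹) (inv_pos.2 (Npos n))
    have ht : tsupport (s n) ⊆ K := by
      refine closure_minimal (fun x hx => ?_) hK.isClosed
      by_contra h
      refine hx ?_
      by_cases hm : x ∈ ω
      · have h3 : |S x| ≤ (N n)⁻¹ := not_lt.1 fun hh => h (h2 x hm hh)
        have h4 : |N n * S x| ≤ 1 := by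
          rw [abs_mul, abs_of_pos (Npos n)]
          calc N n * |S x| ≤ N n * (N n)⁻¹ := mul_le_mul_of_nonneg_left h3 (Npos n).le
            _ = 1 := mul_inv_cancel₀ (Npos n).ne'
        simp [s, hm, hτ0 _ h4]
      · simp [s, hm]
    refine ⟨contDiff_iff_contDiffAt.2 fun x => ?_,
      hK.of_isClosed_subset (isClosed_tsupport _) ht, ht.trans h1⟩
    by_cases hx : x ∈ tsupport (s n)
    · have hm : x ∈ ω := h1 (ht hx)
      have : s n =ᶠ[𝓝 x] fun y => (N n)⁻¹ * τ (N n * S y) := by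
        filter_upwards [hω.mem_nhds hm] with y hy
        simp [s, hy]
      refine ContDiffAt.congr_of_eventuallyEq ?_ this
      exact contDiffAt_const.mul (hτ.contDiffAt.comp x (contDiffAt_const.mul (hS x hm)))
    · exact contDiffAt_const.congr_of_eventuallyEq (notMem_tsupport_iff_eventuallyEq.1 hx)
  have hpd : ∀ n i, ∀ x ∈ ω, pd i (s n) x = deriv τ (N n * S x) * pd i S x := by
    intro n i x hm
    have : s n =ᶠ[𝓝 x] fun y => (N n)⁻¹ * τ (N n * S y) := by
      filter_upwards [hω.mem_nhds hm] with y hy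
      simp [s, hy]
    rw [this.pd_eq, pd]
    have d1 : HasFDerivAt S (fderiv ℝ S x) x :=
      ((hS x hm).differentiableAt (by simp)).hasFDerivAt
    have d2 : HasDerivAt τ (deriv τ (N n * S x)) (N n * S x) :=
      (hτ.differentiable (by simp) _).hasDerivAt
    have d3 := (d2.comp_hasFDerivAt x (d1.const_mul (N n))).const_mul (N n)⁻¹
    have d4 : HasFDerivAt (fun y => (N n)⁻¹ * τ (N n * S y)) _ x := d3
    rw [d4.fderiv]
    have := (Npos n).ne'
    simp only [smul_apply, smul_eq_mul, pd]
    field_simp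
  have hfin : volume ω ≠ ⊤ := hb.measure_lt_top.ne
  have memS := memLp_of_bound hω hb hS hC
  have mempd := fun i => memLp_of_bound hω hb (contDiffAt_pd hS i) (hC' i)
  set m := √(volume ω).toReal with hm
  have b1 : ∀ n, ‖toL2 ω (s n) - toL2 ω S‖ ≤ D * (N n)⁻¹ * m := by
    intro n
    rw [← toL2_sub ((hs n).memLp ω 2) memS]
    refine norm_toL2_le_of_bound rfl hfin (((hs n).memLp ω 2).sub memS)
      (mul_nonneg D0 (inv_pos.2 (Npos n)).le) ?_
    filter_upwards [ae_restrict_mem hω.measurableSet] with x hx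
    change |s n x - S x| ≤ _
    simp only [s, hx, if_true]
    rw [show (N n)⁻¹ * τ (N n * S x) - S x = (N n)⁻¹ * (τ (N n * S x) - N n * S x) by
      have := (Npos n).ne'
      field_simp, abs_mul, abs_of_pos (inv_pos.2 (Npos n)), mul_comm]
    exact mul_le_mul_of_nonneg_right (hτ1 _) (inv_pos.2 (Npos n)).le
  have b2 : ∀ n i, ‖toL2 ω (pd i (s n))‖ ≤ D * C * m := by
    intro n i
    refine norm_toL2_le_of_bound rfl hfin (((hs n).pd i).memLp ω 2) (mul_nonneg D0 C0) ?_
    filter_upwards [ae_restrict_mem hω.measurableSet] with x hx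
    rw [hpd n i x hx, abs_mul]
    exact mul_le_mul (hτ2 _) (hC' i x hx) (abs_nonneg _) D0
  have Ninv : ∀ n, (N n)⁻¹ ≤ 1 := fun n =>
    inv_le_one_of_one_le₀ (by simp only [N]; linarith [(Nat.cast_nonneg n : (0 : ℝ) ≤ n)])
  have lim : Tendsto (fun n => toL2 ω (s n)) atTop (𝓝 (toL2 ω S)) := by
    rw [tendsto_iff_norm_sub_tendsto_zero]
    have h0 : Tendsto (fun n => D * (N n)⁻¹ * m) atTop (𝓝 0) := by
      have := ((tendsto_one_div_add_atTop_nhds_zero_nat (𝕜 := ℝ)).const_mul D).mul_const m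
      simpa [N] using this
    exact squeeze_zero (fun _ => norm_nonneg _) b1 h0
  have b3 : ∀ n, ‖jet ω (s n)‖ ≤
      √((‖toL2 ω S‖ + D * m) ^ 2 + ∑ i : Fin 2, (D * C * m) ^ 2) := by
    intro n
    have hm0 : 0 ≤ m := Real.sqrt_nonneg _
    rw [PiLp.norm_eq_of_L2, Fintype.sum_option]
    refine Real.sqrt_le_sqrt (add_le_add ?_ (Finset.sum_le_sum fun i _ => ?_))
    · refine pow_le_pow_left₀ (norm_nonneg _) ?_ 2
      rw [jet_none]
      have h1 := norm_sub_norm_le (toL2 ω (s n)) (toL2 ω S)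
      have h2 := b1 n
      have h3 : D * (N n)⁻¹ * m ≤ D * m := mul_le_mul_of_nonneg_right
        (mul_le_of_le_one_right D0 (Ninv n)) hm0
      linarith
    · exact pow_le_pow_left₀ (norm_nonneg _) (b2 n i) 2
  -- The gradients are only known to be bounded, so the limit is weak. The values converge strongly,
  -- and this identifies the weak limit with the jet of `S`.
  obtain ⟨l, Z, hl, hle, hZ⟩ := exists_weak_limit _ _ b3
  have hZm : Z ∈ H10 ω ω := by
    rw [← Submodule.orthogonal_orthogonal (H10 ω ω), Submodule.mem_orthogonal]
    intro y hy
    rw [Submodule.mem_orthogonal] at hy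
    have h1 := hZ y
    rw [real_inner_comm]
    refine tendsto_nhds_unique h1 (tendsto_const_nhds.congr fun n => ?_)
    exact (hy _ (jet_mem_H10 (hs n))).symm
  have hZ0 : Z none = toL2 ω S := by
    refine ext_inner_right ℝ fun v => ?_
    have h1 := hZ (mkJet v 0)
    have e : ∀ J : Jet ω, inner ℝ J (mkJet v 0) = inner ℝ (J none) v := fun J => by
      rw [PiLp.inner_apply, Fintype.sum_option]
      simp
    simp only [e] at h1
    exact tendsto_nhds_unique h1 ((lim.mono_left hle).inner tendsto_const_nhds)
  have : jet ω S = Z := by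
    refine Jet.ext hZ0.symm fun i => ?_
    have h1 := H10.hasWeakPartial hZm i
    rw [hZ0] at h1
    exact (hasWeakPartial_of_contDiffAt hω hS memS (mempd i)).unique hω h1
  rw [this]
  exact hZm

/-! ### Two orthogonality relations -/

theorem fderiv_gradVec (u : Jet ω) (S : Plane → ℝ) (x : Plane) :
    fderiv ℝ S x (gradVec u x) = ∑ i : Fin 2, u (some i) x * pd i S x := by
  simp [gradVec, pd]

theorem integral_fderiv_gradVec (hω : IsOpen ω) (hb : Bornology.IsBounded ω)
    (hS : ∀ x ∈ ω, ContDiffAt ℝ (⊤ : ℕ∞) S x) {C : ℝ}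
    (hC' : ∀ i, ∀ x ∈ ω, |pd i S x| ≤ C) (u : Jet ω) :
    Integrable (fun x => fderiv ℝ S x (gradVec u x)) (volume.restrict ω) ∧
    ∫ x in ω, fderiv ℝ S x (gradVec u x) =
      ∑ i : Fin 2, inner ℝ (u (some i)) (toL2 ω (pd i S)) := by
  have mempd := fun i => memLp_of_bound hω hb (contDiffAt_pd hS i) (hC' i)
  simp only [fderiv_gradVec, fun i => inner_toL2_right (u (some i)) (mempd i)]
  have hi : ∀ i ∈ Finset.univ, Integrable (fun x => u (some i) x * pd i S x) (volume.restrict ω) :=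
    fun i _ => (Lp.memLp (u (some i))).integrable_mul (mempd i)
  exact ⟨integrable_finsetSum _ hi, integral_finsetSum _ hi⟩

/-- The rotation by `π / 2`, seen through the isometry `T`. -/
def rot (T : ℂ ≃ₗᵢ[ℝ] Plane) (v : Plane) : Plane := T (Complex.I * T.symm v)

/-- A map of the plane with (Rv, v) = 0 for all v is antisymmetric, so it is a multiple m of the
standard rotation. The orientation of `T` affects only m, and the identity is later used to obtain
zero. -/
theorem exists_fderiv_rot (T : ℂ ≃ₗᵢ[ℝ] Plane) : ∃ m : ℝ, ∀ (u : Jet ω) (G : Plane → ℝ) (x : Plane),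
    fderiv ℝ G x (rot T (gradVec u x)) =
      m * (u (some 0) x * pd 1 G x - u (some 1) x * pd 0 G x) := by
  let R : Plane →ₗ[ℝ] Plane :=
    { toFun := rot T
      map_add' := fun v w => by simp [rot, mul_add]
      map_smul' := fun a v => by
        rw [rot, map_smul, mul_smul_comm, map_smul]
        rfl }
  have hR : ∀ v, inner ℝ (R v) v = 0 := fun v => by
    change inner ℝ (T (Complex.I * T.symm v)) v = 0
    nth_rw 2 [← T.apply_symm_apply v]
    rw [T.inner_map_map, Complex.inner]
    simp
    ring
  have hR' : ∀ v, (R v) 0 * v 0 + (R v) 1 * v 1 = 0 := fun v => by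
    have := hR v
    rw [PiLp.inner_apply, Fin.sum_univ_two] at this
    simp at this
    linarith
  have h00 : R (stdVec 0) 0 = 0 := by simpa [stdVec] using hR' (stdVec 0)
  have h11 : R (stdVec 1) 1 = 0 := by simpa [stdVec] using hR' (stdVec 1)
  have h01 : R (stdVec 1) 0 = - R (stdVec 0) 1 := by
    have := hR' (stdVec 0 + stdVec 1)
    rw [map_add] at this
    simp only [PiLp.add_apply, h00, h11] at this
    simp [stdVec] at this
    simp only [stdVec]
    linarith
  refine ⟨R (stdVec 0) 1, fun u G x => ?_⟩
  have e0 : R (stdVec 0) = R (stdVec 0) 1 • stdVec 1 := by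
    ext i
    fin_cases i
    · simpa [stdVec] using h00
    · simp [stdVec]
  have e1 : R (stdVec 1) = -R (stdVec 0) 1 • stdVec 0 := by
    ext i
    fin_cases i
    · simpa [stdVec] using h01
    · simpa [stdVec] using h11
  change fderiv ℝ G x (R (gradVec u x)) = _
  rw [gradVec, map_sum, Fin.sum_univ_two, map_smul, map_smul, map_add, map_smul, map_smul]
  nth_rw 1 [e0]
  rw [e1, map_smul, map_smul]
  simp only [pd, smul_eq_mul]
  ring

theorem integral_fderiv_rot_gradVec (hω : IsOpen ω) (hb : Bornology.IsBounded ω)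
    (T : ℂ ≃ₗᵢ[ℝ] Plane) (hG : ∀ x ∈ ω, ContDiffAt ℝ (⊤ : ℕ∞) G x) {C : ℝ}
    (hC' : ∀ i, ∀ x ∈ ω, |pd i G x| ≤ C) (hu : u ∈ H10 ω ω) :
    Integrable (fun x => fderiv ℝ G x (rot T (gradVec u x))) (volume.restrict ω) ∧
    ∫ x in ω, fderiv ℝ G x (rot T (gradVec u x)) = 0 := by
  obtain ⟨m, hm⟩ := exists_fderiv_rot (ω := ω) T
  have mempd := fun i => memLp_of_bound hω hb (contDiffAt_pd hG i) (hC' i)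
  have hi : ∀ i j, Integrable (fun x => u (some i) x * pd j G x) (volume.restrict ω) :=
    fun i j => (Lp.memLp (u (some i))).integrable_mul (mempd j)
  simp only [hm]
  refine ⟨((hi 0 1).sub (hi 1 0)).const_mul m, ?_⟩
  rw [integral_const_mul, integral_sub (hi 0 1) (hi 1 0), ← inner_toL2_right _ (mempd 1),
    ← inner_toL2_right _ (mempd 0), inner_pd_comm hω hG mempd hu 0 1, sub_self, mul_zero]

end interior

/-! ### Fourier modes of a harmonic function at a corner -/

section modes

variable {ω : Set Plane} {P : Plane} {ρ κ : ℝ} {T : ℂ ≃ₗᵢ[ℝ] Plane} {ψ a a' : ℝ → ℝ} {u : Jet ω}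
  {f : L2 ω}

/-- A function that separates in polar coordinates. -/
def polarFun (P : Plane) (T : ℂ ≃ₗᵢ[ℝ] Plane) (ψ a : ℝ → ℝ) (x : Plane) : ℝ :=
  ψ ‖T.symm (x - P)‖ * a (T.symm (x - P)).arg

theorem polarFun_polarMap {r θ : ℝ} (hr : 0 < r) (hθ : θ ∈ Ioc (-Real.pi) Real.pi) :
    polarFun P T ψ a (polarMap P T (r, θ)) = ψ r * a θ := by
  rw [polarFun, polarMap, add_sub_cancel_left, T.symm_apply_apply, norm_mul,
    Complex.norm_exp_ofReal_mul_I, Complex.norm_real, Real.norm_of_nonneg hr.le, mul_one,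
    Complex.arg_real_mul _ hr, Complex.exp_mul_I, Complex.arg_cos_add_sin_mul_I hθ]

theorem polarFun_eventually_zero {x : Plane} (hx : dist x P ∉ tsupport ψ) :
    polarFun P T ψ a =ᶠ[𝓝 x] fun _ => 0 := by
  have hc : ContinuousAt (fun y : Plane => dist y P) x := by fun_prop
  have h : ∀ᶠ r in 𝓝 (dist x P), ψ r = 0 := notMem_tsupport_iff_eventuallyEq.1 hx
  filter_upwards [hc.eventually h] with y hy
  rw [polarFun, T.symm.norm_map, ← dist_eq_norm, hy, zero_mul]

/-- The points of `ω` where a separated function lives. -/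
theorem IsPolarSector.exists_polar (h : IsPolarSector ω P T ρ κ) {x : Plane} (hx : x ∈ ω)
    (h0 : 0 < dist x P) (h1 : dist x P < ρ) :
    ∃ θ, |θ| < κ ∧ polarMap P T (dist x P, θ) = x := by
  obtain ⟨θ, hθ, he⟩ := exists_polarMap (P := P) T x
  refine ⟨θ, ?_, he⟩
  rw [← h.mem_iff (dist x P) θ h0 h1 (abs_le.2 ⟨hθ.1.le, hθ.2⟩), he]
  exact hx

theorem IsPolarSector.angle_mem (h : IsPolarSector ω P T ρ κ) {θ : ℝ} (hθ : |θ| ≤ κ) :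
    θ ∈ Ioo (-Real.pi) Real.pi := by
  have := h.angle_lt
  rw [abs_le] at hθ
  exact ⟨by linarith [hθ.1], by linarith [hθ.2]⟩

/-- The argument is the imaginary part of the logarithm, smooth off the negative axis, and the norm
is smooth off the origin. -/
theorem contDiffAt_polarFun (hψ : ContDiff ℝ (⊤ : ℕ∞) ψ) (ha : ContDiff ℝ (⊤ : ℕ∞) a) {r θ : ℝ}
    (hr : 0 < r) (hθ : θ ∈ Ioo (-Real.pi) Real.pi) :
    ContDiffAt ℝ (⊤ : ℕ∞) (polarFun P T ψ a) (polarMap P T (r, θ)) := by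
  have hz : ContDiffAt ℝ (⊤ : ℕ∞) (fun x => T.symm (x - P)) (polarMap P T (r, θ)) :=
    T.symm.contDiff.contDiffAt.comp _ (contDiffAt_id.sub contDiffAt_const)
  have e : T.symm (polarMap P T (r, θ) - P) = r * Complex.exp (θ * Complex.I) := by
    rw [polarMap, add_sub_cancel_left, T.symm_apply_apply]
  have harg : (r * Complex.exp (θ * Complex.I)).arg = θ := by
    rw [Complex.arg_real_mul _ hr, Complex.exp_mul_I,
      Complex.arg_cos_add_sin_mul_I (Ioo_subset_Ioc_self hθ)]
  have hne : (r * Complex.exp (θ * Complex.I) : ℂ) ≠ 0 :=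
    mul_ne_zero (Complex.ofReal_ne_zero.2 hr.ne') (Complex.exp_ne_zero _)
  have hs : (r * Complex.exp (θ * Complex.I) : ℂ) ∈ Complex.slitPlane := by
    rw [Complex.mem_slitPlane_iff_arg, harg]
    exact ⟨hθ.2.ne, hne⟩
  have h1 : ContDiffAt ℝ (⊤ : ℕ∞) (fun z : ℂ => ‖z‖) (T.symm (polarMap P T (r, θ) - P)) := by
    rw [e]
    exact contDiffAt_norm ℝ hne
  have h2 : ContDiffAt ℝ (⊤ : ℕ∞) Complex.arg (T.symm (polarMap P T (r, θ) - P)) := by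
    rw [e]
    have hl : ContDiffAt ℝ (⊤ : ℕ∞) Complex.log (r * Complex.exp (θ * Complex.I)) :=
      (Complex.contDiffAt_log hs).restrict_scalars ℝ
    have := Complex.imCLM.contDiff.contDiffAt.comp _ hl
    refine this.congr_of_eventuallyEq (Eventually.of_forall fun z => ?_)
    simp [Complex.log_im]
  exact (hψ.contDiffAt.comp _ (ContDiffAt.comp (f := fun x => T.symm (x - P)) _ h1 hz)).mul
    (ha.contDiffAt.comp _ (ContDiffAt.comp (f := fun x => T.symm (x - P)) _ h2 hz))

theorem IsPolarSector.contDiffAt_polarFun (h : IsPolarSector ω P T ρ κ)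
    (hψ : ContDiff ℝ (⊤ : ℕ∞) ψ) (hs : tsupport ψ ⊆ Ioo 0 ρ) (ha : ContDiff ℝ (⊤ : ℕ∞) a) :
    ∀ x ∈ ω, ContDiffAt ℝ (⊤ : ℕ∞) (polarFun P T ψ a) x := by
  intro x hx
  by_cases hm : dist x P ∈ tsupport ψ
  · obtain ⟨θ, hθ, he⟩ := h.exists_polar hx (hs hm).1 (hs hm).2
    rw [← he]
    exact _root_.contDiffAt_polarFun hψ ha (hs hm).1 (h.angle_mem hθ.le)
  · exact contDiffAt_const.congr_of_eventuallyEq (polarFun_eventually_zero hm)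

theorem hasDerivAt_polarMap_fst (r θ : ℝ) :
    HasDerivAt (fun s => polarMap P T (s, θ)) (T (Complex.exp (θ * Complex.I))) r := by
  have h1 : HasDerivAt (fun s : ℝ => (s : ℂ) * Complex.exp (θ * Complex.I))
      (Complex.exp (θ * Complex.I)) r := by
    simpa using (hasDerivAt_id r).ofReal_comp.mul_const (Complex.exp (θ * Complex.I))
  exact (T.toContinuousLinearEquiv.hasFDerivAt.comp_hasDerivAt r h1).const_add P

theorem hasDerivAt_polarMap_snd (r θ : ℝ) :
    HasDerivAt (fun t => polarMap P T (r, t)) (r • T (Complex.I * Complex.exp (θ * Complex.I)))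
      θ := by
  have h0 : HasDerivAt (fun t : ℝ => (t : ℂ) * Complex.I) Complex.I θ := by
    simpa using (hasDerivAt_id θ).ofReal_comp.mul_const Complex.I
  have h1 : HasDerivAt (fun t : ℝ => (r : ℂ) * Complex.exp (t * Complex.I))
      (r • (Complex.I * Complex.exp (θ * Complex.I))) θ := by
    refine (h0.cexp.const_mul (r : ℂ)).congr_deriv ?_
    rw [Complex.real_smul]
    ring
  rw [← map_smul]
  exact (T.toContinuousLinearEquiv.hasFDerivAt.comp_hasDerivAt θ h1).const_add P

theorem fderiv_polarFun (hψ : ContDiff ℝ (⊤ : ℕ∞) ψ) (ha : ContDiff ℝ (⊤ : ℕ∞) a)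
    (ha' : ∀ θ, HasDerivAt a (a' θ) θ) {r θ : ℝ}
    (hr : 0 < r) (hθ : θ ∈ Ioo (-Real.pi) Real.pi) :
    fderiv ℝ (polarFun P T ψ a) (polarMap P T (r, θ)) (T (Complex.exp (θ * Complex.I))) =
      deriv ψ r * a θ ∧
    fderiv ℝ (polarFun P T ψ a) (polarMap P T (r, θ))
      (T (Complex.I * Complex.exp (θ * Complex.I))) = ψ r * a' θ / r := by
  have hS := ((contDiffAt_polarFun (P := P) (T := T) hψ ha hr hθ).differentiableAt
    (by simp)).hasFDerivAt
  constructor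
  · have h1 : HasDerivAt (fun s => polarFun P T ψ a (polarMap P T (s, θ))) _ r :=
      HasFDerivAt.comp_hasDerivAt (f := fun s => polarMap P T (s, θ)) r hS
        (hasDerivAt_polarMap_fst r θ)
    have h2 : HasDerivAt (fun s => ψ s * a θ) (deriv ψ r * a θ) r :=
      ((hψ.differentiable (by simp)) r).hasDerivAt.mul_const _
    refine h1.unique (h2.congr_of_eventuallyEq ?_)
    filter_upwards [lt_mem_nhds hr] with s hs
    exact polarFun_polarMap hs (Ioo_subset_Ioc_self hθ)
  · have h1 : HasDerivAt (fun t => polarFun P T ψ a (polarMap P T (r, t))) _ θ :=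
      HasFDerivAt.comp_hasDerivAt (f := fun t => polarMap P T (r, t)) θ hS
        (hasDerivAt_polarMap_snd r θ)
    have h2 : HasDerivAt (fun t => ψ r * a t) (ψ r * a' θ) θ := (ha' θ).const_mul _
    have h3 := h1.unique (h2.congr_of_eventuallyEq (by
      filter_upwards [isOpen_Ioo.mem_nhds hθ] with t ht
      exact polarFun_polarMap hr (Ioo_subset_Ioc_self ht)))
    rw [map_smul, smul_eq_mul] at h3
    rw [← h3]
    field_simp

theorem exists_bound_div (hψ : ContDiff ℝ (⊤ : ℕ∞) ψ) (hc : HasCompactSupport ψ)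
    (hs : tsupport ψ ⊆ Ioo 0 ρ) : ∃ C, 0 ≤ C ∧ (∀ r, |ψ r| ≤ C) ∧ (∀ r, |deriv ψ r| ≤ C) ∧
      ∀ r, |ψ r / r| ≤ C := by
  obtain ⟨C0, h0⟩ := hc.exists_bound_of_continuous hψ.continuous
  obtain ⟨C1, h1⟩ := hc.deriv.exists_bound_of_continuous (hψ.continuous_deriv (by simp))
  have hd : Continuous fun r => ψ r / r := by
    refine continuous_iff_continuousAt.2 fun r => ?_
    by_cases hr : r ∈ tsupport ψ
    · exact hψ.continuous.continuousAt.div continuousAt_id (hs hr).1.ne'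
    · have : (fun r => ψ r / r) =ᶠ[𝓝 r] fun _ => 0 := by
        filter_upwards [notMem_tsupport_iff_eventuallyEq.1 hr] with t ht
        rw [ht]
        simp
      exact (continuousAt_const).congr this.symm
  have hdc : HasCompactSupport fun r => ψ r / r := by
    simp only [div_eq_mul_inv]
    exact hc.mul_right
  obtain ⟨C2, h2⟩ := hdc.exists_bound_of_continuous hd
  refine ⟨max C0 (max C1 C2), ((norm_nonneg _).trans (h0 0)).trans (le_max_left _ _),
    fun r => (h0 r).trans (le_max_left _ _),
    fun r => (h1 r).trans ((le_max_left _ _).trans (le_max_right _ _)),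
    fun r => (h2 r).trans ((le_max_right _ _).trans (le_max_right _ _))⟩

theorem IsPolarSector.exists_bound_pd_polarFun (h : IsPolarSector ω P T ρ κ)
    (hψ : ContDiff ℝ (⊤ : ℕ∞) ψ) (hc : HasCompactSupport ψ) (hs : tsupport ψ ⊆ Ioo 0 ρ)
    (ha : ContDiff ℝ (⊤ : ℕ∞) a) (ha' : ∀ θ, HasDerivAt a (a' θ) θ) {A : ℝ}
    (hA : ∀ θ, |a θ| ≤ A) (hA' : ∀ θ, |a' θ| ≤ A) :
    ∃ C, (∀ x ∈ ω, |polarFun P T ψ a x| ≤ C) ∧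
      ∀ i, ∀ x ∈ ω, |pd i (polarFun P T ψ a) x| ≤ C := by
  obtain ⟨C, C0, h0, h1, h2⟩ := exists_bound_div hψ hc hs
  have A0 : 0 ≤ A := (abs_nonneg _).trans (hA 0)
  refine ⟨C * A + C * A, fun x _ => ?_, fun i x hx => ?_⟩
  · rw [polarFun, abs_mul]
    have := mul_le_mul (h0 ‖T.symm (x - P)‖) (hA (T.symm (x - P)).arg) (abs_nonneg _) C0
    linarith [mul_nonneg C0 A0]
  · by_cases hm : dist x P ∈ tsupport ψ
    · obtain ⟨θ, hθ, he⟩ := h.exists_polar hx (hs hm).1 (hs hm).2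
      set r := dist x P
      have hr : 0 < r := (hs hm).1
      obtain ⟨d1, d2⟩ := fderiv_polarFun (P := P) (T := T) hψ ha ha' hr (h.angle_mem hθ.le)
      rw [he] at d1 d2
      set w := T.symm (stdVec i) * Complex.exp (-(θ * Complex.I)) with hw
      have hwn : ‖w‖ = 1 := by
        rw [hw, norm_mul, T.symm.norm_map, ← neg_mul, ← Complex.ofReal_neg,
          Complex.norm_exp_ofReal_mul_I]
        simp [stdVec]
      have e : stdVec i = w.re • T (Complex.exp (θ * Complex.I)) +
          w.im • T (Complex.I * Complex.exp (θ * Complex.I)) := by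
        rw [← map_smul, ← map_smul, ← map_add, ← T.symm_apply_eq]
        have h1 : w.re • Complex.exp (θ * Complex.I) +
            w.im • (Complex.I * Complex.exp (θ * Complex.I)) = w * Complex.exp (θ * Complex.I) := by
          nth_rw 3 [← Complex.re_add_im w]
          simp only [Complex.real_smul]
          ring
        rw [h1, hw, mul_assoc, ← Complex.exp_add]
        simp
      have hre : |w.re| ≤ 1 := (Complex.abs_re_le_norm w).trans hwn.le
      have him : |w.im| ≤ 1 := (Complex.abs_im_le_norm w).trans hwn.le
      rw [pd, e, map_add, map_smul, map_smul, d1, d2, smul_eq_mul, smul_eq_mul]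
      refine (abs_add_le _ _).trans (add_le_add ?_ ?_)
      · rw [abs_mul, abs_mul]
        calc |w.re| * (|deriv ψ r| * |a θ|) ≤ 1 * (C * A) := by
              gcongr
              · exact h1 r
              · exact hA θ
          _ = C * A := one_mul _
      · rw [mul_div_right_comm, abs_mul, abs_mul]
        calc |w.im| * (|ψ r / r| * |a' θ|) ≤ 1 * (C * A) := by
              gcongr
              · exact h2 r
              · exact hA' θ
          _ = C * A := one_mul _
    · rw [(polarFun_eventually_zero hm).pd_eq]
      simp only [pd, fderiv_fun_const, Pi.zero_apply, zero_apply, abs_zero]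
      positivity

/-- Radially the function lives in a compact part of (0, ρ). In the closed sector the condition |ψa|
≥ ε is closed and excludes the two edges, where `a` vanishes. -/
theorem IsPolarSector.polarFun_vanishing (h : IsPolarSector ω P T ρ κ)
    (hψ : ContDiff ℝ (⊤ : ℕ∞) ψ) (hc : HasCompactSupport ψ) (hs : tsupport ψ ⊆ Ioo 0 ρ)
    (ha : Continuous a) (h1 : a (-κ) = 0) (h2 : a κ = 0) {ε : ℝ} (hε : 0 < ε) :
    ∃ K, IsCompact K ∧ K ⊆ ω ∧ ∀ x ∈ ω, ε < |polarFun P T ψ a x| → x ∈ K := by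
  have hcl : IsClosed {p : ℝ × ℝ | ε ≤ |ψ p.1 * a p.2|} :=
    isClosed_le continuous_const (by
      have := hψ.continuous
      fun_prop)
  refine ⟨polarMap P T '' ((tsupport ψ ×ˢ Icc (-κ) κ) ∩ {p : ℝ × ℝ | ε ≤ |ψ p.1 * a p.2|}),
    ((hc.isCompact.prod isCompact_Icc).inter_right hcl).image continuous_polarMap, ?_, ?_⟩
  · rintro _ ⟨⟨r, θ⟩, ⟨⟨hr, hθ⟩, hp⟩, rfl⟩
    have hr' := hs hr
    refine (h.mem_iff r θ hr'.1 hr'.2 ?_).2 ?_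
    · exact (abs_le.2 hθ).trans h.angle_lt.le
    · refine lt_of_le_of_ne (abs_le.2 hθ) fun he => ?_
      have : a θ = 0 := by
        rcases (abs_eq h.angle_pos.le).1 he with rfl | rfl <;> assumption
      simp only [mem_ofPred_eq, this, mul_zero, abs_zero] at hp
      linarith
  · intro x hx hlt
    have hm : dist x P ∈ tsupport ψ := by
      by_contra hm
      rw [(polarFun_eventually_zero hm).self_of_nhds, abs_zero] at hlt
      linarith
    obtain ⟨θ, hθ, he⟩ := h.exists_polar hx (hs hm).1 (hs hm).2
    rw [← he, polarFun_polarMap (hs hm).1 (Ioo_subset_Ioc_self (h.angle_mem hθ.le))] at hlt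
    exact ⟨(dist x P, θ), ⟨⟨hm, abs_le.1 hθ.le⟩, hlt.le⟩, he⟩

/-- The `k`-th mode of the gradient at a corner. -/
def cornerModeDensity (P : Plane) (T : ℂ ≃ₗᵢ[ℝ] Plane) (κ : ℝ) (u : Jet ω) (k : ℤ) (p : ℝ × ℝ) :
    ℝ :=
  (polarGrad P T u p).im * Real.cos (k * (Real.pi / (2 * κ)) * (p.2 + κ)) +
    (polarGrad P T u p).re * Real.sin (k * (Real.pi / (2 * κ)) * (p.2 + κ))

/-- The `k`-th mode of the gradient at a corner. -/
def cornerMode (P : Plane) (T : ℂ ≃ₗᵢ[ℝ] Plane) (κ : ℝ) (u : Jet ω) (k : ℤ) (r : ℝ) : ℝ :=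
  r * ∫ θ in Ioo (-κ) κ, cornerModeDensity P T κ u k (r, θ)

theorem measurable_cornerModeDensity (u : Jet ω) (k : ℤ) :
    Measurable (cornerModeDensity P T κ u k) := by
  unfold cornerModeDensity
  have h1 := Complex.measurable_re.comp (measurable_polarGrad (P := P) (T := T) u)
  have h2 := Complex.measurable_im.comp (measurable_polarGrad (P := P) (T := T) u)
  exact (h2.mul (by fun_prop)).add (h1.mul (by fun_prop))

theorem cornerModeDensity_sq_le (u : Jet ω) (k : ℤ) (p : ℝ × ℝ) :
    cornerModeDensity P T κ u k p ^ 2 ≤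
      (polarGrad P T u p).re ^ 2 + (polarGrad P T u p).im ^ 2 := by
  rw [cornerModeDensity]
  set x := (polarGrad P T u p).re
  set y := (polarGrad P T u p).im
  set s := Real.sin (k * (Real.pi / (2 * κ)) * (p.2 + κ))
  set c := Real.cos (k * (Real.pi / (2 * κ)) * (p.2 + κ))
  have : s ^ 2 + c ^ 2 = 1 := Real.sin_sq_add_cos_sq _
  have e : x ^ 2 + y ^ 2 = (x ^ 2 + y ^ 2) * (s ^ 2 + c ^ 2) := by rw [this, mul_one]
  rw [e]
  nlinarith [sq_nonneg (y * s - x * c)]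

theorem IsPolarSector.integrableOn_cornerModeDensity (h : IsPolarSector ω P T ρ κ)
    (hω : MeasurableSet ω) (u : Jet ω) (k : ℤ) :
    IntegrableOn (fun p : ℝ × ℝ => p.1 * cornerModeDensity P T κ u k p)
      (Ioo 0 ρ ×ˢ Ioo (-κ) κ) := by
  have h1 := h.integrableOn_polarGrad_sq hω u
  have hfin : volume (Ioo 0 ρ ×ˢ Ioo (-κ) κ) ≠ ⊤ := by
    rw [Measure.volume_eq_prod, Measure.prod_prod]
    exact ENNReal.mul_ne_top (by simp) (by simp)
  have h2 : IntegrableOn (fun _ : ℝ × ℝ => ρ) (Ioo 0 ρ ×ˢ Ioo (-κ) κ) :=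
    integrableOn_const hfin
  refine Integrable.mono' (h1.add h2)
    (measurable_fst.mul (measurable_cornerModeDensity u k)).aestronglyMeasurable ?_
  filter_upwards [ae_restrict_mem measurableSet_rect] with p hp
  have hp1 := hp.1.1
  have hp2 := hp.1.2
  have h3 := cornerModeDensity_sq_le (P := P) (T := T) (κ := κ) u k p
  set y := cornerModeDensity P T κ u k p
  rw [Real.norm_eq_abs, abs_mul, abs_of_pos hp1]
  simp only [Pi.add_apply]
  have h4 : |y| ≤ y ^ 2 + 1 := by
    rw [← sq_abs]
    nlinarith [sq_nonneg (|y| - 1), abs_nonneg y]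
  nlinarith [mul_le_mul_of_nonneg_left h4 hp1.le, mul_le_mul_of_nonneg_left h3 hp1.le]

theorem IsPolarSector.integrableOn_cornerMode (h : IsPolarSector ω P T ρ κ)
    (hω : MeasurableSet ω) (u : Jet ω) (k : ℤ) :
    IntegrableOn (cornerMode P T κ u k) (Ioo 0 ρ) := by
  have h1 := h.integrableOn_cornerModeDensity hω u k
  rw [IntegrableOn, Measure.volume_eq_prod, ← Measure.prod_restrict] at h1
  have h2 := h1.integral_prod_left
  refine h2.congr (Eventually.of_forall fun r => ?_)
  simp only [cornerMode, integral_const_mul]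

/-- The modes of a harmonic function satisfy an ordinary differential equation. -/
theorem IsPolarSector.integral_cornerMode (h : IsPolarSector ω P T ρ κ) (hω : IsOpen ω)
    (hb : Bornology.IsBounded ω) (hu : u ∈ H10 ω ω) (hf : HasLap u f)
    (h0 : ∀ᵐ x ∂volume.restrict ω, x ∈ Metric.ball P ρ → f x = 0) (k : ℤ)
    (hψ : ContDiff ℝ (⊤ : ℕ∞) ψ) (hc : HasCompactSupport ψ) (hs : tsupport ψ ⊆ Ioo 0 ρ) :
    ∫ r, cornerMode P T κ u k r * (deriv ψ r + k * (Real.pi / (2 * κ)) * ψ r / r) = 0 := by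
  set l : ℝ := k * (Real.pi / (2 * κ)) with hl
  let s : ℝ → ℝ := fun θ => Real.sin (l * (θ + κ))
  let c : ℝ → ℝ := fun θ => Real.cos (l * (θ + κ))
  have hs1 : ContDiff ℝ (⊤ : ℕ∞) s := Real.contDiff_sin.comp (by fun_prop)
  have hc1 : ContDiff ℝ (⊤ : ℕ∞) c := Real.contDiff_cos.comp (by fun_prop)
  have hlin : ∀ θ, HasDerivAt (fun θ => l * (θ + κ)) l θ := fun θ => by
    simpa using ((hasDerivAt_id θ).add_const κ).const_mul l
  have hs2 : ∀ θ, HasDerivAt s (l * c θ) θ := fun θ =>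
    (hlin θ).sin.congr_deriv (mul_comm _ _)
  have hc2 : ∀ θ, HasDerivAt c (-(l * s θ)) θ := fun θ =>
    (hlin θ).cos.congr_deriv (by simp only [s]; ring)
  have sb : ∀ θ, |s θ| ≤ 1 + |l| := fun θ =>
    (Real.abs_sin_le_one _).trans (by linarith [abs_nonneg l])
  have cb : ∀ θ, |c θ| ≤ 1 + |l| := fun θ =>
    (Real.abs_cos_le_one _).trans (by linarith [abs_nonneg l])
  have lb : ∀ t : ℝ, |t| ≤ 1 → |l * t| ≤ 1 + |l| := fun t ht => by
    rw [abs_mul]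
    nlinarith [abs_nonneg l, abs_nonneg t]
  -- The frequency is chosen so that the sine vanishes on both edges for every integer k; so `S` is
  -- in H¹₀ and may be used in the equation. The cosine has no such boundary values.
  have sz1 : s (-κ) = 0 := by simp [s]
  have sz2 : s κ = 0 := by
    have : l * (κ + κ) = k * Real.pi := by
      have := h.angle_pos.ne'
      rw [hl]
      field_simp
      ring
    simp only [s, this, Real.sin_int_mul_pi]
  set S := polarFun P T ψ s with hS
  set G := polarFun P T ψ c with hG
  have Ssm := h.contDiffAt_polarFun hψ hs hs1
  have Gsm := h.contDiffAt_polarFun hψ hs hc1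
  obtain ⟨C, bS, bS'⟩ := h.exists_bound_pd_polarFun hψ hc hs hs1 hs2 sb
    (fun θ => lb _ (Real.abs_cos_le_one _))
  obtain ⟨C', bG, bG'⟩ := h.exists_bound_pd_polarFun hψ hc hs hc1 hc2 cb
    (fun θ => by rw [abs_neg]; exact lb _ (Real.abs_sin_le_one _))
  have SH := jet_mem_H10_of_vanishing hω hb Ssm bS bS' fun ε hε =>
    h.polarFun_vanishing hψ hc hs hs1.continuous sz1 sz2 hε
  have off : ∀ {a : ℝ → ℝ} {x : Plane}, x ∉ Metric.ball P ρ →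
      polarFun P T ψ a =ᶠ[𝓝 x] fun _ => 0 := fun {a x} hx =>
    polarFun_eventually_zero fun hm => hx (hs hm).2
  obtain ⟨i1, I1⟩ := integral_fderiv_gradVec hω hb Ssm bS' u
  replace I1 : ∫ x in ω, fderiv ℝ S x (gradVec u x) = 0 := by
    have := hf.inner_eq SH
    simp only [jet_some, jet_none] at this
    rw [I1, this, inner_toL2_right _ (memLp_of_bound hω hb Ssm bS), neg_eq_zero]
    refine integral_eq_zero_of_ae ?_
    filter_upwards [h0] with x hx
    by_cases hm : x ∈ Metric.ball P ρ
    · simp [hx hm]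
    · have : polarFun P T ψ s x = 0 := (off hm).self_of_nhds
      simp [this]
  -- For the cosine function, the zero boundary values of `u` do the work instead, through the
  -- orthogonality of gradients and rotated gradients.
  obtain ⟨i2, I2⟩ := integral_fderiv_rot_gradVec hω hb T Gsm bG' hu
  have I : ∫ x in ω ∩ Metric.ball P ρ,
      (fderiv ℝ S x (gradVec u x) - fderiv ℝ G x (rot T (gradVec u x))) = 0 := by
    rw [← setIntegral_eq_of_subset_of_forall_sdiff_eq_zero hω.measurableSet inter_subset_left,
      integral_sub i1 i2, I1, I2, sub_zero]
    intro x hx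
    have hm : x ∉ Metric.ball P ρ := fun hm => hx.2 ⟨hx.1, hm⟩
    rw [(off (a := s) hm).fderiv_eq, (off (a := c) hm).fderiv_eq]
    simp
  rw [h.setIntegral_eq hω.measurableSet] at I
  let B : ℝ → ℝ := fun r => deriv ψ r + l * ψ r / r
  -- In polar components the difference of the two integrands factors into the mode density and ψ' +
  -- λψ/r; both orthogonality relations are needed for this.
  have key : ∫ p in Ioo 0 ρ ×ˢ Ioo (-κ) κ, p.1 * cornerModeDensity P T κ u k p * B p.1 = 0 := by
    refine Eq.trans ?_ I
    refine setIntegral_congr_fun measurableSet_rect fun p hp => ?_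
    have hθ := h.angle_mem (abs_le.2 ⟨hp.2.1.le, hp.2.2.le⟩)
    obtain ⟨d1, d2⟩ := fderiv_polarFun (P := P) (T := T) hψ hs1 hs2 hp.1.1 hθ
    obtain ⟨d3, d4⟩ := fderiv_polarFun (P := P) (T := T) hψ hc1 hc2 hp.1.1 hθ
    have hr : ∀ x y θ : ℝ, rot T (x • T (Complex.exp (θ * Complex.I)) +
        y • T (Complex.I * Complex.exp (θ * Complex.I))) =
        x • T (Complex.I * Complex.exp (θ * Complex.I)) - y • T (Complex.exp (θ * Complex.I)) := by
      intro x y θ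
      rw [rot, ← map_smul, ← map_smul, ← map_smul, ← map_smul, ← map_add, ← map_sub,
        T.symm_apply_apply]
      congr 1
      simp only [Complex.real_smul]
      linear_combination (y : ℂ) * Complex.exp (θ * Complex.I) * Complex.I_mul_I
    obtain ⟨r, θ⟩ := p
    simp only at d1 d2 d3 d4 ⊢
    rw [gradVec_eq, hr, map_add, map_sub, map_smul, map_smul, map_smul, map_smul, d1, d2, d3, d4]
    simp only [smul_eq_mul, cornerModeDensity, ← hl, s, c, B]
    ring
  obtain ⟨D, D0, D1, D2, D3⟩ := exists_bound_div hψ hc hs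
  have Bm : Measurable B := ((hψ.continuous_deriv (by simp)).measurable).add
    ((hψ.continuous.measurable.const_mul l).div measurable_id)
  have Bb : ∀ r, ‖B r‖ ≤ D + |l| * D := fun r => by
    refine (norm_add_le _ _).trans (add_le_add (D2 r) ?_)
    rw [mul_div_assoc, norm_mul]
    exact mul_le_mul_of_nonneg_left (D3 r) (abs_nonneg l)
  have ki : IntegrableOn (fun p : ℝ × ℝ => p.1 * cornerModeDensity P T κ u k p * B p.1)
      (Ioo 0 ρ ×ˢ Ioo (-κ) κ) :=
    Integrable.mul_bdd (c := D + |l| * D) (h.integrableOn_cornerModeDensity hω.measurableSet u k)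
      (Bm.comp measurable_fst).aestronglyMeasurable (Eventually.of_forall fun p => Bb p.1)
  rw [Measure.volume_eq_prod] at key ki
  rw [setIntegral_prod _ ki] at key
  rw [← key, ← setIntegral_eq_integral_of_forall_compl_eq_zero (s := Ioo 0 ρ)]
  · refine setIntegral_congr_fun measurableSet_Ioo fun r _ => ?_
    simp only [cornerMode, integral_mul_const, integral_const_mul, B]
  · intro r hr
    have hr1 : r ∉ tsupport ψ := fun hh => hr (hs hh)
    have z1 : deriv ψ r = 0 :=
      image_eq_zero_of_notMem_tsupport fun hh => hr1 (tsupport_deriv_subset hh)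
    rw [z1, image_eq_zero_of_notMem_tsupport hr1]
    simp

/-- The modes of a harmonic function are powers of the distance to the corner. -/
theorem IsPolarSector.exists_cornerMode_eq (h : IsPolarSector ω P T ρ κ) (hω : IsOpen ω)
    (hb : Bornology.IsBounded ω) (hu : u ∈ H10 ω ω) (hf : HasLap u f)
    (h0 : ∀ᵐ x ∂volume.restrict ω, x ∈ Metric.ball P ρ → f x = 0) (k : ℤ) :
    ∃ C, ∀ᵐ r, r ∈ Ioo 0 ρ → cornerMode P T κ u k r = C * r ^ (k * (Real.pi / (2 * κ))) :=
  exists_ae_eq_rpow h.pos (h.integrableOn_cornerMode hω.measurableSet u k).locallyIntegrableOn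
    fun _ h1 h2 h3 => h.integral_cornerMode hω hb hu hf h0 k h1 h2 h3

end modes

/-! ### Decay of the energy at a corner -/

section decay

variable {ω : Set Plane} {P : Plane} {ρ κ : ℝ} {T : ℂ ≃ₗᵢ[ℝ] Plane} {u v : Jet ω} {f g : L2 ω}

/-- The energy density on a circle around the corner, times the square of the radius. -/
def circleEnergy (P : Plane) (T : ℂ ≃ₗᵢ[ℝ] Plane) (κ : ℝ) (u : Jet ω) (r : ℝ) : ℝ :=
  r ^ 2 * ∫ θ in Ioo (-κ) κ, ((polarGrad P T u (r, θ)).re ^ 2 + (polarGrad P T u (r, θ)).im ^ 2)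

theorem IsPolarSector.ballEnergy_eq_circleEnergy (h : IsPolarSector ω P T ρ κ)
    (hω : MeasurableSet ω) (u : Jet ω) :
    ballEnergy u P ρ = ∫ r in Ioo 0 ρ, circleEnergy P T κ u r / r := by
  rw [h.ballEnergy_eq hω]
  refine setIntegral_congr_fun measurableSet_Ioo fun r hr => ?_
  have := hr.1.ne'
  simp only [circleEnergy]
  field_simp

theorem IsPolarSector.integrableOn_circleEnergy (h : IsPolarSector ω P T ρ κ)
    (hω : MeasurableSet ω) (u : Jet ω) :
    IntegrableOn (fun r => circleEnergy P T κ u r / r) (Ioo 0 ρ) := by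
  have h1 := h.integrableOn_polarGrad_sq hω u
  rw [IntegrableOn, Measure.volume_eq_prod, ← Measure.prod_restrict] at h1
  refine h1.integral_prod_left.congr ?_
  filter_upwards [ae_restrict_mem measurableSet_Ioo] with r hr
  have := hr.1.ne'
  simp only [circleEnergy, integral_const_mul]
  field_simp

/-- On almost every circle, the gradient is square integrable. -/
theorem IsPolarSector.ae_memLp (h : IsPolarSector ω P T ρ κ) (hω : MeasurableSet ω) (u : Jet ω) :
    ∀ᵐ r, r ∈ Ioo 0 ρ →
      MemLp (fun θ => (polarGrad P T u (r, θ)).re) 2 (volume.restrict (Ioo (-κ) κ)) ∧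
      MemLp (fun θ => (polarGrad P T u (r, θ)).im) 2 (volume.restrict (Ioo (-κ) κ)) := by
  have h1 := h.integrableOn_polarGrad_sq hω u
  rw [IntegrableOn, Measure.volume_eq_prod, ← Measure.prod_restrict] at h1
  have h2 := h1.prod_right_ae
  rw [ae_restrict_iff' measurableSet_Ioo] at h2
  filter_upwards [h2] with r hr hm
  have h3 := (hr hm).const_mul r⁻¹
  simp only [← mul_assoc, inv_mul_cancel₀ hm.1.ne', one_mul] at h3
  have hmeas : Measurable fun θ => polarGrad P T u (r, θ) :=
    (measurable_polarGrad u).comp measurable_prodMk_left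
  have m1 : Measurable fun θ => (polarGrad P T u (r, θ)).re := Complex.measurable_re.comp hmeas
  have m2 : Measurable fun θ => (polarGrad P T u (r, θ)).im := Complex.measurable_im.comp hmeas
  constructor
  · rw [memLp_two_iff_integrable_sq m1.aestronglyMeasurable]
    refine h3.mono' (m1.pow_const 2).aestronglyMeasurable (Eventually.of_forall fun θ => ?_)
    rw [Real.norm_of_nonneg (sq_nonneg _)]
    exact le_add_of_nonneg_right (sq_nonneg _)
  · rw [memLp_two_iff_integrable_sq m2.aestronglyMeasurable]
    refine h3.mono' (m2.pow_const 2).aestronglyMeasurable (Eventually.of_forall fun θ => ?_)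
    rw [Real.norm_of_nonneg (sq_nonneg _)]
    exact le_add_of_nonneg_left (sq_nonneg _)

/-- Parseval on a circle, with the radial derivative as sine part and the angular derivative as
cosine part. The merged coefficients, indexed by all integers, capture the whole gradient. -/
theorem IsPolarSector.ae_hasSum_cornerMode (h : IsPolarSector ω P T ρ κ) (hω : MeasurableSet ω)
    (u : Jet ω) : ∀ᵐ r, r ∈ Ioo 0 ρ →
      HasSum (fun k : ℤ => cornerMode P T κ u k r ^ 2) (2 * κ * circleEnergy P T κ u r) := by
  filter_upwards [h.ae_memLp hω u] with r hr hm
  have h1 := (hasSum_sq_integral_cos_add_sin h.angle_pos (hr hm).1 (hr hm).2).mul_left (r ^ 2)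
  simp only [cornerMode, circleEnergy, cornerModeDensity, mul_pow]
  rw [show ∀ a b c : ℝ, a * (b * c) = b * (a * c) from fun a b c => by ring]
  exact h1

/-- The coefficients of the modes; those of nonpositive order vanish. -/
theorem IsPolarSector.exists_coeff (h : IsPolarSector ω P T ρ κ) (hω : IsOpen ω)
    (hb : Bornology.IsBounded ω) (hu : u ∈ H10 ω ω) (hf : HasLap u f)
    (h0 : ∀ᵐ x ∂volume.restrict ω, x ∈ Metric.ball P ρ → f x = 0) :
    ∃ C : ℤ → ℝ, (∀ k, ∀ᵐ r, r ∈ Ioo 0 ρ →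
        cornerMode P T κ u k r = C k * r ^ (k * (Real.pi / (2 * κ)))) ∧
      (∀ k ≤ 0, C k = 0) ∧
      ∀ᵐ r, r ∈ Ioo 0 ρ → HasSum (fun k : ℤ => C k ^ 2 * r ^ (2 * (k * (Real.pi / (2 * κ)))))
        (2 * κ * circleEnergy P T κ u r) := by
  choose C hC using h.exists_cornerMode_eq hω hb hu hf h0
  have hsum : ∀ᵐ r, r ∈ Ioo 0 ρ →
      HasSum (fun k : ℤ => C k ^ 2 * r ^ (2 * (k * (Real.pi / (2 * κ)))))
        (2 * κ * circleEnergy P T κ u r) := by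
    filter_upwards [ae_all_iff.2 hC, h.ae_hasSum_cornerMode hω.measurableSet u] with r h1 h2 hr
    refine (h2 hr).congr_fun fun k => ?_
    rw [h1 k hr, mul_pow, ← Real.rpow_natCast (r ^ _) 2, ← Real.rpow_mul hr.1.le, mul_comm 2]
    simp
  refine ⟨C, hC, fun k hk => ?_, hsum⟩
  by_contra hne
  -- A single mode is dominated by the energy, so a nonzero coefficient would make r^{2λ-1}
  -- integrable at 0, which forces λ > 0.
  have hi : IntegrableOn (fun r : ℝ => r ^ (2 * (k * (Real.pi / (2 * κ))) - 1)) (Ioo 0 ρ) := by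
    have h1 := ((h.integrableOn_circleEnergy hω.measurableSet u).const_mul (2 * κ)).const_mul
      ((C k ^ 2)⁻¹)
    refine Integrable.mono' h1 (Measurable.aestronglyMeasurable (by fun_prop)) ?_
    rw [ae_restrict_iff' measurableSet_Ioo]
    filter_upwards [hsum] with r hr hm
    have h2 := le_hasSum (hr hm) k fun j _ => by
      have := hm.1
      positivity
    have hC2 : 0 < C k ^ 2 := by positivity
    rw [Real.norm_of_nonneg (Real.rpow_nonneg hm.1.le _), Real.rpow_sub_one hm.1.ne',
      le_inv_mul_iff₀ hC2]
    calc C k ^ 2 * (r ^ (2 * (k * (Real.pi / (2 * κ)))) / r)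
        = C k ^ 2 * r ^ (2 * (k * (Real.pi / (2 * κ)))) / r := by ring
      _ ≤ 2 * κ * circleEnergy P T κ u r / r := div_le_div_of_nonneg_right h2 hm.1.le
      _ = _ := by ring
  rw [intervalIntegral.integrableOn_Ioo_rpow_iff h.pos] at hi
  have h3 : (k : ℝ) * (Real.pi / (2 * κ)) ≤ 0 := by
    have : (k : ℝ) ≤ 0 := by exact_mod_cast hk
    have := h.angle_pos
    exact mul_nonpos_of_nonpos_of_nonneg ‹_› (by positivity)
  linarith

theorem ae_neBot_Ioo (hρ : 0 < ρ) : (ae (volume.restrict (Ioo 0 ρ))).NeBot := by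
  rw [ae_neBot]
  intro h0
  have := congrArg (fun μ => μ univ) h0
  simp at this
  linarith

/-- The energy decays like the first mode that is present. -/
theorem IsPolarSector.tendsto_ballEnergy (h : IsPolarSector ω P T ρ κ) (hω : MeasurableSet ω)
    {C : ℤ → ℝ} {m : ℤ} (hm : 1 < m * (Real.pi / (2 * κ))) (hC : ∀ k < m, C k = 0)
    (hsum : ∀ᵐ r, r ∈ Ioo 0 ρ → HasSum (fun k : ℤ => C k ^ 2 * r ^ (2 * (k * (Real.pi / (2 * κ)))))
        (2 * κ * circleEnergy P T κ u r)) :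
    Tendsto (fun ρ => ballEnergy u P ρ / ρ ^ 2) (𝓝[>] 0) (𝓝 0) := by
  set β := Real.pi / (2 * κ) with hβ
  have hβ0 : 0 < β := by
    have := h.angle_pos
    positivity
  set γ := 2 * (m * β) with hγ
  have hγ2 : 2 < γ := by linarith
  -- One radius at which the series converges suffices: for k ≥ m and r < ρ1, each term at r is at
  -- most (r/ρ1)^γ times the term at ρ1, with γ = 2λ_m.
  obtain ⟨ρ1, hρ1, hs1⟩ : ∃ ρ1, ρ1 ∈ Ioo 0 ρ ∧
      HasSum (fun k : ℤ => C k ^ 2 * ρ1 ^ (2 * (k * β))) (2 * κ * circleEnergy P T κ u ρ1) := by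
    have hne := ae_neBot_Ioo h.pos
    obtain ⟨r, h1, h2⟩ := (((ae_restrict_iff' measurableSet_Ioo).2 hsum).and
      (ae_restrict_mem measurableSet_Ioo)).exists
    exact ⟨r, h2, h1⟩
  have hle : ∀ᵐ r, r ∈ Ioo 0 ρ1 →
      circleEnergy P T κ u r ≤ (r / ρ1) ^ γ * circleEnergy P T κ u ρ1 := by
    filter_upwards [hsum] with r hr hrm
    have hrp := hrm.1
    have h1 := hr ⟨hrm.1, hrm.2.trans hρ1.2⟩
    have h2 := hs1.mul_left ((r / ρ1) ^ γ)
    have h3 := hasSum_le (fun k => ?_) h1 h2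
    · have := h.angle_pos
      nlinarith
    · by_cases hk : k < m
      · simp [hC k hk]
      · have hkm : (m : ℝ) ≤ k := by exact_mod_cast not_lt.1 hk
        have h4 : r ^ (2 * (k * β)) = (r / ρ1) ^ (2 * (k * β)) * ρ1 ^ (2 * (k * β)) := by
          rw [← Real.mul_rpow (div_nonneg hrp.le hρ1.1.le) hρ1.1.le, div_mul_cancel₀ _ hρ1.1.ne']
        have h5 : (r / ρ1) ^ (2 * (k * β)) ≤ (r / ρ1) ^ γ :=
          Real.rpow_le_rpow_of_exponent_ge (div_pos hrp hρ1.1)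
            ((div_le_one hρ1.1).2 hrm.2.le) (by
              rw [hγ]
              have := mul_le_mul_of_nonneg_right hkm hβ0.le
              linarith)
        rw [h4]
        have h6 : 0 ≤ C k ^ 2 * ρ1 ^ (2 * (k * β)) :=
          mul_nonneg (sq_nonneg _) (Real.rpow_nonneg hρ1.1.le _)
        nlinarith
  set M := circleEnergy P T κ u ρ1 / ρ1 ^ γ with hM
  have hbound : ∀ ρ' ∈ Ioo 0 ρ1, ballEnergy u P ρ' ≤ M / γ * ρ' ^ γ := by
    intro ρ' hρ'
    have hs := h.mono hρ'.1 (hρ'.2.le.trans hρ1.2.le)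
    rw [hs.ballEnergy_eq_circleEnergy hω]
    have hint : IntegrableOn (fun r : ℝ => M * r ^ (γ - 1)) (Ioo 0 ρ') :=
      ((intervalIntegral.integrableOn_Ioo_rpow_iff hρ'.1).2 (by linarith)).const_mul M
    calc ∫ r in Ioo 0 ρ', circleEnergy P T κ u r / r ≤ ∫ r in Ioo 0 ρ', M * r ^ (γ - 1) := by
          refine integral_mono_ae (hs.integrableOn_circleEnergy hω u) hint ?_
          refine (ae_restrict_iff' measurableSet_Ioo).2 ?_
          filter_upwards [hle] with r hr hrm
          rw [Real.rpow_sub_one hrm.1.ne', ← mul_div_assoc]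
          refine div_le_div_of_nonneg_right ?_ hrm.1.le
          refine (hr ⟨hrm.1, hrm.2.trans hρ'.2⟩).trans (le_of_eq ?_)
          rw [Real.div_rpow hrm.1.le hρ1.1.le, hM]
          ring
      _ = M / γ * ρ' ^ γ := by
          rw [← integral_Ioc_eq_integral_Ioo, ← intervalIntegral.integral_of_le hρ'.1.le,
            intervalIntegral.integral_const_mul, integral_rpow (Or.inl (by linarith)),
            sub_add_cancel, Real.zero_rpow (by linarith)]
          ring
  -- The condition λ_m > 1 is used here as γ > 2.
  have hlim : Tendsto (fun ρ' : ℝ => M / γ * ρ' ^ (γ - 2)) (𝓝[>] 0) (𝓝 0) := by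
    have h1 : Tendsto (fun ρ' : ℝ => ρ' ^ (γ - 2)) (𝓝[>] 0) (𝓝 0) := by
      have := (Real.continuousAt_rpow_const 0 (γ - 2) (Or.inr (by linarith))).tendsto
      rw [Real.zero_rpow (by linarith)] at this
      exact this.mono_left nhdsWithin_le_nhds
    simpa using h1.const_mul (M / γ)
  refine tendsto_of_tendsto_of_tendsto_of_le_of_le' tendsto_const_nhds hlim ?_ ?_
  · refine Eventually.of_forall fun ρ' => div_nonneg ?_ (sq_nonneg _)
    exact Finset.sum_nonneg fun i _ => integral_nonneg fun _ => sq_nonneg _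
  · filter_upwards [Ioo_mem_nhdsGT hρ1.1] with ρ' hρ'
    rw [div_le_iff₀ (by have := hρ'.1; positivity), mul_assoc, ← Real.rpow_natCast ρ' 2,
      ← Real.rpow_add hρ'.1]
    simpa using hbound ρ' hρ'

/-! ### The Poincaré inequality in a sector -/

/-- The integral is the squared norm of the image under restriction, a bounded operator. -/
theorem continuous_setIntegral_sq {B : Set Plane} (hB : MeasurableSet B) :
    Continuous fun v : L2 ω => ∫ x in ω ∩ B, v x ^ 2 := by
  have e : ∀ v : L2 ω, ∫ x in ω ∩ B, v x ^ 2 =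
      inner ℝ (LpToLpRestrictCLM Plane ℝ ℝ (volume.restrict ω) 2 B v)
        (LpToLpRestrictCLM Plane ℝ ℝ (volume.restrict ω) 2 B v) := fun v => by
    rw [L2.inner_def, inter_comm, ← Measure.restrict_restrict hB]
    refine integral_congr_ae ?_
    filter_upwards [LpToLpRestrictCLM_coeFn ℝ B v] with x hx
    rw [hx]
    simp [sq]
  simp only [e]
  have hc := (LpToLpRestrictCLM Plane ℝ ℝ (volume.restrict ω) 2 B).continuous
  exact hc.inner hc

theorem continuous_ballEnergy : Continuous fun u : Jet ω => ballEnergy u P ρ :=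
  continuous_finsetSum _ fun _ _ =>
    (continuous_setIntegral_sq Metric.isOpen_ball.measurableSet).comp (Jet.continuous_apply _)

theorem sq_fderiv_le (φ : Plane → ℝ) (x w : Plane) (hw : ‖w‖ = 1) :
    (fderiv ℝ φ x w) ^ 2 ≤ ∑ i : Fin 2, pd i φ x ^ 2 := by
  have hw2 : w 0 ^ 2 + w 1 ^ 2 = 1 := by
    have := EuclideanSpace.norm_sq_eq w
    rw [hw, Fin.sum_univ_two] at this
    simpa using this.symm
  have e : w = w 0 • stdVec 0 + w 1 • stdVec 1 := by
    ext i
    fin_cases i <;> simp [stdVec]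
  rw [e, map_add, map_smul, map_smul, Fin.sum_univ_two]
  simp only [smul_eq_mul]
  change (w 0 * pd 0 φ x + w 1 * pd 1 φ x) ^ 2 ≤ _
  have : pd 0 φ x ^ 2 + pd 1 φ x ^ 2 =
      (w 0 ^ 2 + w 1 ^ 2) * (pd 0 φ x ^ 2 + pd 1 φ x ^ 2) := by rw [hw2, one_mul]
  rw [this]
  nlinarith [sq_nonneg (w 0 * pd 1 φ x - w 1 * pd 0 φ x)]

/-- A test function vanishes at both ends of each arc, so the one-dimensional inequality applies in
θ. The θ-derivative is r times a unit directional derivative, whence the factor ρ². -/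
theorem IsPolarSector.poincare (h : IsPolarSector ω P T ρ κ) (hω : MeasurableSet ω)
    (hu : u ∈ H10 ω ω) : ∫ x in ω ∩ Metric.ball P ρ, u none x ^ 2 ≤
      4 * κ ^ 2 * ρ ^ 2 * ballEnergy u P ρ := by
  have hBm : MeasurableSet (Metric.ball P ρ) := Metric.isOpen_ball.measurableSet
  refine H10.induction (p := fun u => ∫ x in ω ∩ Metric.ball P ρ, u none x ^ 2 ≤
      4 * κ ^ 2 * ρ ^ 2 * ballEnergy u P ρ) (isClosed_le ?_ ?_) (fun φ hφ => ?_) hu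
  · exact (continuous_setIntegral_sq hBm).comp (Jet.continuous_apply _)
  · exact continuous_const.mul continuous_ballEnergy
  have e1 : ∫ x in ω ∩ Metric.ball P ρ, jet ω φ none x ^ 2 =
      ∫ x in ω ∩ Metric.ball P ρ, φ x ^ 2 := by
    refine integral_congr_ae (ae_mono (Measure.restrict_mono inter_subset_left le_rfl) ?_)
    filter_upwards [coeFn_toL2 (hφ.memLp ω 2)] with x hx
    rw [jet_none, hx]
  have int : ∀ i : Fin 2, Integrable (fun x => pd i φ x ^ 2)
      (volume.restrict (ω ∩ Metric.ball P ρ)) := fun i => by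
    have := ((hφ.pd i).mul_smooth (hφ.pd i).smooth).integrable (ω ∩ Metric.ball P ρ)
    simpa only [← sq] using this
  have e2 : ballEnergy (jet ω φ) P ρ = ∫ x in ω ∩ Metric.ball P ρ, ∑ i, pd i φ x ^ 2 := by
    rw [ballEnergy, integral_finsetSum _ fun i _ => int i]
    refine Finset.sum_congr rfl fun i _ => integral_congr_ae
      (ae_mono (Measure.restrict_mono inter_subset_left le_rfl) ?_)
    filter_upwards [coeFn_toL2 ((hφ.pd i).memLp ω 2)] with x hx
    rw [jet_some, hx]
  have cpd : ∀ i, Continuous (pd i φ) := fun i => (hφ.pd i).continuous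
  have cφ := hφ.continuous
  have cΦ : Continuous (polarMap P T) := continuous_polarMap
  have inti : ∀ {F : ℝ × ℝ → ℝ}, Continuous F → IntegrableOn F (Ioo 0 ρ ×ˢ Ioo (-κ) κ)
      (volume.prod volume) := fun hF =>
    (hF.continuousOn.integrableOn_compact (isCompact_Icc.prod isCompact_Icc)).mono_set
      (prod_mono Ioo_subset_Icc_self Ioo_subset_Icc_self)
  have c1 : Continuous fun p : ℝ × ℝ => p.1 * φ (polarMap P T p) ^ 2 := by fun_prop
  have c2 : Continuous fun p : ℝ × ℝ => p.1 * ∑ i, pd i φ (polarMap P T p) ^ 2 := by fun_prop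
  rw [e1, e2, h.setIntegral_eq hω, h.setIntegral_eq hω, Measure.volume_eq_prod,
    setIntegral_prod _ (inti c1), setIntegral_prod _ (inti c2), ← integral_const_mul]
  have i1 := inti c1
  have i2 := inti c2
  rw [IntegrableOn, ← Measure.prod_restrict] at i1 i2
  refine setIntegral_mono_on i1.integral_prod_left (i2.integral_prod_left.const_mul _)
    measurableSet_Ioo fun r hr => ?_
  simp only [integral_const_mul]
  have hd : ∀ θ, HasDerivAt (fun t => φ (polarMap P T (r, t)))
      (r * fderiv ℝ φ (polarMap P T (r, θ)) (T (Complex.I * Complex.exp (θ * Complex.I)))) θ := by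
    intro θ
    have h1 := HasFDerivAt.comp_hasDerivAt (f := fun t => polarMap P T (r, t)) θ
      (hφ.differentiable (polarMap P T (r, θ))).hasFDerivAt (hasDerivAt_polarMap_snd r θ)
    rw [map_smul, smul_eq_mul] at h1
    exact h1
  have hdc : Continuous fun θ : ℝ => r * fderiv ℝ φ (polarMap P T (r, θ))
      (T (Complex.I * Complex.exp (θ * Complex.I))) := by
    have h1 : Continuous (fderiv ℝ φ) := hφ.smooth.continuous_fderiv (by simp)
    have h2 : Continuous fun θ : ℝ => fderiv ℝ φ (polarMap P T (r, θ)) := by fun_prop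
    exact continuous_const.mul (h2.clm_apply (by fun_prop))
  have hz : ∀ θ, |θ| = κ → φ (polarMap P T (r, θ)) = 0 := fun θ hθ => by
    refine hφ.eq_zero_of_notMem fun hm => ?_
    have := (h.mem_iff r θ hr.1 hr.2 (hθ.le.trans h.angle_lt.le)).1 hm
    linarith
  have h1 := integral_sq_le_of_eq_zero h.angle_pos hd hdc
    (hz _ (by rw [abs_neg, abs_of_pos h.angle_pos])) (hz _ (abs_of_pos h.angle_pos))
  have ii : ∀ {F : ℝ → ℝ}, Continuous F → IntegrableOn F (Ioo (-κ) κ) := fun hF =>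
    (hF.continuousOn.integrableOn_compact isCompact_Icc).mono_set Ioo_subset_Icc_self
  have h2 : ∫ θ in Ioo (-κ) κ, (r * fderiv ℝ φ (polarMap P T (r, θ))
      (T (Complex.I * Complex.exp (θ * Complex.I)))) ^ 2 ≤
      ∫ θ in Ioo (-κ) κ, ρ ^ 2 * ∑ i, pd i φ (polarMap P T (r, θ)) ^ 2 := by
    refine setIntegral_mono (ii (by fun_prop)) (ii (by fun_prop)) fun θ => ?_
    simp only
    rw [mul_pow]
    refine mul_le_mul (pow_le_pow_left₀ hr.1.le hr.2.le 2) (sq_fderiv_le _ _ _ ?_) (sq_nonneg _)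
      (sq_nonneg _)
    rw [T.norm_map, norm_mul, Complex.norm_I, Complex.norm_exp_ofReal_mul_I, one_mul]
  rw [integral_const_mul] at h2
  have h3 : (0 : ℝ) ≤ 4 * κ ^ 2 := by positivity
  calc r * ∫ θ in Ioo (-κ) κ, φ (polarMap P T (r, θ)) ^ 2
      ≤ r * (4 * κ ^ 2 * (ρ ^ 2 * ∫ θ in Ioo (-κ) κ, ∑ i, pd i φ (polarMap P T (r, θ)) ^ 2)) :=
        mul_le_mul_of_nonneg_left (h1.trans (mul_le_mul_of_nonneg_left h2 h3)) hr.1.le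
    _ = _ := by ring

theorem IsPolarSector.cornerDecay (h : IsPolarSector ω P T ρ κ) (hω : IsOpen ω)
    (hu : u ∈ H10 ω ω)
    (h0 : ∀ᵐ x ∂volume.restrict ω, x ∈ Metric.ball P ρ → f x = 0)
    {C : ℤ → ℝ} {m : ℤ} (hm : 1 < m * (Real.pi / (2 * κ))) (hC : ∀ k < m, C k = 0)
    (hsum : ∀ᵐ r, r ∈ Ioo 0 ρ → HasSum (fun k : ℤ => C k ^ 2 * r ^ (2 * (k * (Real.pi / (2 * κ)))))
        (2 * κ * circleEnergy P T κ u r)) : CornerDecay u f P where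
  energy := h.tendsto_ballEnergy hω.measurableSet hm hC hsum
  poincare := by
    refine ⟨4 * κ ^ 2, ?_⟩
    filter_upwards [Ioo_mem_nhdsGT h.pos] with ρ' hρ'
    exact (h.mono hρ'.1 hρ'.2.le).poincare hω.measurableSet hu
  vanish := by
    filter_upwards [Ioo_mem_nhdsGT h.pos] with ρ' hρ'
    filter_upwards [h0] with x hx hm using hx (Metric.ball_subset_ball hρ'.2.le hm)

end decay

/-! ### The coefficient of the singular mode -/

section singular

variable {ω : Set Plane} {P : Plane} {ρ κ : ℝ} {T : ℂ ≃ₗᵢ[ℝ] Plane} {u v : Jet ω} {f g : L2 ω}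

/-- In the rectangle the Jacobian r is positive, so null sets of the plane pull back to null sets.
-/
theorem IsPolarSector.ae_polarMap (h : IsPolarSector ω P T ρ κ) (hω : MeasurableSet ω)
    {Q : Plane → Prop} (hQ : ∀ᵐ x ∂volume.restrict ω, Q x) :
    ∀ᵐ p ∂(volume.restrict (Ioo 0 ρ ×ˢ Ioo (-κ) κ)), Q (polarMap P T p) := by
  obtain ⟨N, hN, hNm, hN0⟩ := exists_measurable_superset_of_null (ae_iff.1 hQ)
  have hN1 : ∫⁻ x in ω ∩ Metric.ball P ρ, N.indicator (fun _ => 1) x = 0 := by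
    rw [lintegral_indicator hNm, setLIntegral_const, one_mul]
    exact nonpos_iff_eq_zero.1 ((Measure.restrict_mono inter_subset_left le_rfl N).trans_eq hN0)
  rw [h.setLIntegral_eq hω, lintegral_eq_zero_iff'] at hN1
  · filter_upwards [hN1, ae_restrict_mem measurableSet_rect] with p hp hpm
    by_contra hq
    have : polarMap P T p ∈ N := hN hq
    simp only [indicator_of_mem this, mul_one, Pi.zero_apply, ENNReal.ofReal_eq_zero] at hp
    exact absurd hpm.1.1 (not_lt.2 hp)
  · refine ((ENNReal.measurable_ofReal.comp measurable_fst).mul ?_).aemeasurable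
    exact (measurable_const.indicator hNm).comp continuous_polarMap.measurable

/-- Modes are computed from representatives on circles, so linearity holds only for almost every
radius. -/
theorem IsPolarSector.cornerMode_sub_smul (h : IsPolarSector ω P T ρ κ) (hω : MeasurableSet ω)
    (u v : Jet ω) (t : ℝ) (k : ℤ) : ∀ᵐ r, r ∈ Ioo 0 ρ → cornerMode P T κ (u - t • v) k r =
      cornerMode P T κ u k r - t * cornerMode P T κ v k r := by
  have h1 : ∀ᵐ x ∂volume.restrict ω, gradVec (u - t • v) x = gradVec u x - t • gradVec v x := by
    have : ∀ i : Fin 2, ∀ᵐ x ∂volume.restrict ω,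
        (u - t • v) (some i) x = u (some i) x - t * v (some i) x := fun i => by
      filter_upwards [Lp.coeFn_sub (u (some i)) (t • v (some i)),
        Lp.coeFn_smul t (v (some i))] with x h1 h2
      rw [PiLp.sub_apply, PiLp.smul_apply, h1, Pi.sub_apply, h2, Pi.smul_apply, smul_eq_mul]
    filter_upwards [this 0, this 1] with x h0 h1
    simp only [gradVec, Fin.sum_univ_two, h0, h1]
    module
  have h2 := h.ae_polarMap hω h1
  have h3 : ∀ᵐ p ∂(volume.restrict (Ioo 0 ρ)).prod (volume.restrict (Ioo (-κ) κ)),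
      cornerModeDensity P T κ (u - t • v) k p =
        cornerModeDensity P T κ u k p - t * cornerModeDensity P T κ v k p := by
    rw [Measure.prod_restrict, ← Measure.volume_eq_prod]
    filter_upwards [h2] with p hp
    have : polarGrad P T (u - t • v) p = polarGrad P T u p - t * polarGrad P T v p := by
      rw [polarGrad, hp, map_sub, map_smul, Complex.real_smul, polarGrad, polarGrad]
      ring
    simp only [cornerModeDensity, this, Complex.sub_re, Complex.sub_im, Complex.re_ofReal_mul,
      Complex.im_ofReal_mul]
    ring
  have h4 := (ae_restrict_iff' measurableSet_Ioo).1 (Measure.ae_ae_of_ae_prod h3)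
  have hi : ∀ w : Jet ω, ∀ᵐ r, r ∈ Ioo 0 ρ →
      IntegrableOn (fun θ => cornerModeDensity P T κ w k (r, θ)) (Ioo (-κ) κ) := by
    intro w
    have h5 := h.integrableOn_cornerModeDensity hω w k
    rw [IntegrableOn, Measure.volume_eq_prod, ← Measure.prod_restrict] at h5
    have h6 := h5.prod_right_ae
    rw [ae_restrict_iff' measurableSet_Ioo] at h6
    filter_upwards [h6] with r hr hm
    have h7 := (hr hm).const_mul r⁻¹
    simp only [← mul_assoc, inv_mul_cancel₀ hm.1.ne', one_mul] at h7
    exact h7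
  filter_upwards [h4, hi u, hi v] with r h4 h5 h6 hm
  rw [cornerMode, integral_congr_ae (h4 hm), integral_sub (h5 hm) ((h6 hm).const_mul t),
    integral_const_mul, cornerMode, cornerMode]
  ring

/-- Near the corner, the first mode of `u` is `C r ^ (π / (2 κ))`. -/
def HasSingCoeff (P : Plane) (T : ℂ ≃ₗᵢ[ℝ] Plane) (κ : ℝ) (u : Jet ω) (C : ℝ) : Prop :=
  ∀ᶠ ρ in 𝓝[>] (0 : ℝ), ∀ᵐ r, r ∈ Ioo 0 ρ →
    cornerMode P T κ u 1 r = C * r ^ (Real.pi / (2 * κ))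

/-- The function `f` vanishes near the point `P`. -/
def VanishesNear (P : Plane) (f : L2 ω) : Prop :=
  ∃ ε > 0, ∀ᵐ x ∂volume.restrict ω, x ∈ Metric.ball P ε → f x = 0

theorem VanishesNear.sub_smul (hf : VanishesNear P f) (hg : VanishesNear P g) (t : ℝ) :
    VanishesNear P (f - t • g) := by
  obtain ⟨ε, hε, h1⟩ := hf
  obtain ⟨δ, hδ, h2⟩ := hg
  refine ⟨min ε δ, lt_min hε hδ, ?_⟩
  filter_upwards [h1, h2, Lp.coeFn_sub f (t • g), Lp.coeFn_smul t g] with x h1 h2 h3 h4 hm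
  rw [h3, Pi.sub_apply, h4, Pi.smul_apply, h1 (Metric.ball_subset_ball (min_le_left _ _) hm),
    h2 (Metric.ball_subset_ball (min_le_right _ _) hm)]
  simp

/-- Shrinking a sector to a region where `f` vanishes. -/
theorem IsPolarSector.exists_shrink (h : IsPolarSector ω P T ρ κ) (hf : VanishesNear P f) :
    ∃ ρ', IsPolarSector ω P T ρ' κ ∧
      ∀ᵐ x ∂volume.restrict ω, x ∈ Metric.ball P ρ' → f x = 0 := by
  obtain ⟨ε, hε, h1⟩ := hf
  refine ⟨min ρ ε, h.mono (lt_min h.pos hε) (min_le_left _ _), ?_⟩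
  filter_upwards [h1] with x hx hm using hx (Metric.ball_subset_ball (min_le_right _ _) hm)

theorem IsPolarSector.exists_hasSingCoeff (h : IsPolarSector ω P T ρ κ) (hω : IsOpen ω)
    (hb : Bornology.IsBounded ω) (hu : u ∈ H10 ω ω) (hf : HasLap u f) (h0 : VanishesNear P f) :
    ∃ C, HasSingCoeff P T κ u C := by
  obtain ⟨ρ', h', h1⟩ := h.exists_shrink h0
  obtain ⟨C, hC⟩ := h'.exists_cornerMode_eq hω hb hu hf h1 1
  refine ⟨C, ?_⟩
  filter_upwards [Ioo_mem_nhdsGT h'.pos] with r hr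
  filter_upwards [hC] with s hs hm
  simpa using hs ⟨hm.1, hm.2.trans hr.2⟩

theorem IsPolarSector.hasSingCoeff_sub_smul (h : IsPolarSector ω P T ρ κ) (hω : MeasurableSet ω)
    {C D : ℝ} (hu : HasSingCoeff P T κ u C) (hv : HasSingCoeff P T κ v D) (t : ℝ) :
    HasSingCoeff P T κ (u - t • v) (C - t * D) := by
  filter_upwards [hu, hv, Ioo_mem_nhdsGT h.pos] with r h1 h2 hr
  filter_upwards [h1, h2, h.cornerMode_sub_smul hω u v t 1] with s h1 h2 h3 hm
  rw [h3 ⟨hm.1, hm.2.trans hr.2⟩, h1 hm, h2 hm]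
  ring

/-- At a convex corner, the energy decays. -/
theorem IsPolarSector.cornerDecay_of_convex (h : IsPolarSector ω P T ρ κ) (hκ : κ < Real.pi / 2)
    (hω : IsOpen ω) (hb : Bornology.IsBounded ω) (hu : u ∈ H10 ω ω) (hf : HasLap u f)
    (h0 : VanishesNear P f) : CornerDecay u f P := by
  obtain ⟨ρ', h', h1⟩ := h.exists_shrink h0
  obtain ⟨C, -, hC, hsum⟩ := h'.exists_coeff hω hb hu hf h1
  -- At a convex corner already the first positive mode decays fast enough: π/(2κ) > 1.
  refine h'.cornerDecay (m := 1) hω hu h1 ?_ (fun k hk => hC k (by omega)) hsum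
  rw [Int.cast_one, one_mul, lt_div_iff₀ (by linarith [h.angle_pos])]
  linarith

/-- At a re-entrant corner, the energy decays if the singular mode is not present. -/
theorem IsPolarSector.cornerDecay_of_hasSingCoeff (h : IsPolarSector ω P T ρ κ)
    (hω : IsOpen ω) (hb : Bornology.IsBounded ω) (hu : u ∈ H10 ω ω) (hf : HasLap u f)
    (h0 : VanishesNear P f) (hs : HasSingCoeff P T κ u 0) : CornerDecay u f P := by
  obtain ⟨ρ', h', h1⟩ := h.exists_shrink h0
  obtain ⟨C, hmode, hC, hsum⟩ := h'.exists_coeff hω hb hu hf h1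
  -- Both descriptions of the first mode hold at some common radius, where the power of the radius
  -- is not zero.
  have hC1 : C 1 = 0 := by
    obtain ⟨r, h2, h3⟩ := (hs.and (Ioo_mem_nhdsGT h'.pos)).exists
    have := ae_neBot_Ioo h3.1
    obtain ⟨s, ⟨h4, h5⟩, h6⟩ := ((((ae_restrict_of_ae h2).and (ae_restrict_of_ae (hmode 1)))).and
      (ae_restrict_mem (measurableSet_Ioo (a := 0) (b := r)))).exists
    have h7 := (h4 h6).symm.trans (h5 ⟨h6.1, h6.2.trans h3.2⟩)
    rw [zero_mul, eq_comm] at h7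
    exact (mul_eq_zero.1 h7).resolve_right (Real.rpow_pos_of_pos h6.1 _).ne'
  -- Without the first mode the leading exponent is π/κ, which exceeds 1 since κ < π.
  refine h'.cornerDecay (m := 2) hω hu h1 ?_ (fun k hk => ?_) hsum
  · have := h.angle_pos
    rw [Int.cast_ofNat, ← mul_div_assoc, lt_div_iff₀ (by linarith)]
    linarith [h.angle_lt]
  · rcases (show k ≤ 0 ∨ k = 1 by omega) with hk | rfl
    · exact hC k hk
    · exact hC1

end singular

/-! ### The variational problem -/

section variational

variable {ω : Set Plane} {u v : Jet ω} {f g : L2 ω}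

theorem norm_toL2_sq {φ : Plane → ℝ} (hφ : MemLp φ 2 (volume.restrict ω)) :
    ‖toL2 ω φ‖ ^ 2 = ∫ x in ω, φ x ^ 2 := by
  rw [norm_sq_eq_integral]
  refine integral_congr_ae ?_
  filter_upwards [coeFn_toL2 hφ] with x hx
  rw [hx]

/-- The Poincaré inequality in a bounded open set. -/
theorem H10.exists_poincare (hb : Bornology.IsBounded ω) :
    ∃ C, 0 ≤ C ∧ ∀ u ∈ H10 ω ω, ‖u none‖ ^ 2 ≤ C * ∑ i : Fin 2, ‖u (some i)‖ ^ 2 := by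
  obtain ⟨R, hR⟩ := hb.subset_closedBall (0 : Plane)
  refine ⟨4 * R ^ 2, by positivity, fun u hu => ?_⟩
  refine H10.induction (p := fun u => ‖u none‖ ^ 2 ≤ 4 * R ^ 2 * ∑ i : Fin 2, ‖u (some i)‖ ^ 2)
    (isClosed_le ?_ ?_) (fun φ hφ => ?_) hu
  · exact (Jet.continuous_apply _).norm.pow 2
  · exact continuous_const.mul
      (continuous_finsetSum _ fun i _ => (Jet.continuous_apply _).norm.pow 2)
  let X : Plane →L[ℝ] ℝ := EuclideanSpace.proj 0
  have hX : pd 0 (fun x => X x * φ x) = fun x => X x * pd 0 φ x + φ x := by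
    rw [pd_mul X.differentiable hφ.differentiable]
    have h1 : ∀ x, pd 0 X x = 1 := fun x => by
      rw [pd, X.fderiv]
      simp [X, stdVec]
    ext x
    rw [h1, one_mul]
  -- Integration by parts of x₀φ ∂₀φ yields ∫φ² = -2∫x₀φ ∂₀φ; the coordinate is bounded by R on ω,
  -- and Young's inequality concludes.
  have ibp := integral_mul_pd hφ (X.contDiff.mul hφ.smooth) 0
  rw [hX, ← (hφ.pd 0).setIntegral_mul, ← hφ.setIntegral_mul] at ibp
  have t1 : Integrable (fun x => X x * pd 0 φ x * φ x) (volume.restrict ω) :=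
    ((hφ.smooth_mul (hφ.pd 0).smooth).smooth_mul X.contDiff).integrable ω |>.congr
      (Eventually.of_forall fun x => by ring)
  have t2 : Integrable (fun x => φ x ^ 2) (volume.restrict ω) :=
    ((hφ.smooth_mul hφ.smooth).integrable ω).congr (Eventually.of_forall fun x => by ring)
  have t3 : Integrable (fun x => pd 0 φ x ^ 2) (volume.restrict ω) :=
    (((hφ.pd 0).smooth_mul (hφ.pd 0).smooth).integrable ω).congr
      (Eventually.of_forall fun x => by ring)
  have e1 : ∫ x in ω, X x * φ x * pd 0 φ x = ∫ x in ω, X x * pd 0 φ x * φ x :=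
    integral_congr_ae (Eventually.of_forall fun x => by ring)
  have e2 : ∫ x in ω, (X x * pd 0 φ x + φ x) * φ x =
      (∫ x in ω, X x * pd 0 φ x * φ x) + ∫ x in ω, φ x ^ 2 := by
    rw [← integral_add t1 t2]
    exact integral_congr_ae (Eventually.of_forall fun x => by ring)
  have e3 : ∫ x in ω, -(X x * pd 0 φ x * φ x) ≤
      ∫ x in ω, (1 / 4 * φ x ^ 2 + R ^ 2 * pd 0 φ x ^ 2) := by
    refine integral_mono t1.neg ((t2.const_mul _).add (t3.const_mul _)) fun x => ?_
    change -(X x * pd 0 φ x * φ x) ≤ 1 / 4 * φ x ^ 2 + R ^ 2 * pd 0 φ x ^ 2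
    by_cases hx : x ∈ ω
    · have h1 : |X x| ≤ R := by
        have h2 := hR hx
        rw [mem_closedBall_zero_iff] at h2
        exact (PiLp.norm_apply_le x 0).trans h2
      have h3 : X x ^ 2 ≤ R ^ 2 := sq_le_sq' (abs_le.1 h1).1 (abs_le.1 h1).2
      nlinarith [sq_nonneg (1 / 2 * φ x + X x * pd 0 φ x),
        mul_le_mul_of_nonneg_right h3 (sq_nonneg (pd 0 φ x))]
    · rw [hφ.eq_zero_of_notMem hx, (hφ.pd 0).eq_zero_of_notMem hx]
      simp
  rw [integral_neg, integral_add (t2.const_mul _) (t3.const_mul _), integral_const_mul,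
    integral_const_mul] at e3
  rw [jet_none, norm_toL2_sq (hφ.memLp ω 2)]
  have e4 : ‖toL2 ω (pd 0 φ)‖ ^ 2 ≤ ∑ i : Fin 2, ‖jet ω φ (some i)‖ ^ 2 :=
    Finset.single_le_sum (f := fun i : Fin 2 => ‖jet ω φ (some i)‖ ^ 2)
      (fun _ _ => sq_nonneg _) (Finset.mem_univ 0)
  rw [norm_toL2_sq ((hφ.pd 0).memLp ω 2)] at e4
  have e5 := mul_le_mul_of_nonneg_left e4 (sq_nonneg R)
  linarith

theorem Jet.norm_sq (u : Jet ω) : ‖u‖ ^ 2 = ‖u none‖ ^ 2 + ∑ i : Fin 2, ‖u (some i)‖ ^ 2 := by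
  rw [PiLp.norm_sq_eq_of_L2, Fintype.sum_option]

/-- The bilinear form `(∇ u, ∇ v) + μ (u, v)` on jets. -/
def jetForm (μ : ℝ) (u v : Jet ω) : ℝ :=
  ∑ i : Fin 2, inner ℝ (u (some i)) (v (some i)) + μ * inner ℝ (u none) (v none)

/-- A component of a jet in `H¹₀(ω)`. -/
def H10.comp (ω : Set Plane) (o : Option (Fin 2)) : H10 ω ω →L[ℝ] L2 ω :=
  (PiLp.proj 2 (fun _ : Option (Fin 2) => L2 ω) o : Jet ω →L[ℝ] L2 ω) ∘L (H10 ω ω).subtypeL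

/-- Lax–Milgram; the Poincaré inequality makes the form coercive even for μ = 0, a case used for the
Poisson problem. -/
theorem H10.exists_jetForm_eq (hb : Bornology.IsBounded ω) {μ : ℝ} (hμ : 0 ≤ μ) (f : L2 ω) :
    ∃ u ∈ H10 ω ω, ∀ v ∈ H10 ω ω, jetForm μ u v = inner ℝ f (v none) := by
  obtain ⟨C, C0, hC⟩ := H10.exists_poincare hb
  let b : Option (Fin 2) → H10 ω ω →L[ℝ] H10 ω ω →L[ℝ] ℝ := fun o =>
    ((innerSL ℝ : L2 ω →L[ℝ] L2 ω →L[ℝ] ℝ)).bilinearComp (H10.comp ω o) (H10.comp ω o)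
  let B : H10 ω ω →L[ℝ] H10 ω ω →L[ℝ] ℝ := b (some 0) + b (some 1) + μ • b none
  have hB : ∀ u v : H10 ω ω, B u v = jetForm μ (u : Jet ω) (v : Jet ω) := fun u v => by
    simp [B, b, jetForm, H10.comp, Fin.sum_univ_two]
  have hcoe : IsCoercive B := by
    refine ⟨(C + 1)⁻¹, by positivity, fun u => ?_⟩
    rw [hB, mul_assoc, ← sq, inv_mul_le_iff₀ (by positivity)]
    have h1 := hC u u.2
    have h2 := Jet.norm_sq (u : Jet ω)
    have h3 : 0 ≤ μ * ‖(u : Jet ω) none‖ ^ 2 := by positivity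
    have h4 : ‖u‖ = ‖(u : Jet ω)‖ := rfl
    rw [h4, h2, jetForm]
    simp only [real_inner_self_eq_norm_sq]
    nlinarith
  let F : H10 ω ω →L[ℝ] ℝ := (innerSL ℝ f) ∘L H10.comp ω none
  let y := (InnerProductSpace.toDual ℝ (H10 ω ω)).symm F
  refine ⟨hcoe.continuousLinearEquivOfBilin.symm y, Subtype.coe_prop _, fun v hv => ?_⟩
  have h1 := hcoe.continuousLinearEquivOfBilin_apply
    (hcoe.continuousLinearEquivOfBilin.symm y) ⟨v, hv⟩
  rw [ContinuousLinearEquiv.apply_symm_apply, hB] at h1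
  rw [← h1, InnerProductSpace.toDual_symm_apply]
  simp [F, H10.comp]

theorem hasLap_of_jetForm (h : ∀ v ∈ H10 ω ω, jetForm 0 u v = inner ℝ f (v none)) :
    HasLap u (-f) := fun φ hφ => by
  have := h _ (jet_mem_H10 hφ)
  rw [jetForm, zero_mul, add_zero] at this
  rw [inner_neg_left, neg_neg]
  exact this

theorem H10.exists_hasLap (hb : Bornology.IsBounded ω) (f : L2 ω) :
    ∃ u ∈ H10 ω ω, HasLap u f := by
  obtain ⟨u, hu, h⟩ := H10.exists_jetForm_eq hb le_rfl (-f)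
  exact ⟨u, hu, by simpa using hasLap_of_jetForm h⟩

/-- Stability of the Poisson problem: convergence of the data implies convergence of the solutions
in H¹. -/
theorem H10.exists_norm_le (hb : Bornology.IsBounded ω) :
    ∃ C, ∀ u ∈ H10 ω ω, ∀ f, HasLap u f → ‖u‖ ≤ C * ‖f‖ := by
  obtain ⟨C, C0, hC⟩ := H10.exists_poincare hb
  refine ⟨C + 1, fun u hu f hf => ?_⟩
  have h1 := hf.inner_eq hu
  simp only [real_inner_self_eq_norm_sq] at h1
  have h2 := hC u hu
  have h3 := Jet.norm_sq u
  have h4 := abs_real_inner_le_norm f (u none)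
  have h5 : ‖u none‖ ≤ ‖u‖ := by
    refine le_of_sq_le_sq ?_ (norm_nonneg _)
    rw [h3]
    exact le_add_of_nonneg_right (Finset.sum_nonneg fun _ _ => sq_nonneg _)
  have h6 : ‖u‖ * ‖u‖ ≤ (C + 1) * ‖f‖ * ‖u‖ := by
    have h7 : -inner ℝ f (u none) ≤ ‖f‖ * ‖u‖ :=
      (neg_le_abs _).trans (h4.trans (mul_le_mul_of_nonneg_left h5 (norm_nonneg _)))
    have h8 : ‖u‖ ^ 2 ≤ (C + 1) * ∑ i : Fin 2, ‖u (some i)‖ ^ 2 := by linarith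
    rw [h1] at h8
    nlinarith [mul_le_mul_of_nonneg_left h7 (show 0 ≤ C + 1 by linarith)]
  rcases (norm_nonneg u).eq_or_lt with h0 | h0
  · rw [← h0]
    positivity
  · exact le_of_mul_le_mul_right h6 h0

/-- The orthogonal complement of the classes of test functions is zero, so their span is dense. -/
theorem exists_seq_test (hω : IsOpen ω) (g : L2 ω) : ∃ φ : ℕ → Plane → ℝ,
    (∀ n, IsTestFunction ω (φ n)) ∧ Tendsto (fun n => toL2 ω (φ n)) atTop (𝓝 g) := by
  let S : Submodule ℝ (L2 ω) :=
    { carrier := {w | ∃ φ, IsTestFunction ω φ ∧ w = toL2 ω φ}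
      add_mem' := by
        rintro _ _ ⟨φ, hφ, rfl⟩ ⟨ψ, hψ, rfl⟩
        exact ⟨_, hφ.add hψ, (toL2_add (hφ.memLp ω 2) (hψ.memLp ω 2)).symm⟩
      zero_mem' := ⟨_, IsTestFunction.zero, toL2_zero.symm⟩
      smul_mem' := by
        rintro c _ ⟨φ, hφ, rfl⟩
        exact ⟨_, hφ.const_mul c, (toL2_const_mul (hφ.memLp ω 2) c).symm⟩ }
  have hS : S.topologicalClosure = ⊤ := by
    rw [Submodule.topologicalClosure_eq_top_iff, Submodule.eq_bot_iff]
    intro w hw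
    refine eq_zero_of_inner_test hω fun φ hφ => ?_
    rw [real_inner_comm]
    exact (Submodule.mem_orthogonal _ _).1 hw _ ⟨φ, hφ, rfl⟩
  have hg : g ∈ closure (S : Set (L2 ω)) := by
    change g ∈ S.topologicalClosure
    rw [hS]
    trivial
  obtain ⟨x, hx, hlim⟩ := mem_closure_iff_seq_limit.1 hg
  choose φ hφ e using hx
  exact ⟨φ, hφ, hlim.congr e⟩

/-! ### Regularity of the solutions with data orthogonal to the singular function -/

variable {K : ℕ} [NeZero K] {poly : Polygon Plane K}

theorem IsPolygonalDomain.vertex_notMem (h : IsPolygonalDomain poly ω) (i : Fin K) :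
    poly i ∉ ω := fun hm => by
  have h1 : poly i ∈ frontier ω := by
    rw [h.frontier_eq, Polygon.boundary, mem_iUnion]
    refine ⟨i, ?_⟩
    rw [edgeSet_eq_segment]
    exact left_mem_segment ℝ _ _
  rw [h.isOpen.frontier_eq] at h1
  exact h1.2 hm

theorem IsTestFunction.vanishesNear {φ : Plane → ℝ} (hφ : IsTestFunction ω φ) {P : Plane}
    (hP : P ∉ ω) : VanishesNear P (toL2 ω φ) := by
  obtain ⟨ε, hε, h⟩ := Metric.isOpen_iff.1 (isClosed_tsupport φ).isOpen_compl P
    fun hm => hP (hφ.support hm)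
  refine ⟨ε, hε, ?_⟩
  filter_upwards [coeFn_toL2 (hφ.memLp ω 2)] with x hx hm
  rw [hx]
  exact image_eq_zero_of_notMem_tsupport (h hm)

/-- If the datum is orthogonal to the singular function, then the solution is in `H²(ω)`. -/
theorem hessBound_of_inner_eq_zero (h : IsPolygonalDomain poly ω)
    (hcorner : HasUniqueReentrantCorner poly ω) {ps : L2 ω} (hps : IsSingularHarmonic poly ps)
    (hps0 : ps ≠ 0) (hg : inner ℝ ps g = 0) (hu : u ∈ H10 ω ω) (hug : HasLap u g) :
    HessBound u g := by
  have hω := h.isOpen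
  have hb := h.isBounded
  obtain ⟨i₀, hre, hconv⟩ := hcorner
  obtain ⟨ρ, b, c, κ, hsec, k0, k1⟩ := h.exists_sector_reentrant hre
  obtain ⟨T, hT⟩ := hsec.exists_isPolarSector k0 k1
  -- For data vanishing near the vertices, absence of the singular mode is the only condition. It
  -- gives regularity and orthogonality to p_s at the same time.
  have reg : ∀ {w : Jet ω} {q : L2 ω}, w ∈ H10 ω ω → HasLap w q → (∀ i, VanishesNear (poly i) q) →
      HasSingCoeff (poly i₀) T κ w 0 → HessBound w q ∧ inner ℝ ps q = 0 := by
    intro w q hw hwq hv hs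
    refine regular_of_decay h hps hw hwq fun i => ?_
    by_cases hi : i = i₀
    · rw [hi]
      exact hT.cornerDecay_of_hasSingCoeff hω hb hw hwq (hv i₀) hs
    · obtain ⟨ρ', b', c', κ', hsec', k0', k1'⟩ := h.exists_sector_convex (hconv i hi)
      obtain ⟨T', hT'⟩ := hsec'.exists_isPolarSector k0' (by linarith [Real.pi_pos])
      exact hT'.cornerDecay_of_convex k1' hω hb hw hwq (hv i)
  -- passing to the limit
  have lim : ∀ (w : ℕ → Jet ω) (q : ℕ → L2 ω), (∀ n, w n ∈ H10 ω ω) → (∀ n, HasLap (w n) (q n)) →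
      (∀ n i, VanishesNear (poly i) (q n)) → (∀ n, HasSingCoeff (poly i₀) T κ (w n) 0) →
      Tendsto q atTop (𝓝 g) → HessBound u g := by
    intro w q h1 h2 h3 h4 h5
    obtain ⟨C, hC⟩ := H10.exists_norm_le (ω := ω) hb
    have hlim : Tendsto w atTop (𝓝 u) := by
      rw [tendsto_iff_norm_sub_tendsto_zero] at h5 ⊢
      refine squeeze_zero (fun _ => norm_nonneg _) (fun n => ?_) (by simpa using h5.const_mul C)
      exact hC _ (Submodule.sub_mem _ (h1 n) hu) _ ((h2 n).sub hug)
    refine HessBound.of_tendsto hω (fun n => (reg (h1 n) (h2 n) (h3 n) (h4 n)).1) (fun n m => ?_)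
      hlim h5
    refine (reg (Submodule.sub_mem _ (h1 n) (h1 m)) ((h2 n).sub (h2 m)) (fun i => ?_) ?_).1
    · simpa using (h3 n i).sub_smul (h3 m i) 1
    · simpa using hT.hasSingCoeff_sub_smul hω.measurableSet (h4 n) (h4 m) 1
  choose sol hsol1 hsol2 using fun q : L2 ω => H10.exists_hasLap hb q
  obtain ⟨φ, hφ, hlim⟩ := exists_seq_test hω g
  have van : ∀ {φ : Plane → ℝ}, IsTestFunction ω φ → ∀ i, VanishesNear (poly i) (toL2 ω φ) :=
    fun hφ i => hφ.vanishesNear (h.vertex_notMem i)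
  have coef : ∀ {φ : Plane → ℝ}, IsTestFunction ω φ →
      ∃ C, HasSingCoeff (poly i₀) T κ (sol (toL2 ω φ)) C := fun hφ =>
    hT.exists_hasSingCoeff hω hb (hsol1 _) (hsol2 _) (van hφ i₀)
  -- If the singular mode never occurs for test data, plain density is enough. Otherwise one datum
  -- `f₀` that excites it serves to eliminate it from all the others.
  by_cases hall : ∀ φ, IsTestFunction ω φ → HasSingCoeff (poly i₀) T κ (sol (toL2 ω φ)) 0
  · exact lim (fun n => sol (toL2 ω (φ n))) _ (fun n => hsol1 _) (fun n => hsol2 _)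
      (fun n => van (hφ n)) (fun n => hall _ (hφ n)) hlim
  push Not at hall
  obtain ⟨φ₀, hφ₀, hne⟩ := hall
  obtain ⟨C₀, hC₀⟩ := coef hφ₀
  have hC₀' : C₀ ≠ 0 := fun h0 => hne (h0 ▸ hC₀)
  set f₀ := toL2 ω φ₀ with hf₀
  -- With t = C/C₀ the singular modes cancel. The combination is regular, so its Laplacian is
  -- orthogonal to p_s, which evaluates (p_s, φ).
  have step : ∀ {φ : Plane → ℝ}, IsTestFunction ω φ → ∃ t : ℝ,
      HasSingCoeff (poly i₀) T κ (sol (toL2 ω φ) - t • sol f₀) 0 ∧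
      inner ℝ ps (toL2 ω φ) = t * inner ℝ ps f₀ := by
    intro φ hφ
    obtain ⟨C, hC⟩ := coef hφ
    have h1 := hT.hasSingCoeff_sub_smul hω.measurableSet hC hC₀ (C / C₀)
    rw [div_mul_cancel₀ _ hC₀', sub_self] at h1
    refine ⟨C / C₀, h1, ?_⟩
    have h2 := (reg (Submodule.sub_mem _ (hsol1 (toL2 ω φ)) (Submodule.smul_mem _ _ (hsol1 f₀)))
      ((hsol2 (toL2 ω φ)).sub ((hsol2 f₀).smul (C / C₀)))
      (fun i => (van hφ i).sub_smul (van hφ₀ i) _) h1).2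
    rw [inner_sub_right, inner_smul_right] at h2
    linarith
  -- Otherwise p_s would be orthogonal to every test function.
  have hps₀ : inner ℝ ps f₀ ≠ 0 := fun h0 => by
    refine hps0 (eq_zero_of_inner_test hω fun φ hφ => ?_)
    obtain ⟨t, -, ht⟩ := step hφ
    rw [ht, h0, mul_zero]
  choose t ht1 ht2 using fun n => step (hφ n)
  -- The corrections die out because t_n is proportional to (p_s, φ_n), which tends to (p_s, g) = 0.
  have tlim : Tendsto t atTop (𝓝 0) := by
    have h1 : Tendsto (fun n => inner ℝ ps (toL2 ω (φ n)) / inner ℝ ps f₀) atTop (𝓝 0) := by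
      have := (tendsto_const_nhds (x := ps) |>.inner hlim).div_const (inner ℝ ps f₀)
      rwa [hg, zero_div] at this
    refine h1.congr fun n => ?_
    rw [ht2 n, mul_div_cancel_right₀ _ hps₀]
  refine lim (fun n => sol (toL2 ω (φ n)) - t n • sol f₀) (fun n => toL2 ω (φ n) - t n • f₀)
    (fun n => Submodule.sub_mem _ (hsol1 _) (Submodule.smul_mem _ _ (hsol1 _)))
    (fun n => (hsol2 _).sub ((hsol2 _).smul _))
    (fun n i => (van (hφ n) i).sub_smul (van hφ₀ i) _) ht1 ?_
  simpa using hlim.sub (tlim.smul_const f₀)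

end variational

/-! ### The coupled system -/

section coupled

variable {ω : Set Plane} {μ : ℝ} {u v w x y p : Jet ω} {f ps φs : L2 ω}

theorem memH10_iff_exists (hω : IsOpen ω) {u : L2 ω} :
    MemH10 u ↔ ∃ x ∈ H10 ω ω, x none = u := by
  refine ⟨fun h => ⟨_, memH10_iff.1 h, rfl⟩, ?_⟩
  rintro ⟨x, hx, rfl⟩
  exact H10.memH10 hω hx

theorem aForm_none (hω : IsOpen ω) (hx : x ∈ H10 ω ω) (hy : y ∈ H10 ω ω) :
    aForm μ (x none) (y none) = jetForm μ x y := by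
  simp only [aForm, gradInner, jetForm, H10.weakPartial_eq hω hx, H10.weakPartial_eq hω hy]

theorem seminormH1_sq (hω : IsOpen ω) (hx : x ∈ H10 ω ω) :
    seminormH1 (x none) ^ 2 = ∑ i : Fin 2, ‖x (some i)‖ ^ 2 := by
  rw [seminormH1, Real.sq_sqrt (Finset.sum_nonneg fun _ _ => sq_nonneg _)]
  simp only [H10.weakPartial_eq hω hx]

theorem jetForm_add_left : jetForm μ (x + y) v = jetForm μ x v + jetForm μ y v := by
  simp only [jetForm, PiLp.add_apply, inner_add_left, Finset.sum_add_distrib]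
  ring

theorem jetForm_smul_left (c : ℝ) : jetForm μ (c • x) v = c * jetForm μ x v := by
  simp only [jetForm, PiLp.smul_apply, real_inner_smul_left, ← Finset.mul_sum]
  ring

theorem jetForm_sub_left : jetForm μ (x - y) v = jetForm μ x v - jetForm μ y v := by
  simp only [jetForm, PiLp.sub_apply, inner_sub_left, Finset.sum_sub_distrib]
  ring

theorem H10.eq_zero_of_jetForm (hb : Bornology.IsBounded ω) (hμ : 0 ≤ μ) (hx : x ∈ H10 ω ω)
    (h : jetForm μ x x = 0) : x = 0 := by
  obtain ⟨C, C0, hC⟩ := H10.exists_poincare hb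
  have h1 := hC x hx
  have h2 := Jet.norm_sq x
  simp only [jetForm, real_inner_self_eq_norm_sq] at h
  have h3 : 0 ≤ μ * ‖x none‖ ^ 2 := by positivity
  have h4 : 0 ≤ ∑ i : Fin 2, ‖x (some i)‖ ^ 2 := Finset.sum_nonneg fun _ _ => sq_nonneg _
  have h5 : ∑ i : Fin 2, ‖x (some i)‖ ^ 2 = 0 := by linarith
  rw [h5, mul_zero] at h1
  rw [h5, add_zero] at h2
  have h6 : ‖x‖ ^ 2 = 0 := le_antisymm (by linarith) (sq_nonneg _)
  exact norm_eq_zero.1 (pow_eq_zero_iff two_ne_zero |>.1 h6)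

/-- The jet whose norm is the energy norm. -/
def energyJet (μ : ℝ) (x : Jet ω) : Jet ω := mkJet (√μ • x none) fun i => x (some i)

theorem energyJet_sub_smul (c : ℝ) :
    energyJet μ (x - c • y) = energyJet μ x - c • energyJet μ y := by
  refine Jet.ext ?_ fun i => ?_
  · simp [energyJet, smul_sub, smul_comm c]
  · simp [energyJet]

theorem norm_energyJet_sq (hμ : 0 ≤ μ) : ‖energyJet μ x‖ ^ 2 = jetForm μ x x := by
  rw [Jet.norm_sq, jetForm]
  simp only [energyJet, mkJet_none, mkJet_some, real_inner_self_eq_norm_sq, norm_smul, mul_pow,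
    Real.norm_eq_abs, sq_abs, Real.sq_sqrt hμ]
  ring

theorem energyNorm_none (hω : IsOpen ω) (hμ : 0 ≤ μ) (hx : x ∈ H10 ω ω) :
    energyNorm μ (x none) = ‖energyJet μ x‖ := by
  rw [energyNorm, aForm_none hω hx hx, ← norm_energyJet_sq hμ, Real.sqrt_sq (norm_nonneg _)]

/-- The coupled system, expressed through the solution `w` of the uncoupled problem. -/
theorem isCoupledSolution_iff (hω : IsOpen ω) (hb : Bornology.IsBounded ω) (hμ : 0 ≤ μ)
    (hp : p ∈ H10 ω ω) (hpl : HasLap p (-ps)) (hw : w ∈ H10 ω ω)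
    (hwf : ∀ v ∈ H10 ω ω, jetForm μ w v = inner ℝ f (v none)) {u : L2 ω} {c : ℝ} :
    IsCoupledSolution μ f ps (p none) u c ↔
      u = w none - c • p none ∧ c * ‖ps‖ ^ 2 = inner ℝ (f - μ • w none) ps := by
  -- The equation of φ_s tested with φ_s itself.
  have hpp : seminormH1 (p none) ^ 2 = inner ℝ (p none) ps := by
    have h1 := hpl.inner_eq hp
    simp only [real_inner_self_eq_norm_sq, inner_neg_left, neg_neg] at h1
    rw [seminormH1_sq hω hp, h1, real_inner_comm]
  -- The term μ c |φ_s|₁² cancels against -μ c (φ_s, p_s), so the equation for c no longer involves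
  -- φ_s.
  have key : u = w none - c • p none →
      ((‖ps‖ ^ 2 + μ * seminormH1 (p none) ^ 2) * c + μ * inner ℝ u ps = inner ℝ f ps ↔
        c * ‖ps‖ ^ 2 = inner ℝ (f - μ • w none) ps) := by
    rintro rfl
    rw [hpp, inner_sub_left, inner_sub_left, real_inner_smul_left, real_inner_smul_left]
    constructor <;> intro h <;> linarith
  have hreg : MemH10 u → ((∀ v, MemH10 v → aForm μ u v + c * aForm μ (p none) v = inner ℝ f v) ↔
      u = w none - c • p none) := by
    intro hu
    obtain ⟨x, hx, rfl⟩ := (memH10_iff_exists hω).1 hu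
    constructor
    · intro h
      have hd : x + c • p - w ∈ H10 ω ω :=
        Submodule.sub_mem _ (Submodule.add_mem _ hx (Submodule.smul_mem _ _ hp)) hw
      have h0 := H10.eq_zero_of_jetForm hb hμ hd (by
        have h1 := h _ (H10.memH10 hω hd)
        rw [aForm_none hω hx hd, aForm_none hω hp hd] at h1
        rw [jetForm_sub_left, jetForm_add_left, jetForm_smul_left, hwf _ hd, h1, sub_self])
      rw [sub_eq_zero] at h0
      rw [← h0]
      simp
    · intro h v hv
      obtain ⟨y, hy, rfl⟩ := (memH10_iff_exists hω).1 hv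
      have hd : w - c • p ∈ H10 ω ω := Submodule.sub_mem _ hw (Submodule.smul_mem _ _ hp)
      have e : x none = (w - c • p) none := by simpa using h
      rw [e, aForm_none hω hd hy, aForm_none hω hp hy, jetForm_sub_left, jetForm_smul_left,
        hwf y hy]
      ring
  constructor
  · rintro ⟨h1, h2, h3⟩
    have h4 := (hreg h1).1 h2
    exact ⟨h4, (key h4).1 h3⟩
  · rintro ⟨h1, h2⟩
    have hu : MemH10 u := (memH10_iff_exists hω).2
      ⟨w - c • p, Submodule.sub_mem _ hw (Submodule.smul_mem _ _ hp), by simpa using h1.symm⟩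
    exact ⟨hu, (hreg hu).2 h1, (key h1).2 h2⟩

/-- Testing with `w` gives (f, w) = |w|₁² + μ‖w‖², so ‖f‖² - ‖f - μw‖² = 2μ|w|₁² + μ²‖w‖² ≥ 0. -/
theorem norm_sub_smul_le_of_jetForm (hμ : 0 ≤ μ) (hw : w ∈ H10 ω ω)
    (hwf : ∀ v ∈ H10 ω ω, jetForm μ w v = inner ℝ f (v none)) : ‖f - μ • w none‖ ≤ ‖f‖ := by
  refine le_of_sq_le_sq ?_ (norm_nonneg _)
  have h1 := hwf w hw
  simp only [jetForm, real_inner_self_eq_norm_sq] at h1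
  have h2 : 0 ≤ ∑ i : Fin 2, ‖w (some i)‖ ^ 2 := Finset.sum_nonneg fun _ _ => sq_nonneg _
  have h3 : 0 ≤ μ * ‖w none‖ ^ 2 := by positivity
  rw [norm_sub_sq_real, norm_smul, real_inner_smul_right, Real.norm_of_nonneg hμ]
  nlinarith [mul_nonneg hμ h2, mul_nonneg hμ h3]

/-- From ‖w‖_a² = (f, w) ≤ ‖f‖ ‖w‖ and √μ ‖w‖ ≤ ‖w‖_a. -/
theorem norm_energyJet_le_of_jetForm (hμ : 0 < μ) (hw : w ∈ H10 ω ω)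
    (hwf : ∀ v ∈ H10 ω ω, jetForm μ w v = inner ℝ f (v none)) :
    ‖energyJet μ w‖ ≤ 1 / √μ * ‖f‖ := by
  have hs : 0 < √μ := Real.sqrt_pos.2 hμ
  have h1 : √μ * ‖w none‖ ≤ ‖energyJet μ w‖ := by
    refine le_trans (le_of_eq ?_) (PiLp.norm_apply_le (energyJet μ w) none)
    simp [energyJet, norm_smul, abs_of_pos hs]
  have h2 : ‖energyJet μ w‖ ^ 2 ≤ ‖f‖ * ‖w none‖ := by
    rw [norm_energyJet_sq hμ.le, hwf w hw]
    exact real_inner_le_norm _ _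
  rw [one_div, inv_mul_eq_div, le_div_iff₀ hs]
  rcases (norm_nonneg (energyJet μ w)).eq_or_lt with h0 | h0
  · rw [← h0, zero_mul]
    exact norm_nonneg _
  · refine le_of_mul_le_mul_right ?_ h0
    nlinarith [mul_le_mul_of_nonneg_left h1 (norm_nonneg f), mul_le_mul_of_nonneg_left h2 hs.le]

/-- Poincaré gives |φ_s|₁ ≤ |C| ‖p_s‖ and ‖φ_s‖ ≤ C² ‖p_s‖, so ‖φ_s‖_a² ≤ (C² + μC⁴) ‖p_s‖². The
weight 2/5 is large enough for the cross term 8/5 C² of the square to cover C², and small enough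
that 1 + 2/5 ≤ √2. -/
theorem norm_energyJet_le_of_hasLap (hω : IsOpen ω) (hμ : 0 < μ) (hp : p ∈ H10 ω ω)
    (hpl : HasLap p (-ps)) {C : ℝ} (hC : IsPoincareConstant ω C) :
    ‖energyJet μ p‖ ≤ (2 * √μ * C ^ 2 + 2 / 5 * (1 / √μ)) * ‖ps‖ := by
  have hs : 0 < √μ := Real.sqrt_pos.2 hμ
  set G := seminormH1 (p none) with hG
  have G0 : 0 ≤ G := Real.sqrt_nonneg _
  have h1 : ‖p none‖ ≤ |C| * G :=
    (hC _ (H10.memH10 hω hp)).trans (mul_le_mul_of_nonneg_right (le_abs_self C) G0)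
  have h2 : G ^ 2 = inner ℝ ps (p none) := by
    have h := hpl.inner_eq hp
    simp only [real_inner_self_eq_norm_sq, inner_neg_left, neg_neg] at h
    rw [hG, seminormH1_sq hω hp, h]
  have h3 : G ≤ |C| * ‖ps‖ := by
    rcases G0.eq_or_lt with h0 | h0
    · rw [← h0]
      positivity
    · refine le_of_mul_le_mul_right ?_ h0
      have := (real_inner_le_norm ps (p none)).trans
        (mul_le_mul_of_nonneg_left h1 (norm_nonneg ps))
      nlinarith
  have h4 : ‖p none‖ ≤ C ^ 2 * ‖ps‖ := by
    refine h1.trans ((mul_le_mul_of_nonneg_left h3 (abs_nonneg C)).trans (le_of_eq ?_))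
    rw [← mul_assoc, abs_mul_abs_self, sq]
  have h5 : ‖energyJet μ p‖ ^ 2 = G ^ 2 + μ * ‖p none‖ ^ 2 := by
    rw [norm_energyJet_sq hμ.le, hG, seminormH1_sq hω hp, jetForm]
    simp only [real_inner_self_eq_norm_sq]
  have h6 : G ^ 2 ≤ C ^ 2 * ‖ps‖ ^ 2 := by
    have := pow_le_pow_left₀ G0 h3 2
    rwa [mul_pow, sq_abs] at this
  have h7 : ‖p none‖ ^ 2 ≤ C ^ 4 * ‖ps‖ ^ 2 := by
    have := pow_le_pow_left₀ (norm_nonneg _) h4 2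
    rwa [mul_pow, ← pow_mul] at this
  refine le_of_sq_le_sq ?_ (by positivity)
  have h8 : (2 * √μ * C ^ 2 + 2 / 5 * (1 / √μ)) ^ 2 =
      4 * μ * C ^ 4 + 8 / 5 * C ^ 2 + 4 / 25 * (1 / √μ) ^ 2 := by
    have e1 : √μ ^ 2 = μ := Real.sq_sqrt hμ.le
    have e2 : √μ * (1 / √μ) = 1 := mul_one_div_cancel hs.ne'
    linear_combination 4 * C ^ 4 * e1 + 8 / 5 * C ^ 2 * e2
  rw [h5, mul_pow, h8]
  have h9 : 0 ≤ (1 / √μ) ^ 2 * ‖ps‖ ^ 2 := by positivity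
  have h10 : 0 ≤ μ * (C ^ 4 * ‖ps‖ ^ 2) := by positivity
  have h11 : 0 ≤ C ^ 2 * ‖ps‖ ^ 2 := by positivity
  nlinarith [mul_le_mul_of_nonneg_left h7 hμ.le]

end coupled

end

/-! ### The theorem: existence, uniqueness, energy bound and regularity. -/

theorem mainTheorem4 {K : ℕ} [NeZero K] (poly : Polygon Plane K) (ω : Set Plane)
    (hω : IsPolygonalDomain poly ω) (hcorner : HasUniqueReentrantCorner poly ω)
    (ps : L2 ω) (hps : IsSingularHarmonic poly ps) (hps0 : ps ≠ 0)
    (φs : L2 ω) (hφs : MemH10 φs) (hφs_eq : HasDistribLaplacian φs (-ps))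
    (μ : ℝ) (hμ : 0 ≤ μ) (f : L2 ω) :
    (∃! s : L2 ω × ℝ, IsCoupledSolution μ f ps φs s.1 s.2) ∧
    ∀ (u : L2 ω) (c : ℝ), IsCoupledSolution μ f ps φs u c →
      (0 < μ → ∀ CP : ℝ, IsPoincareConstant ω CP →
        energyNorm μ u ≤ √2 * (2 * √μ * CP ^ 2 + 1 / √μ) * ‖f‖) ∧
      |c| ≤ 2 * (‖f‖ / ‖ps‖) ∧
      MemH2 u ∧ seminormH2 u ≤ 4 * ‖f‖ := by
  have ho := hω.isOpen
  have hb := hω.isBounded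
  obtain ⟨p, hp, rfl⟩ := (memH10_iff_exists ho).1 hφs
  have hpl : HasLap p (-ps) :=
    (hasDistribLaplacian_iff_hasLap fun i => H10.hasWeakPartial hp i).1 hφs_eq
  obtain ⟨w, hw, hwf⟩ := H10.exists_jetForm_eq hb hμ f
  have hiff : ∀ {u : L2 ω} {c : ℝ}, IsCoupledSolution μ f ps (p none) u c ↔
      u = w none - c • p none ∧ c * ‖ps‖ ^ 2 = inner ℝ (f - μ • w none) ps := fun {_ _} =>
    isCoupledSolution_iff ho hb hμ hp hpl hw hwf
  have hn : 0 < ‖ps‖ := norm_pos_iff.2 hps0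
  have hn2 : ‖ps‖ ^ 2 ≠ 0 := by positivity
  have hfw : ‖f - μ • w none‖ ≤ ‖f‖ := norm_sub_smul_le_of_jetForm hμ hw hwf
  refine ⟨?_, fun u c hs => ?_⟩
  · let c := inner ℝ (f - μ • w none) ps / ‖ps‖ ^ 2
    refine ⟨(w none - c • p none, c), hiff.2 ⟨rfl, div_mul_cancel₀ _ hn2⟩, ?_⟩
    rintro ⟨u, d⟩ hs
    obtain ⟨h1, h2⟩ := hiff.1 hs
    have h3 : d = c := (eq_div_iff hn2).2 h2
    rw [← h3]
    exact Prod.ext h1 rfl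
  obtain ⟨h1, h2⟩ := hiff.1 hs
  have hx : w - c • p ∈ H10 ω ω := Submodule.sub_mem _ hw (Submodule.smul_mem _ _ hp)
  have hc : |c| * ‖ps‖ ≤ ‖f‖ := by
    refine le_of_mul_le_mul_right ?_ hn
    have h3 := (abs_real_inner_le_norm (f - μ • w none) ps).trans
      (mul_le_mul_of_nonneg_right hfw hn.le)
    rw [← h2, abs_mul, abs_of_nonneg (sq_nonneg ‖ps‖)] at h3
    linarith
  have hu : u = (w - c • p) none := by simpa using h1
  rw [hu]
  refine ⟨fun hμ' CP hCP => ?_, ?_, ?_⟩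
  · rw [energyNorm_none ho hμ hx, energyJet_sub_smul]
    have h3 := norm_energyJet_le_of_jetForm hμ' hw hwf
    have h4 := norm_energyJet_le_of_hasLap ho hμ' hp hpl hCP
    set A := 2 * √μ * CP ^ 2
    set B := 1 / √μ
    have hA : 0 ≤ A := by positivity
    have hB : 0 ≤ B := by positivity
    have h5 : |c| * ‖energyJet μ p‖ ≤ (A + 2 / 5 * B) * ‖f‖ := by
      have h6 := mul_le_mul_of_nonneg_left h4 (abs_nonneg c)
      have h7 := mul_le_mul_of_nonneg_left hc (show 0 ≤ A + 2 / 5 * B by positivity)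
      linarith
    -- `w` contributes B and c φ_s contributes A + 2/5 B, in total A + 7/5 B, which is at most √2 (A
    -- + B).
    have h8 : (7 / 5 : ℝ) ≤ √2 := Real.le_sqrt_of_sq_le (by norm_num)
    calc ‖energyJet μ w - c • energyJet μ p‖ ≤ ‖energyJet μ w‖ + |c| * ‖energyJet μ p‖ := by
          rw [← Real.norm_eq_abs, ← norm_smul]
          exact norm_sub_le _ _
      _ ≤ (A + 7 / 5 * B) * ‖f‖ := by linarith
      _ ≤ √2 * (A + B) * ‖f‖ := by
          refine mul_le_mul_of_nonneg_right ?_ (norm_nonneg f)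
          nlinarith
  · rw [← mul_div_assoc, le_div_iff₀ hn]
    linarith [norm_nonneg f]
  -- The equation for c makes `g` the orthogonal projection of f - μ w onto the complement of p_s;
  -- therefore ‖g‖ ≤ ‖f - μ w‖, and the regularity theorem applies to -g, the Laplacian of u.
  · set g := f - μ • w none - c • ps with hg
    have hgo : inner ℝ ps g = 0 := by
      rw [hg, inner_sub_right, real_inner_comm, ← h2, real_inner_smul_right,
        real_inner_self_eq_norm_sq, sub_self]
    have hgn : ‖g‖ ≤ ‖f‖ := by
      refine le_trans (le_of_sq_le_sq ?_ (norm_nonneg _)) hfw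
      have h3 : f - μ • w none = g + c • ps := by simp [hg]
      rw [h3, norm_add_sq_real, real_inner_smul_right, real_inner_comm, hgo]
      nlinarith [sq_nonneg ‖c • ps‖]
    have hwl : HasLap w (-(f - μ • w none)) := hasLap_of_jetForm fun v hv => by
      rw [inner_sub_left, ← hwf v hv, jetForm, jetForm, real_inner_smul_left]
      ring
    have hxl : HasLap (w - c • p) (-g) := by
      have h3 := hwl.sub (hpl.smul c)
      have h4 : -(f - μ • w none) - c • -ps = -g := by
        rw [hg, smul_neg]
        abel
      rwa [h4] at h3
    have hH := hessBound_of_inner_eq_zero hω hcorner hps hps0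
      (by rw [inner_neg_right, hgo, neg_zero]) hx hxl
    have hj := H10.isWeakJet hx
    refine ⟨?_, ?_⟩
    · obtain ⟨H, hH1, -⟩ := hH
      exact hH1.memH2 ho hj
    · have h3 := hH.seminormH2_le ho hj
      rw [norm_neg] at h3
      linarith [norm_nonneg f]
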